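/- Manifolds are smooth, finite-dimensional, Hausdorff and paracompact; let $M$ be a manifold. A submersion $\pi:Y\to M$ is a smooth surjection from a manifold $Y$ whose differential is everywhere surjective, and $Y^{[2]}=Y\times_M Y$. Write $d\log f=-i f^{-1}df$ for the real 1-form of a $U(1)$-valued function $f$. A bundle 0-gerbe $(g,Y,M)$ is a submersion $Y\to M$ with a smooth $g:Y^{[2]}\to U(1)$ such that $g(y_1,y_2)g(y_2,y_3)=g(y_1,y_3)$. It is trivial if $g(y_1,y_2)=h(y_1)^{-1}h(y_2)$ for some smooth $h:Y\to U(1)$. Its dual is $(g^{-1},Y,M)$, and the product is $(g,Y,M)\otimes(g',Y',M)=(gg',Y\times_M Y',M)$. An isomorphism is a diffeomorphism over $M$ that is compatible with the functions $g$. Stable isomorphism is the equivalence relation generated by the pairs $(A,B)$ such that $A\cong B\otimes T$ for some trivial $T$. A connection on $(g,Y,M)$ is a real 1-form $A$ on $Y$ with $\pi_1^*A-\pi_2^*A=d\log g$ on $Y^{[2]}$, where $\pi_1(y_1,y_2)=y_2$ and $\pi_2(y_1,y_2)=y_1$. The dual of $(g;A)$ is $(g^{-1};-A)$, the product is $(g;A)\otimes(g';A')=(gg';A+A')$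 (with pulled back forms), and isomorphisms have to preserve the connections. $(g;A)$ is $D$-trivial if there is a smooth $h:Y\to U(1)$ with $g(y_1,y_2)=h(y_1)^{-1}h(y_2)$ and $d\log h=A$. $D$-stable isomorphism is the equivalence relation generated by the pairs $(\mathcal A,\mathcal B)$ such that $\mathcal A\cong\mathcal B\otimes\mathcal T$ for some $D$-trivial $\mathcal T$. Let $\underline{U(1)}_M$ be the sheaf of smooth $U(1)$-valued functions, $\Omega^1_M$ the sheaf of real smooth 1-forms, and $\mathcal D^1$ the complex of sheaves $\underline{U(1)}_M\xrightarrow{d\log}\Omega^1_M$ in degrees $0$ and $1$. Proposition. (1) Products of bundle 0-gerbes over $M$ exist, and $A$, $B$ are stably isomorphic if and only if $A\otimes B^*$ is trivial, where $B^*$ is the dual of $B$. The product makes the set of stable isomorphism classes into an abelian group, in which the identity is the class of the trivial bundle 0-gerbes and the inverse is given by the dual. This group is isomorphic to the sheaf cohomology group $H^1(M,\underline{U(1)}_M)$. Consequently it is isomorphic to $H^2(M,\mathbb Z)$ (the cohomology of the constant sheaf), and to the group of isomorphism classes of smooth principal $U(1)$-bundles over $M$ under the product $P\otimes Q=(P\times_M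 Q)/U(1)$. (2) Products of bundle 0-gerbes with connection over $M$ exist, and $\mathcal A$, $\mathcal B$ are $D$-stably isomorphic if and only if $\mathcal A\otimes\mathcal B^*$ is $D$-trivial. The product makes the set of $D$-stable isomorphism classes of bundle 0-gerbes with connection into an abelian group, in which the identity is the class of the $D$-trivial ones and the inverse is given by the dual. This group is isomorphic to the hypercohomology group $H^1(M,\mathcal D^1)$. -/

import Mathlib

open CategoryTheory TopologicalSpace
open scoped Manifold ContDiff

universe u

noncomputable section

/-! ### Smooth 1-forms and logarithmic derivatives -/

section Forms

variable (n : ℕ) {M : Type u} [TopologicalSpace M] [ChartedSpace (EuclideanSpace ℝ (Fin n)) M]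

/-- A covector at a point, as a point of the total space of the cotangent bundle `T^*M`. -/
abbrev covector (x : M) (a : TangentSpace (𝓡 n) x →L[ℝ] ℝ) :
    Bundle.TotalSpace (EuclideanSpace ℝ (Fin n) →L[ℝ] ℝ)
      (fun y : M => TangentSpace (𝓡 n) y →L[ℝ] ℝ) := ⟨x, a⟩

/-- The real 1-form `d log f = -i f⁻¹ df` of a function `f : M → U(1)`;
it is `dθ` when `f = exp (i θ)`. -/
def circleDlog (f : M → Circle) (x : M) : TangentSpace (𝓡 n) x →L[ℝ] ℝ :=
  (Complex.imCLM ∘L (ContinuousLinearMap.mul ℝ ℂ (starRingEnd ℂ (f x)))) ∘L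
    (mfderiv (𝓡 n) 𝓘(ℝ, ℂ) (fun y => (f y : ℂ)) x)

theorem contMDiff_circle_coe : ContMDiff (𝓡 1) 𝓘(ℝ, ℂ) ∞ (fun z : Circle => (z : ℂ)) := by
  have : Fact (Module.finrank ℝ ℂ = 1 + 1) := ⟨Complex.finrank_real_complex⟩
  exact contMDiff_coe_sphere (n := 1) (E := ℂ)

theorem contMDiffAt_circleDlog [IsManifold (𝓡 n) ∞ M] {f : M → Circle} {x : M}
    (hf : ContMDiffAt (𝓡 n) (𝓡 1) ∞ f x) :
    ContMDiffAt (𝓡 n) ((𝓡 n).prod 𝓘(ℝ, EuclideanSpace ℝ (Fin n) →L[ℝ] ℝ)) ∞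
      (fun y : M => covector n y (circleDlog n f y)) x := by
  have hc : ContMDiffAt (𝓡 n) 𝓘(ℝ, ℂ) ∞ (fun y => (f y : ℂ)) x :=
    (contMDiff_circle_coe (f x)).comp x hf
  have this := hc.mfderiv_const (m := ∞) le_rfl
  rw [contMDiffAt_hom_bundle (E₂ := Bundle.Trivial M ℝ)]
  refine ⟨contMDiffAt_id, ?_⟩
  have hL : ContMDiffAt (𝓡 n) 𝓘(ℝ, ℂ →L[ℝ] ℝ) ∞ (fun y => Complex.imCLM ∘L
      ContinuousLinearMap.mul ℝ ℂ (starRingEnd ℂ (f y))) x :=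
    ((ContinuousLinearMap.compL ℝ ℂ ℂ ℝ Complex.imCLM ∘L ContinuousLinearMap.mul ℝ ℂ ∘L
      (Complex.conjCLE : ℂ →L[ℝ] ℂ)).contDiff.contMDiff (f x : ℂ)).comp x hc
  refine (hL.clm_comp this).congr_of_eventuallyEq (Filter.Eventually.of_forall fun y => ?_)
  ext v
  have e : Bundle.Trivialization.continuousLinearMapAt ℝ
      (trivializationAt ℝ (Bundle.Trivial M ℝ) x) y = ContinuousLinearMap.id ℝ ℝ :=
    Bundle.Trivial.continuousLinearMapAt_trivialization ℝ M ℝ y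
  simp only [inTangentCoordinates, ContinuousLinearMap.inCoordinates, circleDlog,
    TangentBundle.continuousLinearMapAt_model_space]
  exact DFunLike.congr_fun e _

theorem circleDlog_mul {f g : M → Circle} {x : M}
    (hf : ContMDiffAt (𝓡 n) (𝓡 1) ∞ f x) (hg : ContMDiffAt (𝓡 n) (𝓡 1) ∞ g x) :
    circleDlog n (fun y => f y * g y) x = circleDlog n f x + circleDlog n g x := by
  have hf' : MDifferentiableAt (𝓡 n) 𝓘(ℝ, ℂ) (fun y => (f y : ℂ)) x :=
    ((contMDiff_circle_coe (f x)).comp x hf).mdifferentiableAt (by simp)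
  have hg' : MDifferentiableAt (𝓡 n) 𝓘(ℝ, ℂ) (fun y => (g y : ℂ)) x :=
    ((contMDiff_circle_coe (g x)).comp x hg).mdifferentiableAt (by simp)
  have h : mfderiv (𝓡 n) 𝓘(ℝ, ℂ) (fun y => ((f y * g y : Circle) : ℂ)) x = _ :=
    (hf'.hasMFDerivAt.mul hg'.hasMFDerivAt).mfderiv
  ext v
  have e1 : starRingEnd ℂ (f x : ℂ) * (f x : ℂ) = 1 := by
    rw [← Complex.normSq_eq_conj_mul_self]; simp
  have e2 : starRingEnd ℂ (g x : ℂ) * (g x : ℂ) = 1 := by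
    rw [← Complex.normSq_eq_conj_mul_self]; simp
  have key : ∀ a b : ℂ, starRingEnd ℂ ((f x * g x : Circle) : ℂ) * (f x * b + g x * a) =
      starRingEnd ℂ (f x : ℂ) * a + starRingEnd ℂ (g x : ℂ) * b := by
    intro a b
    rw [Circle.coe_mul, map_mul]
    linear_combination (starRingEnd ℂ (g x : ℂ) * b) * e1 + (starRingEnd ℂ (f x : ℂ) * a) * e2
  unfold circleDlog
  rw [h]
  exact (congrArg Complex.im (key _ _)).trans (Complex.add_im _ _)

theorem circleDlog_congr {f g : M → Circle} {x : M} (h : f =ᶠ[nhds x] g) :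
    circleDlog n f x = circleDlog n g x := by
  have h1 : (fun y => (f y : ℂ)) =ᶠ[nhds x] (fun y => (g y : ℂ)) := by
    filter_upwards [h] with y hy
    rw [hy]
  unfold circleDlog
  rw [h1.mfderiv_eq, h.eq_of_nhds]

theorem contMDiff_covector_neg [IsManifold (𝓡 n) ∞ M]
    {a : ∀ x : M, TangentSpace (𝓡 n) x →L[ℝ] ℝ}
    (ha : ContMDiff (𝓡 n) ((𝓡 n).prod 𝓘(ℝ, EuclideanSpace ℝ (Fin n) →L[ℝ] ℝ)) ∞
      fun x : M => covector n x (a x)) :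
    ContMDiff (𝓡 n) ((𝓡 n).prod 𝓘(ℝ, EuclideanSpace ℝ (Fin n) →L[ℝ] ℝ)) ∞
      fun x : M => covector n x (-a x) := by
  intro x
  have ha := ha x
  rw [contMDiffAt_hom_bundle (E₂ := Bundle.Trivial M ℝ)] at ha ⊢
  refine ⟨ha.1, ha.2.neg.congr_of_eventuallyEq (Filter.Eventually.of_forall fun y => ?_)⟩
  ext v
  exact map_neg (Bundle.Trivialization.continuousLinearMapAt ℝ
    (trivializationAt ℝ (Bundle.Trivial M ℝ) x) y) _

theorem hasMFDerivWithinAt_conj {E H N : Type*} [NormedAddCommGroup E] [NormedSpace ℝ E]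
    [TopologicalSpace H] {I : ModelWithCorners ℝ E H} [TopologicalSpace N] [ChartedSpace H N]
    {g : N → Circle} {s : Set N} {x : N} {D : TangentSpace I x →L[ℝ] ℂ}
    (hD : HasMFDerivWithinAt I 𝓘(ℝ, ℂ) (fun y => (g y : ℂ)) s x D) :
    HasMFDerivWithinAt I 𝓘(ℝ, ℂ) (fun y => (((g y)⁻¹ : Circle) : ℂ)) s x
      ((Complex.conjCLE : ℂ →L[ℝ] ℂ).comp D) := by
  have hc := ((Complex.conjCLE : ℂ →L[ℝ] ℂ).hasMFDerivAt
    (x := (g x : ℂ))).comp_hasMFDerivWithinAt x hD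
  have e : (fun y => (((g y)⁻¹ : Circle) : ℂ)) =
      (Complex.conjCLE : ℂ →L[ℝ] ℂ) ∘ fun y => (g y : ℂ) := by
    funext y
    exact Circle.coe_inv_eq_conj _
  rw [e]
  exact hc

theorem contMDiff_of_locally {E' H' N : Type*} [NormedAddCommGroup E'] [NormedSpace ℝ E']
    [TopologicalSpace H'] {I' : ModelWithCorners ℝ E' H'} [TopologicalSpace N] [ChartedSpace H' N]
    {U : Opens M} (f : U → N)
    (h : ∀ x : U, ∃ (V : Opens M) (_ : x.1 ∈ V) (i : V ≤ U),
      ContMDiff (𝓡 n) I' ∞ fun y : V => f ⟨y, i y.2⟩) : ContMDiff (𝓡 n) I' ∞ f := by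
  intro x
  obtain ⟨V, hV, i, hf⟩ := h x
  exact ((contDiffWithinAt_localInvariantProp ∞).liftPropAt_iff_comp_inclusion i f ⟨x, hV⟩).2
    (hf ⟨x, hV⟩)

open scoped Classical in
/-- Extension of a function on `U` to `M` by the constant `1`. -/
def extendByOne {U : Opens M} (f : U → Circle) (x : M) : Circle :=
  if h : x ∈ U then f ⟨x, h⟩ else 1

theorem contMDiffAt_extendByOne {U : Opens M} {f : U → Circle}
    (hf : ContMDiff (𝓡 n) (𝓡 1) ∞ f) (x : U) :
    ContMDiffAt (𝓡 n) (𝓡 1) ∞ (extendByOne f) (x : M) := by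
  rw [← contMDiffAt_subtype_iff]
  have : (fun y : U => extendByOne f (y : M)) = f := by
    funext y
    simp [extendByOne]
  rw [this]
  exact hf x

end Forms

/-! ### The sheaves `U(1)_M` and `Ω¹_M`, the Deligne complex, and (hyper)cohomology -/

/-- The sheaf of abelian groups whose sections over `U` are the families `f x : T x`, `x ∈ U`,
which satisfy a local predicate that cuts out a subgroup. -/
def sectionSheaf (X : TopCat.{u}) (T : X → Type) [∀ x, AddCommGroup (T x)]
    (P : TopCat.LocalPredicate T) (S : ∀ U : Opens X, AddSubgroup (∀ x : U, T x))
    (hS : ∀ (U : Opens X) (f : ∀ x : U, T x), f ∈ S U ↔ P.pred f) :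
    Sheaf (Opens.grothendieckTopology X) AddCommGrpCat.{u} where
  obj :=
    { obj := fun U => AddCommGrpCat.of (S U.unop)
      map := fun {U V} i => AddCommGrpCat.ofHom
        { toFun := fun f => ⟨fun x => f.1 (i.unop x),
            (hS _ _).2 (P.res i.unop f.1 ((hS _ _).1 f.2))⟩
          map_zero' := rfl
          map_add' := fun _ _ => rfl }
      map_id := fun _ => rfl
      map_comp := fun _ _ => rfl }
  property := by
    rw [CategoryTheory.Presheaf.isSheaf_iff_isSheaf_forget _ _
      (CategoryTheory.forget AddCommGrpCat)]
    refine TopCat.Presheaf.isSheaf_of_iso ?_ (TopCat.subpresheafToTypes.isSheaf P)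
    refine NatIso.ofComponents (fun U => Equiv.toIso
      (Equiv.subtypeEquivRight (fun f => (hS U.unop f).symm))) ?_
    intro U V i
    rfl

section Sheaves

variable (n : ℕ) (M : Type u) [TopologicalSpace M] [ChartedSpace (EuclideanSpace ℝ (Fin n)) M]
  [IsManifold (𝓡 n) ∞ M]

/-- Smooth functions `U → U(1)`, written additively. -/
def circleSections (U : Opens M) : AddSubgroup (∀ _ : U, Additive Circle) where
  carrier := {f | ContMDiff (𝓡 n) (𝓡 1) ∞ fun x => (f x).toMul}
  add_mem' hf hg := ContMDiff.mul hf hg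
  zero_mem' := contMDiff_const
  neg_mem' hf := ContMDiff.inv hf

/-- Smooth 1-forms on `U`: families of covectors which are smooth as a map `U → T^*M`. -/
def oneFormSections (U : Opens M) :
    AddSubgroup (∀ x : U, TangentSpace (𝓡 n) (x : M) →L[ℝ] ℝ) where
  carrier := {a | ContMDiff (𝓡 n) ((𝓡 n).prod 𝓘(ℝ, EuclideanSpace ℝ (Fin n) →L[ℝ] ℝ)) ∞
    fun x : U => covector n (x : M) (a x)}
  add_mem' {a b} ha hb x := by
    have ha := ha x
    have hb := hb x
    rw [contMDiffAt_hom_bundle (E₂ := Bundle.Trivial M ℝ)] at ha hb ⊢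
    refine ⟨ha.1, (ha.2.add hb.2).congr_of_eventuallyEq (Filter.Eventually.of_forall fun y => ?_)⟩
    ext v
    exact map_add (Bundle.Trivialization.continuousLinearMapAt ℝ
      (trivializationAt ℝ (Bundle.Trivial M ℝ) (x : M)) (y : M)) _ _
  zero_mem' x := by
    rw [contMDiffAt_hom_bundle (E₂ := Bundle.Trivial M ℝ)]
    refine ⟨contMDiff_subtype_val x, (contMDiffAt_const (c := 0)).congr_of_eventuallyEq
      (Filter.Eventually.of_forall fun y => ?_)⟩
    ext v
    exact map_zero (Bundle.Trivialization.continuousLinearMapAt ℝ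
      (trivializationAt ℝ (Bundle.Trivial M ℝ) (x : M)) (y : M))
  neg_mem' {a} ha x := by
    have ha := ha x
    rw [contMDiffAt_hom_bundle (E₂ := Bundle.Trivial M ℝ)] at ha ⊢
    refine ⟨ha.1, ha.2.neg.congr_of_eventuallyEq (Filter.Eventually.of_forall fun y => ?_)⟩
    ext v
    exact map_neg (Bundle.Trivialization.continuousLinearMapAt ℝ
      (trivializationAt ℝ (Bundle.Trivial M ℝ) (x : M)) (y : M)) _

/-- The sheaf `U(1)_M` of smooth `U(1)`-valued functions on `M`. -/
def smoothCircleSheaf : Sheaf (Opens.grothendieckTopology M) AddCommGrpCat.{u} :=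
  sectionSheaf (TopCat.of M) (fun _ => Additive Circle)
    { pred := fun {U} f => ContMDiff (𝓡 n) (𝓡 1) ∞ fun x : (U : Opens M) => (f x).toMul
      res := fun {U V} i f hf => ContMDiff.comp (I' := 𝓡 n)
        (g := fun x : (V : Opens M) => (f x).toMul) hf (contMDiff_inclusion (leOfHom i))
      locality := fun {U} f h => contMDiff_of_locally n (U := U) (fun x => (f x).toMul) fun x => by
        obtain ⟨V, hV, i, hf⟩ := h x
        exact ⟨V, hV, leOfHom i, hf⟩ }
    (circleSections n M) (fun _ _ => Iff.rfl)

/-- The sheaf `Ω¹_M` of smooth real 1-forms on `M`. -/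
def oneFormSheaf : Sheaf (Opens.grothendieckTopology M) AddCommGrpCat.{u} :=
  sectionSheaf (TopCat.of M) (fun x : M => TangentSpace (𝓡 n) x →L[ℝ] ℝ)
    { pred := fun {U} a => ContMDiff (𝓡 n)
        ((𝓡 n).prod 𝓘(ℝ, EuclideanSpace ℝ (Fin n) →L[ℝ] ℝ)) ∞
        fun x : (U : Opens M) => covector n (x : M) (a x)
      res := fun {U V} i f hf => ContMDiff.comp (I' := 𝓡 n) hf (contMDiff_inclusion (leOfHom i))
      locality := fun {U} f h => contMDiff_of_locally n (U := U)
        (fun x => covector n (x : M) (f x)) fun x => by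
        obtain ⟨V, hV, i, hf⟩ := h x
        exact ⟨V, hV, leOfHom i, hf⟩ }
    (oneFormSections n M) (fun _ _ => Iff.rfl)

/-- The morphism of sheaves `d log : U(1)_M → Ω¹_M`. -/
def dlogHom : smoothCircleSheaf n M ⟶ oneFormSheaf n M where
  hom :=
    { app := fun U => AddCommGrpCat.ofHom (AddMonoidHom.mk'
        (fun f : circleSections n M U.unop =>
          (⟨fun x => circleDlog n (extendByOne fun y => (f.1 y).toMul) (x : M), fun x =>
            (contMDiffAt_circleDlog n (contMDiffAt_extendByOne n f.2 x)).comp x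
              (contMDiff_subtype_val x)⟩ : oneFormSections n M U.unop))
        (fun f g => by
          apply Subtype.ext
          funext x
          refine Eq.trans (circleDlog_congr n (Filter.Eventually.of_forall fun y => ?_))
            (circleDlog_mul n (contMDiffAt_extendByOne n f.2 x) (contMDiffAt_extendByOne n g.2 x))
          by_cases hy : y ∈ U.unop
          · simp [extendByOne, hy]
          · simp [extendByOne, hy]))
      naturality := fun U V i => by
        apply AddCommGrpCat.hom_ext
        apply AddMonoidHom.ext
        intro f
        apply Subtype.ext
        funext x
        refine circleDlog_congr n ?_
        filter_upwards [(V.unop : Opens M).isOpen.mem_nhds x.2] with y hy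
        have hy' : y ∈ U.unop := (leOfHom i.unop) hy
        have e : extendByOne (fun z => (f.1 z).toMul) y = (f.1 ⟨y, hy'⟩).toMul := dif_pos hy'
        exact (dif_pos hy).trans e.symm }

/-- The complex of sheaves `𝒟¹ = (U(1)_M → Ω¹_M)`, with differential `d log`, in degrees `0`, `1`. -/
def deligneComplex : CochainComplex (Sheaf (Opens.grothendieckTopology M) AddCommGrpCat.{u}) ℤ :=
  HomologicalComplex.double (dlogHom n M) (show (ComplexShape.up ℤ).Rel 0 1 from zero_add 1)

end Sheaves

section Cohomology

variable (X : Type u) [TopologicalSpace X]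

/-- The constant sheaf `ℤ` on `X`. -/
abbrev integerSheaf : Sheaf (Opens.grothendieckTopology X) AddCommGrpCat.{u} :=
  (constantSheaf _ AddCommGrpCat.{u}).obj (AddCommGrpCat.of (ULift.{u} ℤ))

/-- The hypercohomology group `ℍᵖ(X, K)`, as the group of morphisms `ℤ → K[p]` in the derived
category of sheaves of abelian groups on `X`. For a single sheaf in degree `0` this is Mathlib's
`Sheaf.H`. -/
def Hypercohomology (K : CochainComplex (Sheaf (Opens.grothendieckTopology X) AddCommGrpCat.{u}) ℤ)
    (p : ℤ) : Type (u + 1) :=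
  letI := HasDerivedCategory.standard (Sheaf (Opens.grothendieckTopology X) AddCommGrpCat.{u})
  (DerivedCategory.singleFunctor _ 0).obj (integerSheaf X) ⟶ (DerivedCategory.Q.obj K)⟦p⟧

instance Hypercohomology.instAddCommGroup
    (K : CochainComplex (Sheaf (Opens.grothendieckTopology X) AddCommGrpCat.{u}) ℤ)
    (p : ℤ) : AddCommGroup (Hypercohomology X K p) :=
  letI := HasDerivedCategory.standard (Sheaf (Opens.grothendieckTopology X) AddCommGrpCat.{u})
  inferInstanceAs (AddCommGroup
    ((DerivedCategory.singleFunctor _ 0).obj (integerSheaf X) ⟶ (DerivedCategory.Q.obj K)⟦p⟧))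

end Cohomology

/-! ### Submersions and fibre products -/

section Gerbes

variable (n : ℕ) (M : Type u) [TopologicalSpace M] [ChartedSpace (EuclideanSpace ℝ (Fin n)) M]
  [IsManifold (𝓡 n) ∞ M]

/-- A submersion `Y → M`: a smooth surjection with surjective differential from a
(Hausdorff, paracompact) manifold `Y` onto `M`. -/
structure SubmersionOnto : Type (u + 1) where
  dim : ℕ
  Total : Type u
  [topologicalSpace : TopologicalSpace Total]
  [chartedSpace : ChartedSpace (EuclideanSpace ℝ (Fin dim)) Total]
  [isManifold : IsManifold (𝓡 dim) ∞ Total]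
  [t2Space : T2Space Total]
  [paracompactSpace : ParacompactSpace Total]
  proj : Total → M
  contMDiff_proj : ContMDiff (𝓡 dim) (𝓡 n) ∞ proj
  surjective_proj : Function.Surjective proj
  surjective_mfderiv : ∀ y, Function.Surjective (mfderiv (𝓡 dim) (𝓡 n) proj y)

attribute [instance] SubmersionOnto.topologicalSpace SubmersionOnto.chartedSpace
  SubmersionOnto.isManifold SubmersionOnto.t2Space SubmersionOnto.paracompactSpace

variable {n M}

namespace SubmersionOnto

/-- The fibre product `Y ×_M Z`, as a subset (an embedded submanifold) of `Y × Z`. -/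
def fibreProduct (Y Z : SubmersionOnto n M) : Set (Y.Total × Z.Total) :=
  {p | Y.proj p.1 = Z.proj p.2}

/-- Two tangent vectors form a tangent vector to the fibre product. -/
def TangentToFibreProduct (Y Z : SubmersionOnto n M) (y : Y.Total) (z : Z.Total)
    (v : TangentSpace (𝓡 Y.dim) y) (w : TangentSpace (𝓡 Z.dim) z) : Prop :=
  (mfderiv (𝓡 Y.dim) (𝓡 n) Y.proj y v : EuclideanSpace ℝ (Fin n)) =
    mfderiv (𝓡 Z.dim) (𝓡 n) Z.proj z w

/-- `W`, with the maps `p` and `q`, is the manifold `Y ×_M Z`: the map `(p, q)` is a diffeomorphism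
from `W` onto the submanifold `Y ×_M Z` of `Y × Z`, and it is compatible with the maps to `M`.
Smoothness on the submanifold means that there are smooth extensions locally. -/
structure IsFibreProduct (Y Z W : SubmersionOnto n M) (p : W.Total → Y.Total)
    (q : W.Total → Z.Total) : Prop where
  contMDiff_fst : ContMDiff (𝓡 W.dim) (𝓡 Y.dim) ∞ p
  contMDiff_snd : ContMDiff (𝓡 W.dim) (𝓡 Z.dim) ∞ q
  proj_fst : ∀ w, Y.proj (p w) = W.proj w
  proj_snd : ∀ w, Z.proj (q w) = W.proj w
  exists_inverse : ∃ r : Y.Total × Z.Total → W.Total,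
    ContMDiffOn ((𝓡 Y.dim).prod (𝓡 Z.dim)) (𝓡 W.dim) ∞ r (Y.fibreProduct Z) ∧
    (∀ w, r (p w, q w) = w) ∧
    ∀ x ∈ Y.fibreProduct Z, p (r x) = x.1 ∧ q (r x) = x.2

end SubmersionOnto

/-! ### Bundle 0-gerbes -/

variable (n M) in
/-- A bundle 0-gerbe `(g, Y, M)`. The function `g` is a smooth function on `Y ×_M Y`; its values
outside of this submanifold of `Y × Y` are irrelevant. -/
structure BundleZeroGerbe : Type (u + 1) extends SubmersionOnto n M where
  g : Total × Total → Circle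
  contMDiffOn_g : ContMDiffOn ((𝓡 dim).prod (𝓡 dim)) (𝓡 1) ∞ g
    (toSubmersionOnto.fibreProduct toSubmersionOnto)
  cocycle : ∀ y₁ y₂ y₃, proj y₁ = proj y₂ → proj y₂ = proj y₃ →
    g (y₁, y₂) * g (y₂, y₃) = g (y₁, y₃)

namespace BundleZeroGerbe

/-- `h : Y → U(1)` is a trivialisation: `h` is smooth and `g(y₁, y₂) = h(y₁)⁻¹ h(y₂)`. -/
def IsTrivialisation (A : BundleZeroGerbe n M) (h : A.Total → Circle) : Prop :=
  ContMDiff (𝓡 A.dim) (𝓡 1) ∞ h ∧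
    ∀ y₁ y₂, A.proj y₁ = A.proj y₂ → A.g (y₁, y₂) = (h y₁)⁻¹ * h y₂

/-- A bundle 0-gerbe is trivial if it has a trivialisation. -/
def IsTrivial (A : BundleZeroGerbe n M) : Prop := ∃ h, A.IsTrivialisation h

/-- The dual `(g⁻¹, Y, M)`. -/
def dual (A : BundleZeroGerbe n M) : BundleZeroGerbe n M where
  toSubmersionOnto := A.toSubmersionOnto
  g y := (A.g y)⁻¹
  contMDiffOn_g := A.contMDiffOn_g.inv
  cocycle y₁ y₂ y₃ h h' := by rw [← A.cocycle y₁ y₂ y₃ h h', mul_inv]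

/-- `C`, with the projections `p` and `q` of its underlying fibre product, is the product
`A ⊗ B = (g g', Y ×_M Y', M)`. -/
def IsProductVia (A B C : BundleZeroGerbe n M) (p : C.Total → A.Total) (q : C.Total → B.Total) :
    Prop :=
  A.IsFibreProduct B.toSubmersionOnto C.toSubmersionOnto p q ∧
    ∀ z₁ z₂, C.proj z₁ = C.proj z₂ → C.g (z₁, z₂) = A.g (p z₁, p z₂) * B.g (q z₁, q z₂)

/-- `C` is the product `A ⊗ B`. -/
def IsProduct (A B C : BundleZeroGerbe n M) : Prop := ∃ p q, IsProductVia A B C p q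

/-- A diffeomorphism over `M` that is an isomorphism of bundle 0-gerbes. -/
def IsIsomorphism (A B : BundleZeroGerbe n M)
    (φ : Diffeomorph (𝓡 A.dim) (𝓡 B.dim) A.Total B.Total ∞) : Prop :=
  (∀ y, B.proj (φ y) = A.proj y) ∧
    ∀ y₁ y₂, A.proj y₁ = A.proj y₂ → A.g (y₁, y₂) = B.g (φ y₁, φ y₂)

/-- `A ≅ B ⊗ T` for some trivial bundle 0-gerbe `T`. -/
def StableIso (A B : BundleZeroGerbe n M) : Prop :=
  ∃ T C : BundleZeroGerbe n M, T.IsTrivial ∧ IsProduct B T C ∧ ∃ φ, IsIsomorphism A C φ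

variable (n M) in
/-- Stable isomorphism classes: the classes of the equivalence relation generated by stable
isomorphisms. -/
def StableClass : Type (u + 1) := Quot (StableIso (n := n) (M := M))

/-- The stable isomorphism class of a bundle 0-gerbe. -/
def stableClass (A : BundleZeroGerbe n M) : StableClass n M := Quot.mk _ A

end BundleZeroGerbe

/-! ### Bundle 0-gerbes with connection -/

variable (n M) in
/-- A bundle 0-gerbe with connection `(g, Y, M; A)`: a smooth 1-form `A` on `Y` such that
`δ(A) = d log g` on `Y ×_M Y`, where `δ(A)` is `A(y₂) - A(y₁)` at `(y₁, y₂)`. Here `D` is a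
differential of `g` at `(y₁, y₂)` within the submanifold `Y ×_M Y`; its values on tangent vectors of
this submanifold do not depend on any choice. -/
structure ConnectiveZeroGerbe : Type (u + 1) extends BundleZeroGerbe n M where
  conn : ∀ y : Total, TangentSpace (𝓡 dim) y →L[ℝ] ℝ
  contMDiff_conn : ContMDiff (𝓡 dim)
    ((𝓡 dim).prod 𝓘(ℝ, EuclideanSpace ℝ (Fin dim) →L[ℝ] ℝ)) ∞ fun y => covector dim y (conn y)
  delta_conn : ∀ y₁ y₂, proj y₁ = proj y₂ →
    ∃ D : TangentSpace ((𝓡 dim).prod (𝓡 dim)) (y₁, y₂) →L[ℝ] ℂ,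
      HasMFDerivWithinAt ((𝓡 dim).prod (𝓡 dim)) 𝓘(ℝ, ℂ) (fun p => (g p : ℂ))
        (toSubmersionOnto.fibreProduct toSubmersionOnto) (y₁, y₂) D ∧
      ∀ (v₁ : TangentSpace (𝓡 dim) y₁) (v₂ : TangentSpace (𝓡 dim) y₂),
        toSubmersionOnto.TangentToFibreProduct toSubmersionOnto y₁ y₂ v₁ v₂ →
        conn y₂ v₂ - conn y₁ v₁ = (starRingEnd ℂ (g (y₁, y₂)) * D (v₁, v₂)).im

namespace ConnectiveZeroGerbe

/-- A `D`-trivialisation: a trivialisation `h` with `d log h = A`. -/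
def IsDTrivialisation (A : ConnectiveZeroGerbe n M) (h : A.Total → Circle) : Prop :=
  A.IsTrivialisation h ∧ ∀ y, circleDlog A.dim h y = A.conn y

/-- A bundle 0-gerbe with connection is `D`-trivial if it has a `D`-trivialisation. -/
def IsDTrivial (A : ConnectiveZeroGerbe n M) : Prop := ∃ h, A.IsDTrivialisation h

/-- The dual `(g⁻¹, Y, M; -A)`. -/
def dual (A : ConnectiveZeroGerbe n M) : ConnectiveZeroGerbe n M where
  toBundleZeroGerbe := A.toBundleZeroGerbe.dual
  conn y := - A.conn y
  contMDiff_conn := contMDiff_covector_neg (M := A.Total) A.dim A.contMDiff_conn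
  delta_conn y₁ y₂ h := by
    obtain ⟨D, hD, hD'⟩ := A.delta_conn y₁ y₂ h
    refine ⟨(Complex.conjCLE : ℂ →L[ℝ] ℂ).comp D, hasMFDerivWithinAt_conj hD, ?_⟩
    · intro v₁ v₂ hv
      have e := hD' v₁ v₂ hv
      have e' : starRingEnd ℂ (((A.g (y₁, y₂))⁻¹ : Circle) : ℂ) *
          starRingEnd ℂ (D (v₁, v₂)) = starRingEnd ℂ (starRingEnd ℂ (A.g (y₁, y₂) : ℂ) *
            D (v₁, v₂)) := by
        rw [map_mul, Circle.coe_inv_eq_conj]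
      refine Eq.trans ?_ (congrArg Complex.im e').symm
      rw [Complex.conj_im, ← e]
      change -(A.conn y₂ v₂) - -(A.conn y₁ v₁) = _
      ring

/-- `C` is the product `(g g', Y ×_M Y', M; A + A')`. -/
def IsProduct (A B C : ConnectiveZeroGerbe n M) : Prop :=
  ∃ (p : C.Total → A.Total) (q : C.Total → B.Total),
    BundleZeroGerbe.IsProductVia A.toBundleZeroGerbe B.toBundleZeroGerbe C.toBundleZeroGerbe p q ∧
    ∀ z, C.conn z = (A.conn (p z)).comp (mfderiv (𝓡 C.dim) (𝓡 A.dim) p z) +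
      (B.conn (q z)).comp (mfderiv (𝓡 C.dim) (𝓡 B.dim) q z)

/-- An isomorphism of bundle 0-gerbes with connection: an isomorphism `φ` of bundle 0-gerbes such
that the connection of `A` is the pull back under `φ` of that of `B`. -/
def IsIsomorphism (A B : ConnectiveZeroGerbe n M)
    (φ : Diffeomorph (𝓡 A.dim) (𝓡 B.dim) A.Total B.Total ∞) : Prop :=
  BundleZeroGerbe.IsIsomorphism A.toBundleZeroGerbe B.toBundleZeroGerbe φ ∧
    ∀ y, A.conn y = (B.conn (φ y)).comp (mfderiv (𝓡 A.dim) (𝓡 B.dim) φ y)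

/-- `A ≅ B ⊗ T` for some `D`-trivial bundle 0-gerbe with connection `T`. -/
def DStableIso (A B : ConnectiveZeroGerbe n M) : Prop :=
  ∃ T C : ConnectiveZeroGerbe n M, T.IsDTrivial ∧ IsProduct B T C ∧ ∃ φ, IsIsomorphism A C φ

variable (n M) in
/-- `D`-stable isomorphism classes: the classes of the equivalence relation generated by `D`-stable
isomorphisms. -/
def DStableClass : Type (u + 1) := Quot (DStableIso (n := n) (M := M))

/-- The `D`-stable isomorphism class of a bundle 0-gerbe with connection. -/
def dStableClass (A : ConnectiveZeroGerbe n M) : DStableClass n M := Quot.mk _ A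

end ConnectiveZeroGerbe

/-! ### Principal `U(1)`-bundles -/

variable (n M) in
/-- A smooth principal `U(1)`-bundle `P → M`: a manifold with a smooth action of `U(1)` which
preserves `proj`, and with smooth equivariant local trivialisations. -/
structure PrincipalCircleBundle : Type (u + 1) where
  dim : ℕ
  Total : Type u
  [topologicalSpace : TopologicalSpace Total]
  [chartedSpace : ChartedSpace (EuclideanSpace ℝ (Fin dim)) Total]
  [isManifold : IsManifold (𝓡 dim) ∞ Total]
  [t2Space : T2Space Total]
  [paracompactSpace : ParacompactSpace Total]
  [mulAction : MulAction Circle Total]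
  proj : Total → M
  contMDiff_proj : ContMDiff (𝓡 dim) (𝓡 n) ∞ proj
  contMDiff_smul : ContMDiff ((𝓡 1).prod (𝓡 dim)) (𝓡 dim) ∞ fun x : Circle × Total => x.1 • x.2
  proj_smul : ∀ (c : Circle) (p : Total), proj (c • p) = proj p
  locally_trivial : ∀ x : M, ∃ e : Bundle.Trivialization Circle proj, x ∈ e.baseSet ∧
    ContMDiffOn (𝓡 dim) ((𝓡 n).prod (𝓡 1)) ∞ e e.source ∧
    ContMDiffOn ((𝓡 n).prod (𝓡 1)) (𝓡 dim) ∞ e.toOpenPartialHomeomorph.symm e.target ∧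
    ∀ (c : Circle) (p : Total), p ∈ e.source → (e (c • p)).2 = c * (e p).2

attribute [instance] PrincipalCircleBundle.topologicalSpace PrincipalCircleBundle.chartedSpace
  PrincipalCircleBundle.isManifold PrincipalCircleBundle.t2Space
  PrincipalCircleBundle.paracompactSpace PrincipalCircleBundle.mulAction

namespace PrincipalCircleBundle

/-- `P` and `Q` are isomorphic: there is a `U(1)`-equivariant diffeomorphism over `M`. -/
def Iso (P Q : PrincipalCircleBundle n M) : Prop :=
  ∃ φ : Diffeomorph (𝓡 P.dim) (𝓡 Q.dim) P.Total Q.Total ∞,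
    (∀ p, Q.proj (φ p) = P.proj p) ∧ ∀ (c : Circle) (p : P.Total), φ (c • p) = c • φ p

/-- `R` is the product `P ⊗ Q = (P ×_M Q) / U(1)` of principal `U(1)`-bundles, with quotient map
`(p, q) ↦ μ (p, q)`. -/
def IsProduct (P Q R : PrincipalCircleBundle n M) : Prop :=
  ∃ μ : P.Total × Q.Total → R.Total,
    ContMDiffOn ((𝓡 P.dim).prod (𝓡 Q.dim)) (𝓡 R.dim) ∞ μ {x | P.proj x.1 = Q.proj x.2} ∧
    ∀ p q, P.proj p = Q.proj q → R.proj (μ (p, q)) = P.proj p ∧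
      ∀ a b : Circle, μ (a • p, b • q) = (a * b) • μ (p, q)

variable (n M) in
/-- Isomorphism of principal `U(1)`-bundles is an equivalence relation. -/
def isoSetoid : Setoid (PrincipalCircleBundle n M) where
  r := Iso
  iseqv :=
    { refl := fun P => ⟨Diffeomorph.refl _ _ _, fun _ => rfl, fun _ _ => rfl⟩
      symm := fun ⟨φ, h, h'⟩ => ⟨φ.symm,
        fun q => by rw [← h, φ.apply_symm_apply],
        fun c q => φ.injective ((φ.apply_symm_apply _).trans
          ((congrArg (c • ·) (φ.apply_symm_apply q).symm).trans (h' c _).symm))⟩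
      trans := fun ⟨φ, h, h'⟩ ⟨ψ, k, k'⟩ => ⟨φ.trans ψ,
        fun p => (k _).trans (h p),
        fun c p => (congrArg ψ (h' c p)).trans (k' c _)⟩ }

variable (n M) in
/-- Isomorphism classes of principal `U(1)`-bundles. -/
def IsoClass : Type (u + 1) := Quotient (isoSetoid n M)

/-- The isomorphism class of a principal `U(1)`-bundle. -/
def isoClass (P : PrincipalCircleBundle n M) : IsoClass n M := Quotient.mk _ P

end PrincipalCircleBundle

end Gerbes

/-!
Bundle 0-gerbes over `M`, principal `U(1)`-bundles over `M` and the cohomology group `H¹(M, U(1))`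
are all classified by the same group of cocycle classes, which is the following one.

Let `∏ U(1)` be the sheaf of all circle-valued functions, without any condition of continuity. As
the circle is divisible, and as a map to `∏ U(1)` is the same as a map to `U(1)` on each stalk,
this sheaf is injective (`injective_allSections`). Therefore `H¹(M, U(1))` is the group
`CircleClass` of global sections of `∏ U(1) / U(1)`, modulo those that come from a global
circle-valued function (`nonempty_H_one_equiv_circleClass`). A section of the quotient is a family
of circle-valued functions `f i`, defined locally, with smooth quotients `(f i)⁻¹ * f j`; this is
a cocycle together with a discontinuous trivialisation of it.

For the complex `d log : U(1) → Ω¹`, the role of the quotient is played by the sheaf of pairs `(f,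
a)` of a circle-valued function and a smooth 1-form, modulo the pairs `(f, d log f)` with `f`
smooth. It is the cokernel of `U(1) → ∏ U(1) ⊞ Ω¹`, and a comparison of the resulting triangle in
the derived category with that of the mapping cone of `d log` shows that `H¹(M, 𝒟¹)` is the group
`ConnectionClass` of its global sections, modulo the pairs `(k, 0)` for a global function `k`
(`exists_hypercohomology_equiv`, `nonempty_hypercohomology_equiv_connectionClass`).

A bundle 0-gerbe `(g, Y, M)` has a potential: a function `h` on `Y`, not necessarily continuous,
with `g(y₁, y₂) = h(y₁)⁻¹ h(y₂)`. It is obtained from a section of `Y → M` that need not be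
continuous, and it is unique up to a function on `M`. Along two smooth local sections `σ`, `τ` of
`Y → M`, the functions `h ∘ σ` and `h ∘ τ` have the smooth quotient `g(σ, τ)`, so that they define
an element of `CircleClass` (`BundleZeroGerbe.Represents`). It is unique modulo the trivial
classes, it is additive under products and changes its sign under duality, and some trivial class
represents `(g, Y, M)` if and only if there is a smooth potential
(`BundleZeroGerbe.isTrivial_iff_represents`). In the presence of a connection `A`, the pairs `(h ∘
σ, σ^* A)` do the same (`ConnectiveZeroGerbe.isDTrivial_iff_represents`).

Every class occurs, because a cocycle can be glued to a principal bundle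
(`CircleCocycle.exists_principalCircleBundle`), on which a connection can be prescribed locally
(`exists_connectiveZeroGerbe_represents`), and a principal bundle `P → M` is a bundle 0-gerbe,
with `g(p, p')` the element of the circle that takes `p` to `p'` (`PrincipalCircleBundle.gerbe`).
A `U(1)`-equivariant function on `P` is a potential of this bundle 0-gerbe. Two principal bundles
with the same class are isomorphic by the map that preserves suitable equivariant functions
(`PrincipalCircleBundle.iso_of_represents`).

The statements about stable isomorphism follow formally (`exists_commGroup_quot`): if `A ⊗ B*` is
trivial, then `A ⊗ (B* ⊗ B) = B ⊗ (A ⊗ B*)` is a product of `A` with a trivial object and a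
product of `B` with a trivial object. Products exist because a submersion is a projection in
suitable local coordinates, so that the fibre product of two submersions is a manifold
(`SubmersionOnto.exists_isFibreProduct`).

Finally, the isomorphism from `H¹(M, U(1))` to `H²(M, ℤ)` is the connecting map of the exponential
sequence `ℤ → C^∞(ℝ) → U(1)`. It is bijective because `C^∞(ℝ)` is a fine sheaf: partitions of unity lift global sections
along the first two steps of a resolution by sheaves of all families
(`FineAction.subsingleton_H`). As `M` is not assumed to be `σ`-compact, partitions of unity and
the paracompactness of total spaces are obtained from a decomposition of paracompact locally
compact spaces into open `σ`-compact pieces (`exists_isLocallyConstant_isSigmaCompact`).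
-/

set_option linter.unusedSectionVars false

open Opposite

/-! ### Sheaves of sections and their explicit quotients -/

/-- Sheaves of abelian groups on a topological space. -/
abbrev AbSheaf (X : Type u) [TopologicalSpace X] :=
  Sheaf (Opens.grothendieckTopology X) AddCommGrpCat.{u}

section AbSheaf

variable {X : Type u} [TopologicalSpace X]

/-- The group of sections of a sheaf over an open set. -/
abbrev AbSheaf.sections (F : AbSheaf X) (U : Opens X) : AddCommGrpCat.{u} := F.obj.obj (op U)

/-- Restriction of sections. -/
abbrev AbSheaf.res (F : AbSheaf X) {U V : Opens X} (i : V ≤ U) : F.sections U →+ F.sections V :=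
  (F.obj.map (homOfLE i).op).hom

/-- The action of a morphism of sheaves on sections. -/
abbrev AbSheaf.app {F G : AbSheaf X} (f : F ⟶ G) (U : Opens X) : F.sections U →+ G.sections U :=
  (f.hom.app (op U)).hom

theorem AbSheaf.app_res {F G : AbSheaf X} (f : F ⟶ G) {U V : Opens X} (i : V ≤ U)
    (s : F.sections U) : AbSheaf.app f V (F.res i s) = G.res i (AbSheaf.app f U s) :=
  ConcreteCategory.congr_hom (f.hom.naturality (homOfLE i).op) s

theorem AbSheaf.eq_of_locally {F : AbSheaf X} {U : Opens X} {s t : F.sections U}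
    (h : ∀ x ∈ U, ∃ (V : Opens X) (i : V ≤ U), x ∈ V ∧ F.res i s = F.res i t) : s = t := by
  choose V hV hx e using h
  refine TopCat.Sheaf.eq_of_locally_eq' (X := TopCat.of X) F (fun x : U => V x.1 x.2) U
    (fun x => homOfLE (hV x.1 x.2)) ?_ s t fun x => e x.1 x.2
  intro x hxU
  exact Opens.mem_iSup.2 ⟨⟨x, hxU⟩, hx x hxU⟩

theorem AbSheaf.epi_of_locally {F G : AbSheaf X} (f : F ⟶ G)
    (h : ∀ (U : Opens X) (t : G.sections U), ∀ x ∈ U, ∃ (V : Opens X) (i : V ≤ U), x ∈ V ∧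
      ∃ s : F.sections V, AbSheaf.app f V s = G.res i t) : Epi f := by
  refine ⟨fun {H} a b e => ?_⟩
  ext U t
  refine AbSheaf.eq_of_locally (F := H) (U := U.unop) fun x hx => ?_
  obtain ⟨V, i, hV, s, hs⟩ := h U.unop t x hx
  refine ⟨V, i, hV, ?_⟩
  have e' := ConcreteCategory.congr_hom (congrArg (fun k => k.hom.app (op V)) e) s
  have ha := AbSheaf.app_res a i t
  have hb := AbSheaf.app_res b i t
  rw [← hs] at ha hb
  exact ha.symm.trans (e'.trans hb)

/-- Exactness of sheaves can be read off from sections: `f` has to be a kernel of `g` on sections,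
and `g` has to be surjective locally. -/
theorem AbSheaf.shortExact_of_sections {F G H : AbSheaf X} (f : F ⟶ G) (g : G ⟶ H)
    (w : f ≫ g = 0) (hf : ∀ U, Function.Injective (AbSheaf.app f U))
    (hfg : ∀ U (t : G.sections U), AbSheaf.app g U t = 0 → ∃ s, AbSheaf.app f U s = t) (hg : Epi g) :
    (ShortComplex.mk f g w).ShortExact := by
  -- The hypotheses on sections say that `f` has the universal property of a kernel: the preimages
  -- of sections under the injection `f` fit together.
  have key : ∀ {W : AbSheaf X} (k : W ⟶ G) (_ : k ≫ g = 0), ∃ l : W ⟶ F, l ≫ f = k := by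
    intro W k hk
    have h : ∀ U (s : W.sections U), ∃ t, AbSheaf.app f U t = AbSheaf.app k U s := by
      intro U s
      refine hfg U _ ?_
      exact ConcreteCategory.congr_hom (congrArg (fun k => k.hom.app (op U)) hk) s
    choose l hl using h
    refine ⟨⟨{
      app := fun U => AddCommGrpCat.ofHom
        (AddMonoidHom.mk' (fun s => l U.unop s) fun a b => hf _ ?_)
      naturality := ?_ }⟩, ?_⟩
    · rw [map_add, hl, hl, hl, map_add]
    · intro U V i
      ext s
      apply hf V.unop
      refine (hl V.unop (W.res i.unop.le s)).trans ?_
      refine Eq.trans ?_ (AbSheaf.app_res f i.unop.le _).symm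
      rw [AbSheaf.app_res]
      exact congrArg (G.res i.unop.le) (hl U.unop s).symm
    · ext U s
      exact hl U.unop s
  have hm : Mono f := by
    refine ⟨fun {W} a b e => ?_⟩
    ext U s
    exact hf U.unop (ConcreteCategory.congr_hom (congrArg (fun k => k.hom.app U) e) s)
  exact { exact := ShortComplex.exact_of_f_is_kernel _ (Limits.KernelFork.IsLimit.ofι' f w
            fun k hk => ⟨(key k hk).choose, (key k hk).choose_spec⟩)
          mono_f := hm
          epi_g := hg }

end AbSheaf

section ExtendByZero

variable {X : Type*} [TopologicalSpace X] {T : X → Type*} [∀ x, AddCommGroup (T x)]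

open scoped Classical in
/-- Extension by zero of a family over `U`. -/
def extendByZero {U : Opens X} : (∀ x : U, T x) →+ (∀ x, T x) where
  toFun f x := if h : x ∈ U then f ⟨x, h⟩ else 0
  map_zero' := by funext x; simp
  map_add' f g := by
    funext x
    by_cases h : x ∈ U <;> simp [h]

theorem extendByZero_apply {U : Opens X} (f : ∀ x : U, T x) {x : X} (h : x ∈ U) :
    extendByZero f x = f ⟨x, h⟩ := dif_pos h

theorem extendByZero_eventuallyEq {U V : Opens X} (i : V ≤ U) (f : ∀ x : U, T x) (x : V) :
    ∀ᶠ y in nhds (x : X), extendByZero (fun z : V => f ⟨z, i z.2⟩) y = extendByZero f y := by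
  filter_upwards [V.isOpen.mem_nhds x.2] with y hy
  rw [extendByZero_apply _ hy, extendByZero_apply _ (i hy)]

end ExtendByZero

section Sections

variable {X : Type u} [TopologicalSpace X] (T : X → Type u) [∀ x, AddCommGroup (T x)]

/-- The sheaf whose sections over `U` are the families `f x : T x`, `x ∈ U`, subject to a local
condition that cuts out a subgroup. -/
def localSectionSheaf (S : ∀ U : Opens X, AddSubgroup (∀ x : U, T x))
    (res : ∀ {U V : Opens X} (i : V ≤ U) (f : ∀ x : U, T x), f ∈ S U →
      (fun x : V => f ⟨x, i x.2⟩) ∈ S V)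
    (loc : ∀ {U : Opens X} (f : ∀ x : U, T x), (∀ x : U, ∃ (V : Opens X) (_ : x.1 ∈ V) (i : V ≤ U),
      (fun y : V => f ⟨y, i y.2⟩) ∈ S V) → f ∈ S U) : AbSheaf X where
  obj :=
    { obj := fun U => AddCommGrpCat.of (S U.unop)
      map := fun {U V} i => AddCommGrpCat.ofHom
        { toFun := fun f => ⟨fun x => f.1 ⟨x, i.unop.le x.2⟩, res i.unop.le f.1 f.2⟩
          map_zero' := rfl
          map_add' := fun _ _ => rfl }
      map_id := fun _ => rfl
      map_comp := fun _ _ => rfl }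
  property := by
    rw [CategoryTheory.Presheaf.isSheaf_iff_isSheaf_forget _ _
      (CategoryTheory.forget AddCommGrpCat)]
    let P : TopCat.LocalPredicate (X := TopCat.of X) T :=
      { pred := fun {U} f => f ∈ S U
        res := fun i f hf => res i.le f hf
        locality := fun f h => loc f fun x => by
          obtain ⟨V, hV, i, hf⟩ := h x
          exact ⟨V, hV, i.le, hf⟩ }
    refine TopCat.Presheaf.isSheaf_of_iso ?_ (TopCat.subpresheafToTypes.isSheaf P)
    exact NatIso.ofComponents (fun U => Iso.refl _) fun i => rfl

/-- The sheaf of all families `f x : T x`, without any condition of continuity. -/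
def allSections : AbSheaf X :=
  localSectionSheaf T (fun _ => ⊤) (fun _ _ _ => trivial) (fun _ _ => trivial)

variable {T}

variable (T) in
/-- A family of subgroups of `∏ y, T y`, one for each point `x`, such that membership in the
subgroup at `x` depends only on the germ at `x`. -/
structure GermSubgroups where
  carrier : ∀ _ : X, AddSubgroup (∀ y, T y)
  congr : ∀ {x : X} {t t' : ∀ y, T y}, (∀ᶠ y in nhds x, t y = t' y) →
    t ∈ carrier x → t' ∈ carrier x

/-- The group of germs of families at `x`, modulo those in the subgroup at `x`. -/
abbrev GermSubgroups.Quot (S : GermSubgroups T) (x : X) : Type u := (∀ y, T y) ⧸ S.carrier x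

theorem GermSubgroups.mk_eq (S : GermSubgroups T) {x : X} {t t' : ∀ y, T y}
    (h : ∀ᶠ y in nhds x, t y = t' y) : (t : S.Quot x) = t' := by
  rw [QuotientAddGroup.eq]
  refine S.congr (t := 0) ?_ (zero_mem _)
  filter_upwards [h] with y hy
  simp [hy]

/-- The families of germs over `U` that are induced, locally, by a single family that belongs to
the subgroups `A`. -/
def quotientSections (S A : GermSubgroups T) (U : Opens X) : AddSubgroup (∀ x : U, S.Quot x) where
  carrier := {q | ∀ x : U, ∃ t : ∀ y, T y, ∀ᶠ y : U in nhds x, t ∈ A.carrier y ∧ q y = t}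
  add_mem' {q q'} hq hq' x := by
    obtain ⟨t, ht⟩ := hq x
    obtain ⟨t', ht'⟩ := hq' x
    refine ⟨t + t', ?_⟩
    filter_upwards [ht, ht'] with y hy hy'
    exact ⟨add_mem hy.1 hy'.1, by rw [Pi.add_apply, hy.2, hy'.2]; rfl⟩
  zero_mem' x := ⟨0, Filter.Eventually.of_forall fun y => ⟨zero_mem _, rfl⟩⟩
  neg_mem' {q} hq x := by
    obtain ⟨t, ht⟩ := hq x
    refine ⟨-t, ?_⟩
    filter_upwards [ht] with y hy
    exact ⟨neg_mem hy.1, by rw [Pi.neg_apply, hy.2]; rfl⟩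

/-- The quotient sheaf `A / S`: a section is a family of germs modulo `S` that is locally induced by
a section of `A`. -/
def quotientSheaf (S A : GermSubgroups T) : AbSheaf X :=
  localSectionSheaf S.Quot (quotientSections S A)
    (fun {U V} i q hq x => by
      obtain ⟨t, ht⟩ := hq ⟨x, i x.2⟩
      exact ⟨t, ((Opens.isOpenEmbedding_of_le i).continuous.tendsto x).eventually ht⟩)
    (fun {U} q h x => by
      obtain ⟨V, hV, i, hq⟩ := h x
      obtain ⟨t, ht⟩ := hq ⟨x, hV⟩
      -- Neighbourhoods of a point in `V` and in `U` are the same, as `V` is open.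
      refine ⟨t, ?_⟩
      have := (Opens.isOpenEmbedding_of_le i).map_nhds_eq ⟨x, hV⟩
      change ∀ᶠ y : U in nhds (Set.inclusion i ⟨x, hV⟩), _
      rw [← this]
      exact ht)

/-- The subgroups that consist of all families. -/
instance : Top (GermSubgroups T) := ⟨⟨fun _ => ⊤, fun _ _ => trivial⟩⟩

/-- The projection from families to germs modulo `S`. -/
def toQuotientSheaf (S : GermSubgroups T) : allSections T ⟶ quotientSheaf S ⊤ where
  hom :=
    { app := fun U => AddCommGrpCat.ofHom (AddMonoidHom.mk'
        (fun f : (⊤ : AddSubgroup (∀ x : U.unop, T x)) =>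
          (⟨fun x => (extendByZero f.1 : S.Quot x), fun x => ⟨extendByZero f.1,
            Filter.Eventually.of_forall fun y => ⟨trivial, rfl⟩⟩⟩ : quotientSections S ⊤ U.unop))
        (fun f g => Subtype.ext (funext fun x => congrArg (QuotientAddGroup.mk (s := S.carrier x))
          (map_add extendByZero f.1 g.1))))
      naturality := fun U V i => by
        ext f
        refine Subtype.ext (funext fun x => ?_)
        exact S.mk_eq (extendByZero_eventuallyEq i.unop.le f.1 x) }

/-- A condition that holds near a point of an open subspace holds on a smaller open set of the
ambient space. -/
theorem nhds_coe_eventually {U : Opens X} {x : U} {p : U → Prop} (h : ∀ᶠ y in nhds x, p y) :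
    ∃ (V : Opens X) (i : V ≤ U), (x : X) ∈ V ∧ ∀ y : V, p ⟨y, i y.2⟩ := by
  obtain ⟨W, hW, hWo, hx⟩ := eventually_nhds_iff.1 h
  refine ⟨⟨Subtype.val '' W, U.isOpen.isOpenEmbedding_subtypeVal.isOpenMap _ hWo⟩, ?_, ⟨x, hx, rfl⟩,
    ?_⟩
  · rintro _ ⟨y, -, rfl⟩
    exact y.2
  · rintro ⟨_, y, hy, rfl⟩
    exact hW y hy

instance epi_toQuotientSheaf (S : GermSubgroups T) : Epi (toQuotientSheaf S) := by
  refine AbSheaf.epi_of_locally _ fun U q x hx => ?_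
  obtain ⟨t, ht⟩ := q.2 ⟨x, hx⟩
  obtain ⟨V, i, hV, h⟩ := nhds_coe_eventually ht
  refine ⟨V, i, hV, ⟨fun y => t y, trivial⟩, Subtype.ext (funext fun y => ?_)⟩
  refine Eq.trans (S.mk_eq ?_) (h y).2.symm
  filter_upwards [V.isOpen.mem_nhds y.2] with z hz
  exact extendByZero_apply _ hz

/-- If the sections of `F` are the families whose germs all belong to `S`, then
`0 → F → ∏ T → ∏ T / S → 0` is exact. -/
theorem shortExact_toQuotientSheaf (S : GermSubgroups T) {F : AbSheaf X} (f : F ⟶ allSections T)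
    (hinj : ∀ U, Function.Injective (AbSheaf.app f U))
    (hf : ∀ (U : Opens X) (t : ∀ x : U, T x),
      (∀ x : U, extendByZero t ∈ S.carrier x) ↔ ∃ s, (AbSheaf.app f U s).1 = t) :
    ∃ w, (ShortComplex.mk f (toQuotientSheaf S) w).ShortExact := by
  have w : f ≫ toQuotientSheaf S = 0 := by
    ext U s
    refine Subtype.ext (funext fun x => ?_)
    exact (QuotientAddGroup.eq_zero_iff _).2 ((hf U.unop _).2 ⟨s, rfl⟩ x)
  refine ⟨w, AbSheaf.shortExact_of_sections f _ w hinj (fun U t ht => ?_) inferInstance⟩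
  obtain ⟨s, hs⟩ := (hf U t.1).1 fun x =>
    (QuotientAddGroup.eq_zero_iff _).1 (congrFun (congrArg Subtype.val ht) x)
  exact ⟨s, Subtype.ext hs⟩

end Sections

/-! ### Injectivity of the sheaf of all families -/

section Injective

variable {X : Type u} [TopologicalSpace X] (T : X → Type u) [∀ x, AddCommGroup (T x)]

/-- A map to the sheaf of all families is given by maps on stalks; as passing to stalks preserves
monomorphisms, the sheaf of all families of elements of injective groups is injective. -/
theorem injective_allSections (h : ∀ x, Injective (AddCommGrpCat.of (T x))) :
    Injective (allSections T) := by
  refine ⟨fun {G H} φ i hi => ?_⟩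
  let Φ := fun x : X => Opens.pointGrothendieckTopology x
  have hpt : ∀ {x : X} {U : Opens X}, (Φ x).fiber.obj U → x ∈ U := fun h => h.down.down
  -- `ψ` is the map on stalks that corresponds to `φ`, `χ` is an extension of it along `i`, and
  -- `val` gives the values of the extension of `φ`.
  let ψ : ∀ x, (Φ x).sheafFiber.obj G ⟶ AddCommGrpCat.of (T x) := fun x =>
    (Φ x).presheafFiberDesc (fun U hx => AddCommGrpCat.ofHom
      ((Pi.evalAddMonoidHom (fun y : U => T y) ⟨x, hpt hx⟩).comp
        ((AddSubgroup.subtype _).comp (AbSheaf.app φ U)))) (by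
      intro U V f hx
      ext s
      exact congrFun (congrArg Subtype.val (AbSheaf.app_res φ f.le s)) _)
  have hmono : ∀ x, Mono ((Φ x).sheafFiber.map i) := fun x => inferInstance
  let χ : ∀ x, (Φ x).sheafFiber.obj H ⟶ AddCommGrpCat.of (T x) := fun x =>
    Injective.factorThru (ψ x) ((Φ x).sheafFiber.map i)
  have hχ : ∀ x, (Φ x).sheafFiber.map i ≫ χ x = ψ x := fun x => Injective.comp_factorThru _ _
  let val : ∀ (U : Opens X) (x : U), H.sections U →+ T x := fun U x =>
    ((Φ x.1).toPresheafFiber U ⟨⟨x.2⟩⟩ H.obj ≫ χ x.1).hom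
  refine ⟨⟨{
      app := fun U => AddCommGrpCat.ofHom (AddMonoidHom.mk'
        (fun s => (⟨fun x => val U.unop x s, trivial⟩ : (⊤ : AddSubgroup (∀ x : U.unop, T x))))
        fun a b => Subtype.ext (funext fun x => map_add (val U.unop x) a b))
      naturality := ?_ }⟩, ?_⟩
  · intro U V f
    ext s
    refine Subtype.ext (funext fun x => ?_)
    have := (Φ x.1).toPresheafFiber_w f.unop ⟨⟨x.2⟩⟩ H.obj
    exact ConcreteCategory.congr_hom (congrArg (· ≫ χ x.1) this) s
  · ext U s
    refine Subtype.ext (funext fun x => ?_)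
    have h1 := (Φ x.1).toPresheafFiber_naturality i.hom U.unop ⟨⟨x.2⟩⟩
    have h2 : (Φ x.1).toPresheafFiber U.unop ⟨⟨x.2⟩⟩ G.obj ≫ ψ x.1 = _ :=
      (Φ x.1).toPresheafFiber_presheafFiberDesc _ _ _ _
    rw [← hχ] at h2
    have h3 := ConcreteCategory.congr_hom (congrArg (· ≫ χ x.1) h1) s
    exact h3.symm.trans (ConcreteCategory.congr_hom h2 s)

end Injective

/-! ### Cohomology in low degrees from injective resolutions -/

/-- Divisible abelian groups are injective. -/
theorem AddCommGrpCat.injective_of_smul_surjective (A : Type u) [AddCommGroup A]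
    (h : ∀ k : ℤ, k ≠ 0 → Function.Surjective fun a : A => k • a) :
    Injective (AddCommGrpCat.of A) :=
  letI := divisibleByOfSMulRightSurj A ℤ fun {k} hk => h k hk
  AddCommGrpCat.injective_of_divisible A

section Cohomology

variable {X : Type u} [TopologicalSpace X]

theorem exists_equiv_quotient_of_surjective {A B C : Type*} [AddCommGroup A] [AddCommGroup B]
    [AddCommGroup C] (f : A →+ B) (g : B →+ C) (hg : Function.Surjective g)
    (h : ∀ b, g b = 0 ↔ ∃ a, f a = b) : Nonempty (C ≃+ B ⧸ f.range) := by
  have e : g.ker = f.range := by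
    ext b
    rw [AddMonoidHom.mem_ker, h]
    rfl
  exact ⟨((QuotientAddGroup.quotientAddEquivOfEq e.symm).trans
    (QuotientAddGroup.quotientKerEquivOfSurjective g hg)).symm⟩

variable {S : ShortComplex (AbSheaf X)} (hS : S.ShortExact)
include hS

open Abelian

theorem extClass_surjective (n : ℕ) [Subsingleton (S.X₂.H (n + 1))] (x : S.X₁.H (n + 1)) :
    ∃ y : S.X₃.H n, y.comp hS.extClass rfl = x :=
  Ext.covariant_sequence_exact₁ _ hS x (Subsingleton.elim (α := S.X₂.H (n + 1)) _ _) rfl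

theorem comp_extClass_eq_zero_iff (n : ℕ) (y : S.X₃.H n) :
    y.comp hS.extClass rfl = (0 : S.X₁.H (n + 1)) ↔ ∃ z : S.X₂.H n, Sheaf.H.map S.g n z = y := by
  refine ⟨fun h => Ext.covariant_sequence_exact₃ _ hS y rfl h, ?_⟩
  rintro ⟨z, rfl⟩
  rw [Sheaf.H.map_apply, Ext.comp_assoc_of_second_deg_zero, hS.comp_extClass, Ext.comp_zero]

/-- The first cohomology of a subsheaf of an injective sheaf is the cokernel of the map on global
sections from the injective sheaf to the quotient. -/
theorem exists_H_one_equiv [Subsingleton (S.X₂.H 1)] :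
    Nonempty (S.X₁.H 1 ≃+ S.X₃.obj.obj (op ⊤) ⧸ (AbSheaf.app S.g ⊤).range) := by
  let e₂ := Sheaf.H.equiv₀ S.X₂ (Limits.isTerminalTop (α := Opens X))
  let e₃ := Sheaf.H.equiv₀ S.X₃ (Limits.isTerminalTop (α := Opens X))
  have hnat : ∀ x, AbSheaf.app S.g ⊤ (e₂ x) = e₃ (Sheaf.H.map S.g 0 x) :=
    fun x => Sheaf.H.equiv₀_naturality (Limits.isTerminalTop (α := Opens X)) S.g x
  refine exists_equiv_quotient_of_surjective _ ((hS.extClass.postcomp _ rfl : S.X₃.H 0 →+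
    S.X₁.H 1).comp e₃.symm.toAddMonoidHom) (fun x => ?_) fun b => ?_
  · obtain ⟨y, hy⟩ := extClass_surjective hS 0 x
    exact ⟨e₃ y, by simpa using hy⟩
  · refine (comp_extClass_eq_zero_iff hS 0 (e₃.symm b)).trans ⟨?_, ?_⟩
    · rintro ⟨z, hz⟩
      exact ⟨e₂ z, by rw [hnat, hz, e₃.apply_symm_apply]⟩
    · rintro ⟨a, rfl⟩
      exact ⟨e₂.symm a, e₃.injective (by rw [← hnat]; simp)⟩

/-- `H¹` of the first term of a short exact sequence vanishes if that of the middle term does, and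
global sections lift from the last term to the middle term. -/
theorem subsingleton_H_one [Subsingleton (S.X₂.H 1)]
    (h : Function.Surjective (AbSheaf.app S.g ⊤)) : Subsingleton (S.X₁.H 1) := by
  obtain ⟨e⟩ := exists_H_one_equiv hS
  rw [AddMonoidHom.range_eq_top.2 h] at e
  have := QuotientAddGroup.subsingleton_quotient_top (G := S.X₃.obj.obj (op ⊤))
  exact e.toEquiv.subsingleton

theorem subsingleton_H_two [Subsingleton (S.X₂.H 2)] [Subsingleton (S.X₃.H 1)] :
    Subsingleton (S.X₁.H 2) := by
  refine subsingleton_of_forall_eq 0 fun x => ?_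
  obtain ⟨y, rfl⟩ := extClass_surjective hS 1 x
  rw [Subsingleton.elim y 0, Ext.zero_comp]

/-- If the middle term of a short exact sequence is acyclic, the connecting map from `H¹` to `H²` is
bijective. -/
theorem exists_H_two_equiv [Subsingleton (S.X₂.H 1)] [Subsingleton (S.X₂.H 2)] :
    Nonempty (S.X₃.H 1 ≃+ S.X₁.H 2) := by
  refine ⟨AddEquiv.ofBijective (hS.extClass.postcomp _ rfl : S.X₃.H 1 →+ S.X₁.H 2) ⟨?_, ?_⟩⟩
  · rw [injective_iff_map_eq_zero]
    intro y hy
    obtain ⟨z, rfl⟩ := (comp_extClass_eq_zero_iff hS 1 y).1 hy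
    rw [Subsingleton.elim z 0, map_zero]
  · exact fun x => extClass_surjective hS 1 x

end Cohomology

/-! ### Hypercohomology of a complex in two degrees -/

section Triangulated

open Pretriangulated Limits

/-- A diagram chase with the triangles `F → J → P → F[1]` and `F → Ω → K → F[1]`, where `J` is the
direct sum of `I` and `Ω` and there are no morphisms `Z → I[1]`: the group of morphisms `Z → K` is
the cokernel of `Hom(Z, I) → Hom(Z, P)`. -/
theorem exists_hom_equiv_of_triangles {C : Type*} [Category* C] [Preadditive C] [HasZeroObject C]
    [HasShift C ℤ] [∀ k : ℤ, (shiftFunctor C k).Additive] [Pretriangulated C]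
    {Z I Ω F J P K : C} {i : F ⟶ J} {p : J ⟶ P} {e : P ⟶ F⟦(1 : ℤ)⟧}
    (h₁ : Triangle.mk i p e ∈ distTriang C) {d : F ⟶ Ω} {r : Ω ⟶ K} {v : K ⟶ F⟦(1 : ℤ)⟧}
    (h₂ : Triangle.mk d r v ∈ distTriang C) {inI : I ⟶ J} {inΩ : Ω ⟶ J} {prI : J ⟶ I}
    {prΩ : J ⟶ Ω} (hid : prI ≫ inI + prΩ ≫ inΩ = 𝟙 J) (hΩ : inΩ ≫ prΩ = 𝟙 Ω)
    (hIΩ : inI ≫ prΩ = 0) (hd : i ≫ prΩ = d) (hZ : ∀ f : Z ⟶ I⟦(1 : ℤ)⟧, f = 0) :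
    ∃ f : (Z ⟶ P) →+ (Z ⟶ K), Function.Surjective f ∧
      ∀ b, f b = 0 ↔ ∃ a : Z ⟶ I, a ≫ inI ≫ p = b := by
  have hip : i ≫ p = 0 := comp_distTriang_mor_zero₁₂ _ h₁
  have hdr : d ≫ r = 0 := comp_distTriang_mor_zero₁₂ _ h₂
  have hvd : v ≫ d⟦(1 : ℤ)⟧' = 0 := comp_distTriang_mor_zero₃₁ _ h₂
  have ex₁ : ∀ x : Z ⟶ F⟦(1 : ℤ)⟧, x ≫ i⟦(1 : ℤ)⟧' = 0 → ∃ b : Z ⟶ P, x = b ≫ e :=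
    fun x => Triangle.coyoneda_exact₁ _ h₁ x
  have ex₂ : ∀ x : Z ⟶ P, x ≫ e = 0 → ∃ j : Z ⟶ J, x = j ≫ p :=
    fun x => Triangle.coyoneda_exact₃ _ h₁ x
  have ex₃ : ∀ x : Z ⟶ K, x ≫ v = 0 → ∃ w : Z ⟶ Ω, x = w ≫ r :=
    fun x => Triangle.coyoneda_exact₃ _ h₂ x
  have ex₄ : ∀ x : Z ⟶ Ω, x ≫ r = 0 → ∃ f : Z ⟶ F, x = f ≫ d :=
    fun x => Triangle.coyoneda_exact₂ _ h₂ x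
  -- The homomorphism is composition with a morphism of triangles `θ` over the identity of `F`.
  obtain ⟨θ, hθ₁, hθ₂⟩ : ∃ θ : P ⟶ K, p ≫ θ = prΩ ≫ r ∧ e = θ ≫ v := by
    obtain ⟨θ, hθ₁, hθ₂⟩ := complete_distinguished_triangle_morphism _ _ h₁ h₂ (𝟙 F) prΩ
      (hd.trans (Category.id_comp d).symm)
    refine ⟨θ, hθ₁, Eq.trans ?_ hθ₂⟩
    change e = e ≫ (𝟙 F)⟦(1 : ℤ)⟧'
    rw [CategoryTheory.Functor.map_id, Category.comp_id]
  refine ⟨AddMonoidHom.mk' (fun b => b ≫ θ) fun a b => Preadditive.add_comp _ _ _ _ _ _,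
    fun c => ?_, fun b => ⟨fun hb => ?_, ?_⟩⟩
  -- For surjectivity, `c ≫ v` vanishes in `J[1]`: its component in `I[1]` is zero by `hZ`, and its
  -- component in `Ω[1]` is zero because `v` and `d[1]` are consecutive in a triangle.
  · have h0 : (c ≫ v) ≫ i⟦(1 : ℤ)⟧' = 0 := by
      have e1 : ((c ≫ v) ≫ i⟦(1 : ℤ)⟧') ≫ prI⟦(1 : ℤ)⟧' = 0 := hZ _
      have e2 : ((c ≫ v) ≫ i⟦(1 : ℤ)⟧') ≫ prΩ⟦(1 : ℤ)⟧' = 0 := by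
        rw [Category.assoc, Category.assoc, ← Functor.map_comp, hd, hvd, Limits.comp_zero]
      calc (c ≫ v) ≫ i⟦(1 : ℤ)⟧' = ((c ≫ v) ≫ i⟦(1 : ℤ)⟧') ≫ (𝟙 J)⟦(1 : ℤ)⟧' := by simp
        _ = 0 := by
          rw [← hid, Functor.map_add, Functor.map_comp, Functor.map_comp, Preadditive.comp_add,
            ← Category.assoc, e1, ← Category.assoc, e2]
          simp
    obtain ⟨b, hb⟩ := ex₁ (c ≫ v) h0
    obtain ⟨w, hw⟩ := ex₃ (c - b ≫ θ) (by
      rw [Preadditive.sub_comp, Category.assoc, ← hθ₂, hb, sub_self])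
    refine ⟨b + w ≫ inΩ ≫ p, ?_⟩
    change (b + w ≫ inΩ ≫ p) ≫ θ = c
    rw [Preadditive.add_comp, Category.assoc, Category.assoc, hθ₁, reassoc_of% hΩ, ← hw]
    abel
  -- For the kernel, `b` lifts to `j : Z ⟶ J`, and `j` can be changed by a morphism that factors
  -- through `F` so that its component in `Ω` becomes zero.
  · change b ≫ θ = 0 at hb
    obtain ⟨j, hj⟩ := ex₂ b (by
      rw [hθ₂, reassoc_of% hb, Limits.zero_comp])
    obtain ⟨f, hf⟩ := ex₄ (j ≫ prΩ) (by
      rw [Category.assoc, ← hθ₁, ← Category.assoc, ← hj, hb])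
    refine ⟨(j - f ≫ i) ≫ prI, ?_⟩
    have h0 : (j - f ≫ i) ≫ prΩ = 0 := by
      rw [Preadditive.sub_comp, hf, Category.assoc, hd, sub_self]
    have h3 : (j - f ≫ i) ≫ prI ≫ inI = j - f ≫ i := by
      have := (j - f ≫ i) ≫= hid
      rwa [Preadditive.comp_add, reassoc_of% h0, zero_comp, add_zero, Category.comp_id] at this
    rw [Category.assoc, reassoc_of% h3, Preadditive.sub_comp, Category.assoc, hip, hj]
    simp
  · rintro ⟨a, rfl⟩
    change (a ≫ inI ≫ p) ≫ θ = 0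
    rw [Category.assoc, Category.assoc, hθ₁, reassoc_of% hIΩ]
    simp

end Triangulated

section Double

open CochainComplex HomComplex HomologicalComplex Limits

variable {C : Type*} [Category* C] [Preadditive C] [HasZeroObject C] [HasBinaryBiproducts C]

omit [HasZeroObject C] in
/-- In degrees in which only the first summand of the mapping cocone is nonzero, a lift is an
isomorphism if its first component is. -/
theorem isIso_mappingCocone_lift_fst {K L M : CochainComplex C ℤ} (φ : K ⟶ L) (α : M ⟶ K)
    (β : Cochain M L (-1)) (h : δ (-1) 0 β + Cochain.ofHom (α ≫ φ) = 0) (p q : ℤ) (hpq : p + -1 = q)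
    (hα : IsIso (α.f p)) (hL : IsZero (L.X q)) : IsIso ((mappingCocone.lift φ α β h).f p) := by
  have h1 := mappingCocone.lift_f_fst_f φ α β h p
  have h2 := mappingCocone.id_X φ p q hpq
  have h3 : (mappingCocone.snd φ).v p q hpq = 0 := hL.eq_of_tgt _ _
  rw [h3, zero_comp, add_zero] at h2
  have : IsIso ((mappingCocone.fst φ).f p) :=
    ⟨(mappingCocone.inl φ).v p p (add_zero p), h2, by simp⟩
  exact IsIso.of_isIso_fac_right h1

omit [HasZeroObject C] in
/-- In degrees in which only the second summand of the mapping cocone is nonzero, a lift is an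
isomorphism if its second component is. -/
theorem isIso_mappingCocone_lift_snd {K L M : CochainComplex C ℤ} (φ : K ⟶ L) (α : M ⟶ K)
    (β : Cochain M L (-1)) (h : δ (-1) 0 β + Cochain.ofHom (α ≫ φ) = 0) (p q : ℤ) (hpq : p + -1 = q)
    (hβ : IsIso (β.v p q hpq)) (hK : IsZero (K.X p)) :
    IsIso ((mappingCocone.lift φ α β h).f p) := by
  have h1 := mappingCocone.lift_f_snd_v φ α β h p q hpq
  have h2 := mappingCocone.id_X φ p q hpq
  have h3 : (mappingCocone.fst φ).f p = 0 := hK.eq_of_tgt _ _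
  rw [h3, zero_comp, zero_add] at h2
  have : IsIso ((mappingCocone.snd φ).v p q hpq) :=
    ⟨(mappingCocone.inr φ).1.v q p (by lia), h2, by simp⟩
  exact IsIso.of_isIso_fac_right h1

/-- A complex in degrees `0` and `1` is the shifted mapping cone of its differential. -/
theorem nonempty_double_iso_mappingCocone {A B : C} (f : A ⟶ B) :
    Nonempty (double f (show (ComplexShape.up ℤ).Rel 0 1 from zero_add 1) ≅
      mappingCocone ((CochainComplex.singleFunctor C 0).map f)) := by
  let hr : (ComplexShape.up ℤ).Rel 0 1 := zero_add 1
  let M := double f hr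
  let α : M ⟶ (CochainComplex.singleFunctor C 0).obj A :=
    mkHomFromDouble hr zero_ne_one (singleObjXSelf _ 0 A).inv 0
      ((isZero_single_obj_X (ComplexShape.up ℤ) 0 A 1 one_ne_zero).eq_of_tgt _ _)
      (by simp)
  let β : Cochain M ((CochainComplex.singleFunctor C 0).obj B) (-1) :=
    Cochain.mk fun p q hpq => if hp : p = 1 then
      -(eqToHom (by rw [hp]) ≫ (doubleXIso₁ f hr zero_ne_one).hom ≫
        (singleObjXSelf (ComplexShape.up ℤ) 0 B).inv ≫ eqToHom (by
          obtain rfl : q = 0 := by lia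
          rfl)) else 0
  have hβ : β.v 1 0 (by lia) = -((doubleXIso₁ f hr zero_ne_one).hom ≫
      (singleObjXSelf (ComplexShape.up ℤ) 0 B).inv) := by
    simp only [β, Cochain.mk_v, dif_pos, eqToHom_refl, Category.id_comp]
    exact congrArg (fun k => -((doubleXIso₁ f hr zero_ne_one).hom ≫ k)) (Category.comp_id _)
  have hsum : ∀ {Y₀ Y₁ Y₂ Y₃ : C} (a : Y₀ ≅ A) (b : Y₁ ≅ B) (a' : Y₂ ≅ A) (b' : Y₃ ≅ B),
      (a.hom ≫ f ≫ b.inv) ≫ (-(b.hom ≫ b'.inv)) + (a.hom ≫ a'.inv) ≫ a'.hom ≫ f ≫ b'.inv = 0 := by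
    intros
    simp
  -- The sign in `β` makes the two terms cancel in degree `0`.
  have h : δ (-1) 0 β + Cochain.ofHom (α ≫ (CochainComplex.singleFunctor C 0).map f) = 0 := by
    ext p
    by_cases hp : p = 0
    · subst hp
      have hα : α.f 0 = (doubleXIso₀ f hr).hom ≫ (singleObjXSelf _ 0 A).inv :=
        mkHomFromDouble_f₀ ..
      have hz : β.v 0 (-1) (by lia) = 0 :=
        (isZero_single_obj_X (ComplexShape.up ℤ) 0 B (-1) (by lia)).eq_of_tgt _ _
      have hs : ((CochainComplex.singleFunctor C 0).map f).f 0 =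
          (singleObjXSelf (ComplexShape.up ℤ) 0 A).hom ≫ f ≫
            (singleObjXSelf (ComplexShape.up ℤ) 0 B).inv := single_map_f_self ..
      rw [Cochain.add_v, δ_v (-1) 0 (by lia) β 0 0 (by lia) (-1) 1 (by lia) (by lia), hz, hβ,
        double_d f hr zero_ne_one, Cochain.ofHom_v, comp_f, hα, hs]
      rw [zero_comp, zero_add, Int.negOnePow_zero, one_smul]
      exact hsum (doubleXIso₀ f hr) (doubleXIso₁ f hr zero_ne_one) (singleObjXSelf _ 0 A)
        (singleObjXSelf _ 0 B)
    · exact (isZero_single_obj_X (ComplexShape.up ℤ) 0 B p hp).eq_of_tgt _ _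
  have hneg : ∀ {Y Y' : C} (e : Y ≅ Y'), IsIso (-e.hom) := fun e => ⟨-e.inv, by simp, by simp⟩
  have hiso : ∀ p, IsIso ((mappingCocone.lift _ α β h).f p) := by
    intro p
    by_cases h0 : p = 0
    · subst h0
      refine isIso_mappingCocone_lift_fst _ α β h 0 (-1) (by lia) ?_
        (isZero_single_obj_X (ComplexShape.up ℤ) 0 B (-1) (by lia))
      have : α.f 0 = (doubleXIso₀ f hr).hom ≫ (singleObjXSelf _ 0 A).inv :=
        mkHomFromDouble_f₀ ..
      rw [this]
      exact (doubleXIso₀ f hr ≪≫ (singleObjXSelf (ComplexShape.up ℤ) 0 A).symm).isIso_hom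
    by_cases h1 : p = 1
    · subst h1
      refine isIso_mappingCocone_lift_snd _ α β h 1 0 (by lia) ?_
        (isZero_single_obj_X (ComplexShape.up ℤ) 0 A 1 (by lia))
      rw [hβ]
      exact hneg (doubleXIso₁ f hr zero_ne_one ≪≫ (singleObjXSelf (ComplexShape.up ℤ) 0 B).symm)
    · refine isIso_mappingCocone_lift_fst _ α β h p (p + -1) rfl ?_
        (isZero_single_obj_X (ComplexShape.up ℤ) 0 B _ (by lia))
      have hz := isZero_double_X f hr p h0 h1
      have hz' := isZero_single_obj_X (ComplexShape.up ℤ) 0 A p h0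
      exact ⟨0, hz.eq_of_src _ _, hz'.eq_of_src _ _⟩
  have := HomologicalComplex.Hom.isIso_of_components (mappingCocone.lift _ α β h)
  exact ⟨asIso (mappingCocone.lift _ α β h)⟩

end Double

section DoubleTriangle

open Pretriangulated HomologicalComplex

variable {C : Type*} [Category* C] [Abelian C] [HasDerivedCategory C]

/-- In the derived category, a complex in degrees `0` and `1`, shifted by one, is a cone of its
differential. -/
theorem exists_distinguished_double {A B : C} (f : A ⟶ B) :
    ∃ (r : (DerivedCategory.singleFunctor C 0).obj B ⟶ (DerivedCategory.Q.obj
        (double f (show (ComplexShape.up ℤ).Rel 0 1 from zero_add 1)))⟦(1 : ℤ)⟧)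
      (v : (DerivedCategory.Q.obj
        (double f (show (ComplexShape.up ℤ).Rel 0 1 from zero_add 1)))⟦(1 : ℤ)⟧ ⟶
        ((DerivedCategory.singleFunctor C 0).obj A)⟦(1 : ℤ)⟧),
      Triangle.mk ((DerivedCategory.singleFunctor C 0).map f) r v ∈
        distTriang (DerivedCategory C) := by
  obtain ⟨e⟩ := nonempty_double_iso_mappingCocone f
  let φ := (CochainComplex.singleFunctor C 0).map f
  let k := (shiftFunctor (DerivedCategory C) (1 : ℤ)).mapIso (DerivedCategory.Q.mapIso e)
  let r₀ : (DerivedCategory.singleFunctor C 0).obj B ⟶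
      (DerivedCategory.Q.obj (CochainComplex.mappingCocone φ))⟦(1 : ℤ)⟧ :=
    (DerivedCategory.Q.mapTriangle.obj (CochainComplex.mappingCocone.triangle φ)).mor₃
  let v₀ : (DerivedCategory.Q.obj (CochainComplex.mappingCocone φ))⟦(1 : ℤ)⟧ ⟶
      ((DerivedCategory.singleFunctor C 0).obj A)⟦(1 : ℤ)⟧ :=
    -(shiftFunctor (DerivedCategory C) (1 : ℤ)).map
      (DerivedCategory.Q.mapTriangle.obj (CochainComplex.mappingCocone.triangle φ)).mor₁
  have h : Triangle.mk (DerivedCategory.Q.map φ) r₀ v₀ ∈ distTriang (DerivedCategory C) :=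
    rot_of_distTriang _ (DerivedCategory.mappingCocone_triangle_distinguished φ)
  refine ⟨r₀ ≫ k.inv, k.hom ≫ v₀, isomorphic_distinguished _ h _
    (Triangle.isoMk _ _ (Iso.refl _) (Iso.refl _) k ?_ ?_ ?_)⟩
  · exact (Category.comp_id _).trans (Category.id_comp _).symm
  · exact (Category.assoc _ k.inv k.hom).trans ((congrArg _ k.inv_hom_id).trans
      ((Category.comp_id _).trans (Category.id_comp _).symm))
  · exact (congrArg _ (CategoryTheory.Functor.map_id _ _)).trans (Category.comp_id _)

end DoubleTriangle

section Hypercohomology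

open Abelian Limits Pretriangulated

variable {X : Type u} [TopologicalSpace X]

/-- Global sections of a sheaf are the morphisms from the constant sheaf `ℤ`. -/
def AbSheaf.homEquiv (F : AbSheaf X) : F.obj.obj (op ⊤) ≃+ (integerSheaf X ⟶ F) :=
  (Sheaf.H.equiv₀ F (isTerminalTop (α := Opens X))).symm.trans Ext.addEquiv₀

theorem AbSheaf.homEquiv_app {F G : AbSheaf X} (f : F ⟶ G) (s : F.obj.obj (op ⊤)) :
    G.homEquiv (AbSheaf.app f ⊤ s) = F.homEquiv s ≫ f := by
  have := Sheaf.H.equiv₀_symm_naturality (isTerminalTop (α := Opens X)) f s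
  exact (congrArg Ext.addEquiv₀ this.symm).trans (Sheaf.H.addEquiv₀_map f _)

/-- If `F → I ⊞ Ω → P` is short exact with `I` injective, then the first hypercohomology of the
complex `d : F → Ω` is the cokernel of the map on global sections from `I` to `P`. -/
theorem exists_hypercohomology_equiv {F I Ω P : AbSheaf X} (d : F ⟶ Ω) (j : F ⟶ I) (β : I ⟶ P)
    (γ : Ω ⟶ P) (w : biprod.lift j d ≫ biprod.desc β γ = 0)
    (hS : (ShortComplex.mk _ _ w).ShortExact) [Injective I] :
    Nonempty (Hypercohomology X (HomologicalComplex.double d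
      (show (ComplexShape.up ℤ).Rel 0 1 from zero_add 1)) 1 ≃+
        P.obj.obj (op ⊤) ⧸ (AbSheaf.app β ⊤).range) := by
  let := HasDerivedCategory.standard (AbSheaf X)
  let R := DerivedCategory.singleFunctor (AbSheaf X) 0
  obtain ⟨r, v, h₂⟩ := exists_distinguished_double d
  have h₁ : Triangle.mk (R.map (biprod.lift j d)) (R.map (biprod.desc β γ))
      hS.singleδ ∈ distTriang _ := hS.singleTriangle_distinguished
  have hZ : ∀ f : R.obj (integerSheaf X) ⟶ (R.obj I)⟦(1 : ℤ)⟧, f = 0 := by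
    intro f
    obtain ⟨x, hx⟩ := (Ext.homEquiv (X := integerSheaf X) (Y := I) (n := 1)).surjective f
    rw [← hx, Ext.eq_zero_of_injective x]
    exact Ext.zero_hom _ _ _
  obtain ⟨f, hf, hf'⟩ := exists_hom_equiv_of_triangles (Z := R.obj (integerSheaf X))
    h₁ h₂ (inI := R.map biprod.inl) (inΩ := R.map biprod.inr) (prI := R.map biprod.fst)
    (prΩ := R.map biprod.snd)
    (by rw [← R.map_comp, ← R.map_comp, ← R.map_add, biprod.total]; exact R.map_id _)
    (by rw [← R.map_comp, biprod.inr_snd]; exact R.map_id _)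
    (by rw [← R.map_comp, biprod.inl_snd]; exact R.map_zero _ _)
    (by rw [← R.map_comp, biprod.lift_snd]) hZ
  let g : P.obj.obj (op ⊤) →+ Hypercohomology X (HomologicalComplex.double d
      (show (ComplexShape.up ℤ).Rel 0 1 from zero_add 1)) 1 :=
    f.comp (AddMonoidHom.mk' (fun s => R.map (P.homEquiv s)) fun s t => by
      rw [map_add, R.map_add])
  refine exists_equiv_quotient_of_surjective _ g (fun x => ?_) fun s => ?_
  · obtain ⟨y, hy⟩ := hf x
    obtain ⟨z, rfl⟩ := R.map_surjective y
    refine ⟨P.homEquiv.symm z, ?_⟩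
    change f (R.map (P.homEquiv _)) = x
    rw [AddEquiv.apply_symm_apply, hy]
  · change f (R.map (P.homEquiv s)) = 0 ↔ _
    rw [hf']
    constructor
    · rintro ⟨a, ha⟩
      obtain ⟨b, rfl⟩ := R.map_surjective a
      refine ⟨I.homEquiv.symm b, P.homEquiv.injective (R.map_injective ?_)⟩
      rw [AbSheaf.homEquiv_app, AddEquiv.apply_symm_apply, ← ha]
      change R.map (b ≫ β) = R.map b ≫ R.map biprod.inl ≫ R.map (biprod.desc β γ)
      rw [← R.map_comp, ← R.map_comp, biprod.inl_desc]
    · rintro ⟨t, rfl⟩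
      refine ⟨R.map (I.homEquiv t), ?_⟩
      rw [AbSheaf.homEquiv_app]
      rw [← R.map_comp, ← R.map_comp, biprod.inl_desc]

end Hypercohomology

/-! ### Paracompact manifolds -/

section Paracompact

open Set

/-- A paracompact locally compact space is a disjoint union of open `σ`-compact subspaces. -/
theorem exists_isLocallyConstant_isSigmaCompact (X : Type u) [TopologicalSpace X]
    [LocallyCompactSpace X] [T2Space X] [ParacompactSpace X] :
    ∃ (ι : Type u) (p : X → ι), IsLocallyConstant p ∧ ∀ i, IsSigmaCompact (p ⁻¹' {i}) := by
  have h : ∀ x : X, ∃ U : Set X, IsOpen U ∧ x ∈ U ∧ IsCompact (closure U) := by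
    intro x
    obtain ⟨K, hK, hx⟩ := exists_compact_mem_nhds x
    exact ⟨interior K, isOpen_interior, mem_interior_iff_mem_nhds.2 hx,
      hK.of_isClosed_subset isClosed_closure (closure_minimal interior_subset hK.isClosed)⟩
  choose U hUo hxU hUc using h
  obtain ⟨V, hVo, hVcov, hVlf, hVU⟩ := precise_refinement U hUo
    (iUnion_eq_univ_iff.2 fun x => ⟨x, hxU x⟩)
  have hVc : ∀ i, IsCompact (closure (V i)) := fun i =>
    (hUc i).of_isClosed_subset isClosed_closure (closure_mono (hVU i))
  let R : X → X → Prop := fun i j => (V i ∩ V j).Nonempty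
  have hfin : ∀ i, {j | R i j}.Finite := fun i =>
    (hVlf.finite_nonempty_inter_compact (hVc i)).subset fun j hj => by
      obtain ⟨x, hi, hj⟩ := hj
      exact ⟨x, hj, subset_closure hi⟩
  -- Two members of the cover belong to the same class if they are joined by a chain of members,
  -- each of which meets the next; as each member meets finitely many, the classes are countable.
  let s : Setoid X := Relation.EqvGen.setoid R
  have hmem : ∀ x : X, ∃ i, x ∈ V i := iUnion_eq_univ_iff.1 hVcov
  choose c hc using hmem
  have hcls : ∀ {x i}, x ∈ V i → (⟦c x⟧ : Quotient s) = ⟦i⟧ := fun {x i} hx =>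
    Quotient.sound (Relation.EqvGen.rel _ _ ⟨x, hc x, hx⟩)
  have hloc : IsLocallyConstant fun x => (⟦c x⟧ : Quotient s) := by
    rw [IsLocallyConstant.iff_eventually_eq]
    intro x
    filter_upwards [(hVo _).mem_nhds (hc x)] with y hy
    exact hcls hy
  refine ⟨Quotient s, fun x => ⟦c x⟧, hloc, fun q => ?_⟩
  obtain ⟨i, rfl⟩ := Quotient.exists_rep q
  have hcount : {j | (⟦j⟧ : Quotient s) = ⟦i⟧}.Countable := by
    let S : ℕ → Set X := fun k => Nat.rec {i} (fun _ A => ⋃ j ∈ A, {l | R j l}) k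
    have hS : ∀ k, (S k).Countable := by
      intro k
      induction k with
      | zero => exact countable_singleton i
      | succ k ih => exact ih.biUnion fun j _ => (hfin j).countable
    refine (countable_iUnion hS).mono ?_
    have hsymm : ∀ {a b}, R a b → R b a := fun {a b} h => by
      obtain ⟨x, h, h'⟩ := h
      exact ⟨x, h', h⟩
    have key : ∀ {a b}, Relation.EqvGen R a b → (a ∈ ⋃ k, S k ↔ b ∈ ⋃ k, S k) := by
      have step : ∀ {a b}, R a b → a ∈ ⋃ k, S k → b ∈ ⋃ k, S k := by
        intro a b hab ha
        obtain ⟨k, hk⟩ := mem_iUnion.1 ha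
        exact mem_iUnion.2 ⟨k + 1, mem_biUnion hk hab⟩
      intro a b hab
      induction hab with
      | rel a b h => exact ⟨step h, step (hsymm h)⟩
      | refl a => exact Iff.rfl
      | symm a b _ ih => exact ih.symm
      | trans a b c _ _ ih ih' => exact ih.trans ih'
    intro j hj
    exact (key (Quotient.exact hj)).2 (mem_iUnion.2 ⟨0, rfl⟩)
  have e : (fun x => (⟦c x⟧ : Quotient s)) ⁻¹' {⟦i⟧} =
      ⋃ j ∈ {j | (⟦j⟧ : Quotient s) = ⟦i⟧}, closure (V j) := by
    ext x
    simp only [mem_preimage, mem_singleton_iff, mem_iUnion, mem_ofPred_eq, exists_prop]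
    refine ⟨fun h => ⟨c x, h, subset_closure (hc x)⟩, ?_⟩
    rintro ⟨j, hj, hx⟩
    have hcl : IsClosed {x | (⟦c x⟧ : Quotient s) = ⟦j⟧} := (hloc.isClosed_fiber ⟦j⟧)
    exact (closure_minimal (fun y hy => hcls hy) hcl hx : _ = _).trans hj
  rw [e]
  exact isSigmaCompact_biUnion hcount fun j _ => (hVc j).isSigmaCompact

/-- Conversely, a disjoint union of open `σ`-compact subspaces is paracompact. -/
theorem ParacompactSpace.of_isLocallyConstant {X ι : Type*} [TopologicalSpace X]
    [LocallyCompactSpace X] [T2Space X] {p : X → ι} (hp : IsLocallyConstant p)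
    (h : ∀ i, IsSigmaCompact (p ⁻¹' {i})) : ParacompactSpace X := by
  refine ⟨fun α s hs hcov => ?_⟩
  have hpiece : ∀ i, ∃ t : α → Set X, (∀ a, IsOpen (t a)) ∧ (⋃ a, t a) = p ⁻¹' {i} ∧
      (∀ x ∈ p ⁻¹' {i}, ∃ N ∈ nhds x, {a | (t a ∩ N).Nonempty}.Finite) ∧ ∀ a, t a ⊆ s a := by
    intro i
    have ho : IsOpen (p ⁻¹' {i}) := hp _
    have := isSigmaCompact_iff_sigmaCompactSpace.1 (h i)
    have : LocallyCompactSpace (p ⁻¹' {i}) := ho.locallyCompactSpace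
    obtain ⟨t, ht, htc, htl, hts⟩ := precise_refinement
      (fun a => (Subtype.val : p ⁻¹' {i} → X) ⁻¹' s a)
      (fun a => (hs a).preimage continuous_subtype_val)
      (by rw [← preimage_iUnion, hcov, preimage_univ])
    refine ⟨fun a => Subtype.val '' t a, fun a => ho.isOpenMap_subtype_val _ (ht a), ?_, ?_, ?_⟩
    · rw [← image_iUnion, htc, image_univ, Subtype.range_coe]
    · intro x hx
      obtain ⟨N, hN, hf⟩ := htl ⟨x, hx⟩
      refine ⟨Subtype.val '' N, ?_, hf.subset ?_⟩
      · rw [← ho.isOpenEmbedding_subtypeVal.map_nhds_eq ⟨x, hx⟩]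
        exact Filter.image_mem_map hN
      · rintro a ⟨_, ⟨y, hy, rfl⟩, z, hz, e⟩
        exact ⟨y, hy, Subtype.ext e ▸ hz⟩
    · rintro a _ ⟨y, hy, rfl⟩
      exact hts a hy
  choose t ht htc htl hts using hpiece
  have hsub : ∀ i a x, x ∈ t i a → p x = i := fun i a x hx => by
    have : x ∈ p ⁻¹' {i} := htc i ▸ mem_iUnion.2 ⟨a, hx⟩
    exact this
  refine ⟨α, fun a => ⋃ i, t i a, fun a => isOpen_iUnion fun i => ht i a, ?_, ?_, fun a => ⟨a, ?_⟩⟩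
  · refine iUnion_eq_univ_iff.2 fun x => ?_
    have : x ∈ ⋃ a, t (p x) a := (htc (p x)).symm ▸ rfl
    obtain ⟨a, ha⟩ := mem_iUnion.1 this
    exact ⟨a, mem_iUnion.2 ⟨_, ha⟩⟩
  · intro x
    obtain ⟨N, hN, hf⟩ := htl (p x) x rfl
    refine ⟨N ∩ p ⁻¹' {p x}, Filter.inter_mem hN ((hp _).mem_nhds rfl), hf.subset ?_⟩
    rintro a ⟨y, hy, hyN, hyp⟩
    obtain ⟨i, hi⟩ := mem_iUnion.1 hy
    have := hsub _ _ _ hi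
    have e : p y = p x := hyp
    rw [e] at this
    exact ⟨y, this ▸ hi, hyN⟩
  · exact iUnion_subset fun i => hts i a

/-- Products of paracompact spaces need not be paracompact; for locally compact Hausdorff spaces
they are, by the decomposition into `σ`-compact pieces. -/
instance (priority := 50) ParacompactSpace.prod_of_locallyCompact {X : Type u} {Y : Type u}
    [TopologicalSpace X]
    [TopologicalSpace Y] [LocallyCompactSpace X] [T2Space X] [ParacompactSpace X]
    [LocallyCompactSpace Y] [T2Space Y] [ParacompactSpace Y] : ParacompactSpace (X × Y) := by
  obtain ⟨ι, p, hp, h⟩ := exists_isLocallyConstant_isSigmaCompact X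
  obtain ⟨κ, q, hq, h'⟩ := exists_isLocallyConstant_isSigmaCompact Y
  refine ParacompactSpace.of_isLocallyConstant (p := Prod.map p q) ?_ ?_
  · rw [IsLocallyConstant.iff_eventually_eq] at hp hq ⊢
    intro x
    filter_upwards [(hp x.1).prod_nhds (hq x.2)] with y hy
    exact Prod.ext hy.1 hy.2
  · rintro ⟨i, j⟩
    have e : Prod.map p q ⁻¹' {(i, j)} = (p ⁻¹' {i}) ×ˢ (q ⁻¹' {j}) := by
      ext x
      simp [Prod.ext_iff]
    rw [e]
    have h1 := isSigmaCompact_iff_sigmaCompactSpace.1 (h i)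
    have h2 := isSigmaCompact_iff_sigmaCompactSpace.1 (h' j)
    have h3 : IsSigmaCompact (range (Prod.map (Subtype.val : p ⁻¹' {i} → X)
      (Subtype.val : q ⁻¹' {j} → Y))) := isSigmaCompact_range
        (continuous_subtype_val.prodMap continuous_subtype_val)
    rwa [range_prodMap, Subtype.range_coe, Subtype.range_coe] at h3

end Paracompact

section PartitionOfUnity

open Set

variable {n : ℕ} {M : Type u} [TopologicalSpace M] [ChartedSpace (EuclideanSpace ℝ (Fin n)) M]
  [IsManifold (𝓡 n) ∞ M] [T2Space M] [ParacompactSpace M]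

/-- The smooth Urysohn lemma on a paracompact manifold, glued from those for the components of a
decomposition into `σ`-compact open subsets. -/
theorem exists_contMDiff_zero_one_of_isClosed {s t : Set M} (hs : IsClosed s) (ht : IsClosed t)
    (hd : Disjoint s t) : ∃ f : M → ℝ, ContMDiff (𝓡 n) 𝓘(ℝ) ∞ f ∧ EqOn f 0 s ∧ EqOn f 1 t ∧
      ∀ x, f x ∈ Icc 0 1 := by
  have : LocallyCompactSpace M := Manifold.locallyCompact_of_finiteDimensional (𝓡 n)
  obtain ⟨ι, p, hp, h⟩ := exists_isLocallyConstant_isSigmaCompact M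
  let U : ι → Opens M := fun i => ⟨p ⁻¹' {i}, hp _⟩
  have hU : ∀ i, ∃ f : U i → ℝ, ContMDiff (𝓡 n) 𝓘(ℝ) ∞ f ∧ (∀ x : U i, x.1 ∈ s → f x = 0) ∧
      (∀ x : U i, x.1 ∈ t → f x = 1) ∧ ∀ x, f x ∈ Icc 0 1 := by
    intro i
    have : SigmaCompactSpace (U i) := isSigmaCompact_iff_sigmaCompactSpace.1 (h i)
    obtain ⟨f, h0, h1, hf⟩ := exists_contMDiffMap_zero_one_of_isClosed (M := U i) (n := (⊤ : ℕ∞))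
      (𝓡 n)
      (hs.preimage continuous_subtype_val) (ht.preimage continuous_subtype_val)
      (hd.preimage Subtype.val)
    exact ⟨f, f.contMDiff, fun x hx => h0 hx, fun x hx => h1 hx, hf⟩
  choose f hf h0 h1 h01 using hU
  refine ⟨fun x => f (p x) ⟨x, rfl⟩, fun x => ?_, fun x hx => h0 _ _ hx, fun x hx => h1 _ _ hx,
    fun x => h01 _ _⟩
  have hx : x ∈ U (p x) := rfl
  refine (contMDiffAt_subtype_iff (U := U (p x)) (x := ⟨x, hx⟩)).1 ?_
  refine (hf (p x) ⟨x, hx⟩).congr_of_eventuallyEq (Filter.Eventually.of_forall ?_)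
  rintro ⟨y, hy⟩
  have hy' : p y = p x := hy
  have : ∀ i (e : p y = i), f (p y) ⟨y, rfl⟩ = f i ⟨y, e⟩ := by
    rintro _ rfl
    rfl
  exact this _ hy'

/-- Partitions of unity on a manifold that is paracompact, but not necessarily `σ`-compact. -/
theorem exists_smoothPartitionOfUnity {ι : Type u} (U : ι → Set M) (ho : ∀ i, IsOpen (U i))
    (hU : ∀ x, ∃ i, x ∈ U i) :
    ∃ f : SmoothPartitionOfUnity ι (𝓡 n) M univ, f.IsSubordinate U := by
  have := BumpCovering.exists_isSubordinate_of_prop (X := M) (ContMDiff (𝓡 n) 𝓘(ℝ) ∞) ?_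
    isClosed_univ U ho fun x _ => mem_iUnion.2 (hU x)
  · obtain ⟨f, hf, hfU⟩ := this
    exact ⟨f.toSmoothPartitionOfUnity hf, hfU.toSmoothPartitionOfUnity hf⟩
  · intro s t hs ht hd
    obtain ⟨f, hf, h⟩ := exists_contMDiff_zero_one_of_isClosed (n := n) hs ht hd
    exact ⟨⟨f, hf.continuous⟩, hf, h⟩

end PartitionOfUnity

/-! ### Acyclicity of fine sheaves -/

section Fine

variable {n : ℕ} {M : Type u} [TopologicalSpace M] [ChartedSpace (EuclideanSpace ℝ (Fin n)) M]
  (T : M → Type u) [∀ x, AddCommGroup (T x)]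

variable (n) in
/-- An action of the smooth functions on the groups `T x`, such that the action of a function on
`T x` depends only on its germ at `x`. -/
structure FineAction where
  act : ∀ x, C^∞⟮𝓡 n, M; 𝓘(ℝ), ℝ⟯ →+ (T x →+ T x)
  act_one : ∀ x t, act x 1 t = t
  act_eq_zero : ∀ x ρ t, (∀ᶠ y in nhds x, ρ y = 0) → act x ρ t = 0

variable {T}

/-- The subgroups `S x` are preserved by multiplication with smooth functions. -/
def FineAction.Preserves (a : FineAction n T) (S : GermSubgroups T) : Prop :=
  ∀ x ρ t, t ∈ S.carrier x → (fun y => a.act y ρ (t y)) ∈ S.carrier x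

/-- If the smooth functions act on families, global sections of `∏ T / S` lift to global
sections of `∏ T`: local lifts can be added up by means of a partition of unity. -/
theorem FineAction.surjective_app_top [IsManifold (𝓡 n) ∞ M] [T2Space M] [ParacompactSpace M]
    (a : FineAction n T) {S : GermSubgroups T} (hS : a.Preserves S) :
    Function.Surjective (AbSheaf.app (toQuotientSheaf S) ⊤) := by
  intro q
  have h : ∀ x : M, ∃ (t : ∀ y, T y) (U : Set M), IsOpen U ∧ x ∈ U ∧
      ∀ y ∈ U, q.1 ⟨y, trivial⟩ = (t : S.Quot y) := by
    intro x
    obtain ⟨t, ht⟩ := q.2 ⟨x, trivial⟩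
    obtain ⟨V, i, hV, h⟩ := nhds_coe_eventually ht
    exact ⟨t, V, V.isOpen, hV, fun y hy => (h ⟨y, hy⟩).2⟩
  choose t U hUo hxU hU using h
  obtain ⟨ρ, hρ⟩ := exists_smoothPartitionOfUnity (n := n) U hUo fun x => ⟨x, hxU x⟩
  let s : ∀ y, T y := fun y => ∑ᶠ i, a.act y (ρ i) (t i y)
  refine ⟨⟨fun y => s y, trivial⟩, Subtype.ext (funext fun x => ?_)⟩
  have e : (q.1 x : S.Quot x) = (t x : S.Quot x) := hU x x (hxU x)
  refine Eq.trans ?_ e.symm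
  obtain ⟨N, hN, hf⟩ := ρ.locallyFinite (x : M)
  obtain ⟨W, hWN, hWo, hxW⟩ := mem_nhds_iff.1 hN
  let I := hf.toFinset
  have hzero : ∀ y ∈ W, ∀ i, i ∉ I → ∀ᶠ z in nhds y, ρ i z = 0 := by
    intro y hy i hi
    filter_upwards [hWo.mem_nhds hy] with z hz
    by_contra h
    exact hi (hf.mem_toFinset.2 ⟨z, h, hWN hz⟩)
  -- Near `x`, the difference between the glued section and the lift `t x` is a finite sum of
  -- the terms `ρ i • (t i - t x)`, each of which belongs to `S`: on the support of `ρ i` both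
  -- are lifts of `q`.
  have hs : ∀ y ∈ W, s y - t x y = ∑ i ∈ I, a.act y (ρ i) (t i y - t x y) := by
    intro y hy
    have h1 : s y = ∑ i ∈ I, a.act y (ρ i) (t i y) :=
      finsum_eq_sum_of_support_subset _ fun i hi => by
        by_contra h
        exact hi (a.act_eq_zero _ _ _ (hzero y hy i h))
    have h2 : t x y = ∑ i ∈ I, a.act y (ρ i) (t x y) := by
      have h3 : a.act y (∑ i ∈ I, ρ i - 1) (t x y) = 0 := by
        refine a.act_eq_zero _ _ _ ?_
        filter_upwards [hWo.mem_nhds hy] with z hz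
        have h4 : ∑ᶠ i, ρ i z = ∑ i ∈ I, ρ i z :=
          finsum_eq_sum_of_support_subset _ fun i hi => by
            by_contra h
            exact hi (hzero z hz i h).self_of_nhds
        have h5 := ρ.sum_eq_one (Set.mem_univ z)
        rw [h4] at h5
        have h6 : (∑ i ∈ I, ρ i : C^∞⟮𝓡 n, M; 𝓘(ℝ), ℝ⟯) z = ∑ i ∈ I, ρ i z := by
          exact (congrFun (map_sum (ContMDiffMap.coeFnAddMonoidHom
            (I := 𝓡 n) (I' := 𝓘(ℝ)) (N := M) (G := ℝ) (n := ∞)) ρ I) z).trans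
            (Finset.sum_apply z I fun i => ⇑(ρ i))
        change (∑ i ∈ I, ρ i : C^∞⟮𝓡 n, M; 𝓘(ℝ), ℝ⟯) z - 1 = 0
        rw [h6, h5, sub_self]
      rw [map_sub, AddMonoidHom.sub_apply, a.act_one, sub_eq_zero, map_sum] at h3
      rw [← (AddMonoidHom.finsetSum_apply (fun i => a.act y (ρ i)) I (t x y))]
      exact h3.symm
    rw [h1]
    nth_rewrite 1 [h2]
    rw [← Finset.sum_sub_distrib]
    exact Finset.sum_congr rfl fun i _ => (map_sub _ _ _).symm
  have hmem : (∑ i ∈ I, fun y => a.act y (ρ i) (t i y - t x y)) ∈ S.carrier (x : M) := by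
    refine sum_mem fun i _ => ?_
    by_cases hx : (x : M) ∈ tsupport (ρ i)
    · refine hS x (ρ i) (t i - t x) ?_
      have h1 : (t i : S.Quot x) = t x := (hU i x (hρ i hx)).symm.trans e
      rw [QuotientAddGroup.eq, neg_add_eq_sub] at h1
      rw [← neg_sub]
      exact neg_mem h1
    · refine S.congr (t := 0) ?_ (zero_mem _)
      filter_upwards [(isClosed_tsupport (ρ i)).isOpen_compl.mem_nhds hx] with y hy
      refine (a.act_eq_zero _ _ _ ?_).symm
      filter_upwards [(isClosed_tsupport (ρ i)).isOpen_compl.mem_nhds hy] with z hz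
      exact image_eq_zero_of_notMem_tsupport hz
  change ((extendByZero (fun y : (⊤ : Opens M) => s y) : ∀ y, T y) : S.Quot x) = t x
  have e' : extendByZero (fun y : (⊤ : Opens M) => s y) = s := by
    funext y
    exact extendByZero_apply (U := ⊤) _ (show y ∈ (⊤ : Opens M) from trivial)
  rw [e', eq_comm, QuotientAddGroup.eq, neg_add_eq_sub]
  refine S.congr ?_ hmem
  filter_upwards [hWo.mem_nhds hxW] with y hy
  rw [Finset.sum_apply, Pi.sub_apply, hs y hy]

/-- The families of germs modulo `S` that are induced by a single family. -/
def GermSubgroups.induced (S : GermSubgroups T) : GermSubgroups S.Quot where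
  carrier x :=
    { carrier := {q | ∃ t : ∀ y, T y, ∀ᶠ y in nhds x, q y = t}
      add_mem' {q q'} hq hq' := by
        obtain ⟨t, ht⟩ := hq
        obtain ⟨t', ht'⟩ := hq'
        refine ⟨t + t', ?_⟩
        filter_upwards [ht, ht'] with y hy hy'
        rw [Pi.add_apply, hy, hy']
        rfl
      zero_mem' := ⟨0, Filter.Eventually.of_forall fun _ => rfl⟩
      neg_mem' {q} hq := by
        obtain ⟨t, ht⟩ := hq
        refine ⟨-t, ?_⟩
        filter_upwards [ht] with y hy
        rw [Pi.neg_apply, hy]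
        rfl }
  congr {x q q'} h hq := by
    obtain ⟨t, ht⟩ := hq
    refine ⟨t, ?_⟩
    filter_upwards [h, ht] with y hy hy'
    rw [← hy, hy']

/-- The action on families induces an action on germs of families modulo `S`. -/
def FineAction.quot (a : FineAction n T) {S : GermSubgroups T} (hS : a.Preserves S) :
    FineAction n S.Quot where
  act x := AddMonoidHom.mk' (fun ρ => QuotientAddGroup.map (S.carrier x) (S.carrier x)
      (AddMonoidHom.mk' (fun t y => a.act y ρ (t y)) fun t t' => by
        funext y
        exact map_add _ _ _) fun t ht => hS x ρ t ht) fun ρ σ => by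
    apply AddMonoidHom.ext
    intro q
    obtain ⟨t, rfl⟩ := QuotientAddGroup.mk_surjective q
    refine congrArg (QuotientAddGroup.mk (s := S.carrier x)) (funext fun y => ?_)
    exact DFunLike.congr_fun (map_add (a.act y) ρ σ) (t y)
  act_one x q := by
    obtain ⟨t, rfl⟩ := QuotientAddGroup.mk_surjective q
    exact congrArg (QuotientAddGroup.mk (s := S.carrier x)) (funext fun y => a.act_one y (t y))
  act_eq_zero x ρ q h := by
    obtain ⟨t, rfl⟩ := QuotientAddGroup.mk_surjective q
    refine (S.mk_eq (t' := 0) ?_)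
    filter_upwards [h.eventually_nhds] with y hy
    exact a.act_eq_zero _ _ _ hy

theorem FineAction.quot_preserves (a : FineAction n T) {S : GermSubgroups T} (hS : a.Preserves S) :
    (a.quot hS).Preserves S.induced := by
  rintro x ρ q ⟨t, ht⟩
  refine ⟨fun y => a.act y ρ (t y), ?_⟩
  filter_upwards [ht] with y hy
  rw [hy]
  rfl

variable [IsManifold (𝓡 n) ∞ M] [T2Space M] [ParacompactSpace M]

/-- A sheaf of families `F` on which the smooth functions act has no cohomology in degrees `1`
and `2`: it embeds into the injective sheaf `∏ T`, the quotient embeds into the injective sheaf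
`∏ (∏ T / S)`, and global sections lift in both cases. -/
theorem FineAction.subsingleton_H (a : FineAction n T) {S : GermSubgroups T} (hS : a.Preserves S)
    {F : AbSheaf M} (f : F ⟶ allSections T) (hinj : ∀ U, Function.Injective (AbSheaf.app f U))
    (hf : ∀ (U : Opens M) (t : ∀ x : U, T x),
      (∀ x : U, extendByZero t ∈ S.carrier x) ↔ ∃ s, (AbSheaf.app f U s).1 = t)
    (hdiv : ∀ x (k : ℤ), k ≠ 0 → Function.Surjective fun t : T x => k • t) :
    Subsingleton (F.H 1) ∧ Subsingleton (F.H 2) := by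
  have i₁ : Injective (allSections T) := injective_allSections T fun x =>
    AddCommGrpCat.injective_of_smul_surjective _ (hdiv x)
  have i₂ : Injective (allSections S.Quot) := injective_allSections _ fun x =>
    AddCommGrpCat.injective_of_smul_surjective _ fun k hk q => by
      obtain ⟨t, rfl⟩ := QuotientAddGroup.mk_surjective q
      choose s hs using fun y => hdiv y k hk (t y)
      exact ⟨(s : S.Quot x), congrArg (QuotientAddGroup.mk (s := S.carrier x)) (funext hs)⟩
  obtain ⟨w, hE⟩ := shortExact_toQuotientSheaf S f hinj hf
  let j : quotientSheaf S ⊤ ⟶ allSections S.Quot :=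
    { hom :=
      { app := fun U => AddCommGrpCat.ofHom (AddMonoidHom.mk'
          (fun q : quotientSections S ⊤ U.unop =>
            (⟨q.1, trivial⟩ : (⊤ : AddSubgroup (∀ x : U.unop, S.Quot x)))) fun _ _ => rfl)
        naturality := fun _ _ _ => rfl } }
  obtain ⟨w', hE'⟩ := shortExact_toQuotientSheaf S.induced j
    (fun U q q' h => Subtype.ext (congrArg (fun z => z.1) h)) (fun U q => by
      constructor
      · intro h
        refine ⟨⟨q, fun x => ?_⟩, rfl⟩
        obtain ⟨t, ht⟩ := h x
        refine ⟨t, ?_⟩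
        filter_upwards [continuous_subtype_val.continuousAt.eventually ht] with y hy
        refine ⟨trivial, ?_⟩
        rw [← hy, extendByZero_apply _ y.2]
      · rintro ⟨s, rfl⟩ x
        obtain ⟨t, ht⟩ := s.2 x
        refine ⟨t, ?_⟩
        obtain ⟨V, i, hV, h⟩ := nhds_coe_eventually ht
        filter_upwards [V.isOpen.mem_nhds hV] with y hy
        rw [extendByZero_apply _ (i hy)]
        exact (h ⟨y, hy⟩).2)
  have s₁ : Subsingleton ((allSections T).H 1) := inferInstance
  have s₂ : Subsingleton ((allSections T).H 2) := inferInstance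
  have s₃ : Subsingleton ((allSections S.Quot).H 1) := inferInstance
  have s₄ : Subsingleton ((quotientSheaf S ⊤).H 1) :=
    subsingleton_H_one hE' ((a.quot hS).surjective_app_top (a.quot_preserves hS))
  exact ⟨subsingleton_H_one hE (a.surjective_app_top hS), subsingleton_H_two hE⟩

end Fine

/-! ### The exponential sequence -/

section Exponential

variable {X : Type u} [TopologicalSpace X]

variable (X) in
/-- The sheaf of locally constant integer-valued functions. -/
def locallyConstantSheaf : AbSheaf X :=
  localSectionSheaf (fun _ => ULift.{u} ℤ)
    (fun U =>
      { carrier := {f | ∀ x : U, ∀ᶠ y in nhds x, f y = f x}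
        add_mem' := fun {f g} hf hg x => by
          filter_upwards [hf x, hg x] with y hy hy'
          exact congrArg₂ (· + ·) hy hy'
        zero_mem' := fun x => Filter.Eventually.of_forall fun _ => rfl
        neg_mem' := fun {f} hf x => by
          filter_upwards [hf x] with y hy
          exact congrArg Neg.neg hy })
    (fun {U V} i f hf x =>
      ((Opens.isOpenEmbedding_of_le i).continuous.tendsto x).eventually (hf ⟨x, i x.2⟩))
    (fun {U} f h x => by
      obtain ⟨V, hV, i, hf⟩ := h x
      have := (Opens.isOpenEmbedding_of_le i).map_nhds_eq ⟨x, hV⟩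
      change ∀ᶠ y : U in nhds (Set.inclusion i ⟨x, hV⟩), _
      rw [← this]
      exact hf ⟨x, hV⟩)

/-- The constant presheaf maps to the sheaf of locally constant functions by a map that is locally
bijective, so that the latter is its sheafification. -/
theorem nonempty_integerSheaf_iso : Nonempty (integerSheaf X ≅ locallyConstantSheaf X) := by
  let J := Opens.grothendieckTopology X
  let P : (Opens X)ᵒᵖ ⥤ AddCommGrpCat.{u} :=
    (Functor.const _).obj (AddCommGrpCat.of (ULift.{u} ℤ))
  let φ : P ⟶ (locallyConstantSheaf X).obj :=
    { app := fun U => AddCommGrpCat.ofHom (AddMonoidHom.mk' (fun k : ULift.{u} ℤ =>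
        (⟨fun _ => k, fun _ => Filter.Eventually.of_forall fun _ => rfl⟩ :
          (locallyConstantSheaf X).sections U.unop)) fun _ _ => rfl)
      naturality := fun _ _ _ => rfl }
  have hφ : J.W φ := by
    rw [GrothendieckTopology.W_iff_isLocallyBijective]
    refine ⟨⟨fun {U} k l h x hx => ⟨U.unop, 𝟙 _, ?_, hx⟩⟩, ⟨fun {U} s x hx => ?_⟩⟩
    · have e : k = l := congrFun (congrArg Subtype.val h) ⟨x, hx⟩
      rw [e]
      exact rfl
    · obtain ⟨V, i, hV, h⟩ := nhds_coe_eventually (s.2 ⟨x, hx⟩)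
      refine ⟨V, homOfLE i, ⟨s.1 ⟨x, hx⟩, Subtype.ext (funext fun y => ?_)⟩, hV⟩
      exact (h y).symm
  rw [GrothendieckTopology.W_iff] at hφ
  let e₁ : integerSheaf X ≅ (presheafToSheaf J AddCommGrpCat.{u}).obj P := Iso.refl _
  exact ⟨e₁ ≪≫ asIso ((presheafToSheaf J AddCommGrpCat.{u}).map φ) ≪≫
    asIso ((sheafificationAdjunction J AddCommGrpCat.{u}).counit.app (locallyConstantSheaf X))⟩

theorem nonempty_H_equiv_of_iso {F G : AbSheaf X} (e : F ≅ G) (n : ℕ) :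
    Nonempty (F.H n ≃+ G.H n) := by
  refine ⟨AddEquiv.ofBijective (Sheaf.H.map e.hom n)
    (Function.bijective_iff_has_inverse.2 ⟨Sheaf.H.map e.inv n, fun x => ?_, fun x => ?_⟩)⟩
  · rw [← Sheaf.H.map_comp_apply, e.hom_inv_id, Sheaf.H.map_id_apply]
  · rw [← Sheaf.H.map_comp_apply, e.inv_hom_id, Sheaf.H.map_id_apply]

end Exponential

section SmoothFunctions

variable (n : ℕ) (M : Type u) [TopologicalSpace M] [ChartedSpace (EuclideanSpace ℝ (Fin n)) M]
  [IsManifold (𝓡 n) ∞ M]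

/-- The sheaf of smooth real functions. -/
def smoothRealSheaf : AbSheaf M :=
  localSectionSheaf (fun _ => ULift.{u} ℝ)
    (fun U =>
      { carrier := {f | ContMDiff (𝓡 n) 𝓘(ℝ) ∞ fun x : U => (f x).down}
        add_mem' := fun hf hg => ContMDiff.add hf hg
        zero_mem' := contMDiff_const
        neg_mem' := fun hf => ContMDiff.neg hf })
    (fun {U _} i f hf => ContMDiff.comp (I' := 𝓡 n) (g := fun x : U => (f x).down) hf
      (contMDiff_inclusion i))
    (fun f h => contMDiff_of_locally n (fun x => (f x).down) h)

/-- The germs of smooth real functions among all germs of real functions. -/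
def smoothRealGerms : GermSubgroups (fun _ : M => ULift.{u} ℝ) where
  carrier x :=
    { carrier := {f | ContMDiffAt (𝓡 n) 𝓘(ℝ) ∞ (fun y => (f y).down) x}
      add_mem' := fun hf hg => ContMDiffAt.add hf hg
      zero_mem' := contMDiffAt_const
      neg_mem' := fun hf => ContMDiffAt.neg hf }
  congr {x f g} h hf := ContMDiffAt.congr_of_eventuallyEq hf (by
    filter_upwards [h] with y hy
    rw [hy])

end SmoothFunctions

/-- A smooth circle-valued function has a smooth logarithm near each point. -/
theorem exists_contMDiffAt_log {n : ℕ} {M : Type u} [TopologicalSpace M]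
    [ChartedSpace (EuclideanSpace ℝ (Fin n)) M] {f : M → Circle} {x : M} (hf : ContinuousAt f x) :
    ∃ θ : M → ℝ, (∀ᶠ y in nhds x, Circle.exp (θ y) = f y) ∧
      ∀ᶠ y in nhds x, ContMDiffAt (𝓡 n) (𝓡 1) ∞ f y → ContMDiffAt (𝓡 n) 𝓘(ℝ) ∞ θ y := by
  -- Dividing by `f x` moves the values near `x` into the domain where the argument is smooth.
  let g : M → Circle := fun y => f y * (f x)⁻¹
  refine ⟨fun y => Complex.arg (g y) + Complex.arg (f x), ?_, ?_⟩
  · refine Filter.Eventually.of_forall fun y => ?_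
    rw [Circle.exp_add, Circle.exp_arg, Circle.exp_arg, inv_mul_cancel_right]
  · have h1 : ∀ᶠ y in nhds x, (g y : ℂ) ∈ Complex.slitPlane := by
      have hc : ContinuousAt (fun y => (g y : ℂ)) x :=
        (continuous_subtype_val : Continuous fun z : Circle => (z : ℂ)).continuousAt.comp
          (hf.mul continuousAt_const)
      refine hc.eventually (Complex.isOpen_slitPlane.mem_nhds ?_)
      simp [g]
    filter_upwards [h1] with y hy hfy
    have h2 : ContMDiffAt (𝓡 n) 𝓘(ℝ, ℂ) ∞ (fun y => (g y : ℂ)) y :=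
      (contMDiff_circle_coe _).comp y (hfy.mul contMDiffAt_const)
    have h3 : ContDiffAt ℝ ∞ (fun z : ℂ => (Complex.log z).im) (g y) :=
      Complex.imCLM.contDiff.contDiffAt.comp _ ((Complex.contDiffAt_log hy).restrict_scalars ℝ)
    have h4 : ContMDiffAt (𝓡 n) 𝓘(ℝ) ∞ (fun y => (Complex.log (g y)).im) y :=
      ContMDiffAt.comp (g := fun z : ℂ => (Complex.log z).im) y h3.contMDiffAt h2
    simp only [Complex.log_im] at h4
    exact h4.add contMDiffAt_const

theorem contMDiff_iff_contMDiffAt_of_forall_eq {n : ℕ} {M : Type u} [TopologicalSpace M]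
    [ChartedSpace (EuclideanSpace ℝ (Fin n)) M] {E H N : Type*} [NormedAddCommGroup E]
    [NormedSpace ℝ E] [TopologicalSpace H] {I : ModelWithCorners ℝ E H} [TopologicalSpace N]
    [ChartedSpace H N] {U : Opens M} {f : U → N} {g : M → N} (h : ∀ x : U, g x = f x) :
    ContMDiff (𝓡 n) I ∞ f ↔ ∀ x : U, ContMDiffAt (𝓡 n) I ∞ g x := by
  have e : f = fun x : U => g x := funext fun x => (h x).symm
  rw [e]
  exact forall_congr' fun x => contMDiffAt_subtype_iff

section SmoothFunctions

variable (n : ℕ) (M : Type u) [TopologicalSpace M] [ChartedSpace (EuclideanSpace ℝ (Fin n)) M]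
  [IsManifold (𝓡 n) ∞ M]

/-- The sheaf of smooth real functions is fine, hence acyclic. -/
theorem subsingleton_H_smoothRealSheaf [T2Space M] [ParacompactSpace M] :
    Subsingleton ((smoothRealSheaf n M).H 1) ∧ Subsingleton ((smoothRealSheaf n M).H 2) := by
  let a : FineAction n (fun _ : M => ULift.{u} ℝ) :=
    { act := fun x => AddMonoidHom.mk' (fun ρ => AddMonoidHom.mk'
        (fun t : ULift.{u} ℝ => ULift.up (ρ x * t.down))
        fun t t' => congrArg ULift.up (mul_add _ _ _)) fun ρ σ => by
          ext t
          exact add_mul _ _ _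
      act_one := fun x t => congrArg ULift.up (one_mul t.down)
      act_eq_zero := fun x ρ t h => by
        refine congrArg ULift.up ?_
        rw [h.self_of_nhds, zero_mul] }
  refine a.subsingleton_H (S := smoothRealGerms n M) (fun x ρ t ht => ?_)
    (f := ⟨{ app := fun U => AddCommGrpCat.ofHom (AddMonoidHom.mk'
              (fun s : (smoothRealSheaf n M).sections U.unop =>
                (⟨s.1, trivial⟩ : (allSections fun _ : M => ULift.{u} ℝ).sections U.unop))
              fun _ _ => rfl)
             naturality := fun _ _ _ => rfl }⟩)
    (fun U s t h => Subtype.ext (congrArg (fun z => z.1) h)) (fun U t => ?_) fun x k hk t => ?_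
  · exact ContMDiffAt.mul (ρ.contMDiff x) ht
  · have := contMDiff_iff_contMDiffAt_of_forall_eq (n := n) (I := 𝓘(ℝ))
      (f := fun x : U => (t x).down)
      (g := fun x => (extendByZero (T := fun _ : M => ULift.{u} ℝ) t x).down) fun x => by
        rw [extendByZero_apply _ x.2]
    refine this.symm.trans ⟨fun h => ⟨⟨t, h⟩, rfl⟩, ?_⟩
    rintro ⟨s, rfl⟩
    exact s.2
  · refine ⟨ULift.up (t.down / k), ULift.ext _ _ ?_⟩
    have : (k : ℝ) ≠ 0 := Int.cast_ne_zero.2 hk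
    change k • (t.down / k) = t.down
    rw [zsmul_eq_mul, mul_div_cancel₀ _ this]

theorem contMDiff_circle_exp : ContMDiff 𝓘(ℝ) (𝓡 1) ∞ Circle.exp := by
  have : Fact (Module.finrank ℝ ℂ = 1 + 1) := ⟨Complex.finrank_real_complex⟩
  exact contMDiff_circleExp

/-- The connecting map of the exponential sequence `0 → ℤ → C^∞(ℝ) → U(1) → 0`. -/
theorem nonempty_H_one_smoothCircleSheaf_equiv [T2Space M] [ParacompactSpace M] :
    Nonempty ((smoothCircleSheaf n M).H 1 ≃+ (integerSheaf M).H 2) := by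
  let i : locallyConstantSheaf M ⟶ smoothRealSheaf n M :=
    ⟨{ app := fun U => AddCommGrpCat.ofHom (AddMonoidHom.mk'
          (fun s : (locallyConstantSheaf M).sections U.unop =>
            (⟨fun x => ULift.up ((s.1 x).down : ℝ), fun x =>
              (contMDiffAt_const (c := ((s.1 x).down : ℝ))).congr_of_eventuallyEq (by
                filter_upwards [s.2 x] with y hy
                rw [hy])⟩ :
              (smoothRealSheaf n M).sections U.unop))
          fun s t => Subtype.ext (funext fun x => congrArg ULift.up (Int.cast_add _ _)))
       naturality := fun _ _ _ => rfl }⟩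
  let p : smoothRealSheaf n M ⟶ smoothCircleSheaf n M :=
    ⟨{ app := fun U => AddCommGrpCat.ofHom (AddMonoidHom.mk'
          (fun s : (smoothRealSheaf n M).sections U.unop =>
            (⟨fun x => Additive.ofMul (Circle.exp ((s.1 x).down * (2 * Real.pi))),
              (contMDiff_circle_exp).comp (ContMDiff.mul s.2 contMDiff_const)⟩ :
              circleSections n M U.unop))
          fun s t => Subtype.ext (funext fun x => by
            change Additive.ofMul (Circle.exp (((s.1 x).down + (t.1 x).down) * _)) = _
            rw [add_mul, Circle.exp_add]
            rfl))
       naturality := fun _ _ _ => rfl }⟩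
  have w : i ≫ p = 0 := by
    ext U s
    refine Subtype.ext (funext fun x => ?_)
    exact congrArg Additive.ofMul (Circle.exp_int_mul_two_pi _)
  have hE : (ShortComplex.mk i p w).ShortExact := by
    refine AbSheaf.shortExact_of_sections i p w (fun U s t h => ?_) (fun U t ht => ?_)
      (AbSheaf.epi_of_locally _ fun U t x hx => ?_)
    · refine Subtype.ext (funext fun x => ULift.ext _ _ ?_)
      have := congrArg ULift.down (congrFun (congrArg Subtype.val h) x)
      exact Int.cast_injective (α := ℝ) this
    · have h : ∀ x : U, ∃ k : ℤ, (k : ℝ) = (t.1 x).down := by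
        intro x
        have h1 := congrFun (congrArg Subtype.val ht) x
        obtain ⟨k, hk⟩ := Circle.exp_eq_one.1 (congrArg Additive.toMul h1)
        exact ⟨k, (mul_right_cancel₀ Real.two_pi_pos.ne' hk).symm⟩
      choose k hk using h
      refine ⟨⟨fun x => ULift.up (k x), fun x => ?_⟩,
        Subtype.ext (funext fun x => ULift.ext _ _ (hk x))⟩
      have hc : ContinuousAt (fun y : U => (t.1 y).down) x :=
        (t.2 : ContMDiff _ _ _ _).continuous.continuousAt
      filter_upwards [hc.eventually (Metric.ball_mem_nhds _ one_pos)] with y hy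
      have h1 : |(k y : ℝ) - k x| < 1 := by rw [hk, hk]; exact hy
      have h2 : |k y - k x| < 1 := by exact_mod_cast h1
      exact congrArg ULift.up (sub_eq_zero.1 (Int.abs_lt_one_iff.1 h2))
    · let f : M → Circle := extendByOne fun y : U => (t.1 y).toMul
      have hf : ∀ y ∈ U, ContMDiffAt (𝓡 n) (𝓡 1) ∞ f y := fun y hy =>
        contMDiffAt_extendByOne n t.2 ⟨y, hy⟩
      obtain ⟨θ, h1, h2⟩ := exists_contMDiffAt_log (n := n) (hf x hx).continuousAt
      obtain ⟨W, hW, hWo, hxW⟩ := eventually_nhds_iff.1 (h1.and h2)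
      let V : Opens M := ⟨W, hWo⟩ ⊓ U
      refine ⟨V, inf_le_right, ⟨hxW, hx⟩, ⟨fun y => ULift.up (θ y / (2 * Real.pi)), fun y => ?_⟩,
        Subtype.ext (funext fun y => ?_)⟩
      · have h3 := (hW y y.2.1).2 (hf y y.2.2)
        exact contMDiffAt_subtype_iff.2 (h3.mul (contMDiffAt_const (c := (2 * Real.pi)⁻¹)))
      · change Additive.ofMul (Circle.exp (θ y / (2 * Real.pi) * (2 * Real.pi))) = _
        rw [div_mul_cancel₀ _ Real.two_pi_pos.ne', (hW y y.2.1).1]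
        exact congrArg Additive.ofMul (dif_pos y.2.2)
  obtain ⟨s₁, s₂⟩ := subsingleton_H_smoothRealSheaf n M
  obtain ⟨e⟩ := exists_H_two_equiv hE
  obtain ⟨e₀⟩ := nonempty_integerSheaf_iso (X := M)
  obtain ⟨e'⟩ := nonempty_H_equiv_of_iso e₀ 2
  exact ⟨e.trans e'.symm⟩

end SmoothFunctions

/-! ### Cocycle classes of circle-valued functions -/

/-- The class of a family modulo the subgroup at `x`. -/
abbrev GermSubgroups.germ {X : Type u} [TopologicalSpace X] {T : X → Type u}
    [∀ x, AddCommGroup (T x)] (S : GermSubgroups T) (x : X) (t : ∀ y, T y) : S.Quot x :=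
  QuotientAddGroup.mk t

/-- A morphism to a quotient sheaf, given by representatives of the images of sections. -/
def homQuotientSheaf {X : Type u} [TopologicalSpace X] {T : X → Type u} [∀ x, AddCommGroup (T x)]
    (S A : GermSubgroups T) {F : AbSheaf X} (ψ : ∀ U, F.sections U →+ ∀ x, T x)
    (hA : ∀ (U : Opens X) s (x : U), ψ U s ∈ A.carrier x)
    (hres : ∀ {U V : Opens X} (i : V ≤ U) s (x : V),
      ∀ᶠ y in nhds (x : X), ψ V (F.res i s) y = ψ U s y) : F ⟶ quotientSheaf S A where
  hom :=
    { app := fun U => AddCommGrpCat.ofHom (AddMonoidHom.mk'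
        (fun s : F.sections U.unop => (⟨fun x => (ψ U.unop s : S.Quot x), fun x => ⟨ψ U.unop s,
          Filter.Eventually.of_forall fun y => ⟨hA _ s y, rfl⟩⟩⟩ : quotientSections S A U.unop))
        (fun s t => Subtype.ext (funext fun x =>
          congrArg (QuotientAddGroup.mk (s := S.carrier x)) (map_add (ψ U.unop) s t))))
      naturality := fun U V i => by
        ext s
        exact Subtype.ext (funext fun x => S.mk_eq (hres i.unop.le s x)) }

section CircleClasses

variable (n : ℕ) (M : Type u) [TopologicalSpace M] [ChartedSpace (EuclideanSpace ℝ (Fin n)) M]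

/-- The values of circle-valued functions on `M`, in the universe of `M`. -/
abbrev CircleValues : M → Type u := fun _ => ULift.{u} (Additive Circle)

variable {M} in
/-- A circle-valued function, written additively. -/
def circleFamily (f : M → Circle) : ∀ x, CircleValues M x := fun x => ULift.up (Additive.ofMul (f x))

/-- The germs of circle-valued functions that are smooth at a point. -/
def circleGerms : GermSubgroups (CircleValues M) where
  carrier x :=
    { carrier := {f | ContMDiffAt (𝓡 n) (𝓡 1) ∞ (fun y => (f y).down.toMul) x}
      add_mem' := fun hf hg => ContMDiffAt.mul hf hg
      zero_mem' := contMDiffAt_const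
      neg_mem' := fun hf => ContMDiffAt.inv hf }
  congr {x f g} h hf := ContMDiffAt.congr_of_eventuallyEq hf (by
    filter_upwards [h] with y hy
    rw [hy])

/-- The global sections of the quotient of the sheaf of all circle-valued functions by the sheaf of
smooth ones. -/
abbrev CircleClass : AddCommGrpCat.{u} := (quotientSheaf (circleGerms n M) ⊤).sections ⊤

/-- The classes that are induced by a global circle-valued function. -/
def trivialCircleClasses : AddSubgroup (CircleClass n M) :=
  (AbSheaf.app (toQuotientSheaf (circleGerms n M)) ⊤).range

/-- The cotangent spaces of `M`. -/
abbrev Covectors : M → Type := fun x => TangentSpace (𝓡 n) x →L[ℝ] ℝ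

/-- The covectors on `M` together with elements of the circle, in the universe of `M`. -/
abbrev ConnectionValues : M → Type u :=
  fun x => ULift.{u} (Additive Circle × (TangentSpace (𝓡 n) x →L[ℝ] ℝ))

variable {n M} in
/-- A circle-valued function together with a family of covectors. -/
def connectionFamily (f : M → Circle) (a : ∀ x : M, TangentSpace (𝓡 n) x →L[ℝ] ℝ) :
    ∀ x, ConnectionValues n M x := fun x => ULift.up (Additive.ofMul (f x), a x)

/-- The germs of pairs `(f, d log f)` with `f` smooth. -/
def dlogGerms : GermSubgroups (ConnectionValues n M) where
  carrier x :=
    { carrier := {t | ContMDiffAt (𝓡 n) (𝓡 1) ∞ (fun y => (t y).down.1.toMul) x ∧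
        (t x).down.2 = circleDlog n (fun y => (t y).down.1.toMul) x}
      add_mem' := fun {s t} hs ht => ⟨ContMDiffAt.mul hs.1 ht.1, by
        refine Eq.trans ?_ (circleDlog_mul n hs.1 ht.1).symm
        rw [← hs.2, ← ht.2]
        rfl⟩
      zero_mem' := ⟨contMDiffAt_const, by
        have h := circleDlog_mul n (M := M) (x := x) (f := fun _ => 1) (g := fun _ => 1)
          contMDiffAt_const contMDiffAt_const
        simp only [mul_one] at h
        exact (left_eq_add.1 h).symm⟩
      neg_mem' := fun {t} ht => ⟨ContMDiffAt.inv ht.1, by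
        have h := circleDlog_mul n ht.1 ht.1.inv
        have h' := circleDlog_mul n (M := M) (x := x) (f := fun _ => 1) (g := fun _ => 1)
          contMDiffAt_const contMDiffAt_const
        simp only [mul_one] at h'
        simp only [mul_inv_cancel] at h
        rw [left_eq_add.1 h', ← ht.2] at h
        exact neg_eq_of_add_eq_zero_right h.symm⟩ }
  congr {x s t} h hs := by
    have e : (fun y => (t y).down.1.toMul) =ᶠ[nhds x] fun y => (s y).down.1.toMul := by
      filter_upwards [h] with y hy
      rw [hy]
    refine ⟨hs.1.congr_of_eventuallyEq e, ?_⟩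
    rw [circleDlog_congr n e, ← hs.2, h.self_of_nhds]

variable [IsManifold (𝓡 n) ∞ M]

/-- The germs of pairs `(f, a)` with `a` a smooth 1-form. -/
def connectionGerms : GermSubgroups (ConnectionValues n M) where
  carrier x :=
    { carrier := {t | ContMDiffAt (𝓡 n) ((𝓡 n).prod 𝓘(ℝ, EuclideanSpace ℝ (Fin n) →L[ℝ] ℝ)) ∞
        (fun y : M => covector n y (t y).down.2) x}
      add_mem' := fun {s t} hs ht => by
        change ContMDiffAt _ _ _ _ _ at hs ht ⊢
        rw [contMDiffAt_hom_bundle (E₂ := Bundle.Trivial M ℝ)] at hs ht ⊢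
        refine ⟨hs.1, (hs.2.add ht.2).congr_of_eventuallyEq
          (Filter.Eventually.of_forall fun y => ?_)⟩
        ext v
        exact map_add (Bundle.Trivialization.continuousLinearMapAt ℝ
          (trivializationAt ℝ (Bundle.Trivial M ℝ) x) y) _ _
      zero_mem' := by
        change ContMDiffAt _ _ _ _ _
        rw [contMDiffAt_hom_bundle (E₂ := Bundle.Trivial M ℝ)]
        refine ⟨contMDiffAt_id, (contMDiffAt_const (c := 0)).congr_of_eventuallyEq
          (Filter.Eventually.of_forall fun y => ?_)⟩
        ext v
        exact map_zero (Bundle.Trivialization.continuousLinearMapAt ℝ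
          (trivializationAt ℝ (Bundle.Trivial M ℝ) x) y)
      neg_mem' := fun {t} ht => by
        change ContMDiffAt _ _ _ _ _ at ht ⊢
        rw [contMDiffAt_hom_bundle (E₂ := Bundle.Trivial M ℝ)] at ht ⊢
        refine ⟨ht.1, ht.2.neg.congr_of_eventuallyEq (Filter.Eventually.of_forall fun y => ?_)⟩
        ext v
        exact map_neg (Bundle.Trivialization.continuousLinearMapAt ℝ
          (trivializationAt ℝ (Bundle.Trivial M ℝ) x) y) _ }
  congr {x s t} h hs := ContMDiffAt.congr_of_eventuallyEq hs (by
    filter_upwards [h] with y hy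
    rw [hy])

/-- The global sections of the quotient of the sheaf of pairs `(f, a)`, where `f` is any
circle-valued function and `a` is a smooth 1-form, by the pairs `(f, d log f)` with `f` smooth. -/
abbrev ConnectionClass : AddCommGrpCat.{u} :=
  (quotientSheaf (dlogGerms n M) (connectionGerms n M)).sections ⊤

/-- The class of `(f, 0)`, for a circle-valued function `f`. -/
def circleToConnection : allSections (CircleValues M) ⟶
    quotientSheaf (dlogGerms n M) (connectionGerms n M) :=
  homQuotientSheaf _ _ (fun U => AddMonoidHom.mk'
      (fun f : (allSections (CircleValues M)).sections U =>
        connectionFamily (fun y => (extendByZero f.1 y).down.toMul) 0) fun f g => by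
      funext y
      refine ULift.ext _ _ (Prod.ext ?_ (add_zero _).symm)
      exact congrArg (fun t : ∀ y, CircleValues M y => (t y).down) (map_add extendByZero f.1 g.1))
    (fun U f (x : U) => (zero_mem ((connectionGerms n M).carrier (x : M)) :))
    fun i f x => by
      filter_upwards [extendByZero_eventuallyEq i f.1 x] with y hy
      exact ULift.ext _ _ (Prod.ext (congrArg (fun t => t.down) hy) rfl)

variable {n M} in
theorem contMDiffAt_extendByZero_covector_iff {U : Opens M}
    {a : ∀ x : U, TangentSpace (𝓡 n) (x : M) →L[ℝ] ℝ} {x : U} :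
    ContMDiffAt (𝓡 n) ((𝓡 n).prod 𝓘(ℝ, EuclideanSpace ℝ (Fin n) →L[ℝ] ℝ)) ∞
      (fun y => covector n y (extendByZero (T := Covectors n M) a y))
      (x : M) ↔
    ContMDiffAt (𝓡 n) ((𝓡 n).prod 𝓘(ℝ, EuclideanSpace ℝ (Fin n) →L[ℝ] ℝ)) ∞
      (fun y : U => covector n (y : M) (a y)) x := by
  rw [← contMDiffAt_subtype_iff]
  have e : (fun y : U => covector n (y : M)
      (extendByZero (T := Covectors n M) a y)) =
      fun y : U => covector n (y : M) (a y) := by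
    funext y
    rw [extendByZero_apply _ y.2]
  rw [← e]

/-- The class of `(1, a)`, for a smooth 1-form `a`. -/
def formToConnection : oneFormSheaf n M ⟶
    quotientSheaf (dlogGerms n M) (connectionGerms n M) :=
  homQuotientSheaf _ _ (fun U => AddMonoidHom.mk'
      (fun a : AbSheaf.sections (oneFormSheaf n M) U =>
        connectionFamily 1 (extendByZero (T := Covectors n M) a.1))
      fun a b => by
      funext y
      refine ULift.ext _ _ (Prod.ext (add_zero _).symm ?_)
      exact congrFun (map_add (extendByZero (T := Covectors n M)) a.1 b.1) y)
    (fun U a (x : U) => contMDiffAt_extendByZero_covector_iff.2 (a.2 x))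
    fun {U V} i a x => by
      filter_upwards [extendByZero_eventuallyEq (T := Covectors n M) i a.1 x] with y hy
      exact ULift.ext _ _ (Prod.ext rfl hy)

end CircleClasses

/-! ### Cohomology classes as cocycle classes -/

section CohomologyClasses

variable (n : ℕ) (M : Type u) [TopologicalSpace M] [ChartedSpace (EuclideanSpace ℝ (Fin n)) M]

omit [ChartedSpace (EuclideanSpace ℝ (Fin n)) M] in
/-- The sheaf of all circle-valued functions is injective, because the circle group is divisible. -/
instance injective_allSections_circleValues : Injective (allSections (CircleValues M)) :=
  injective_allSections _ fun _ => AddCommGrpCat.injective_of_smul_surjective _ fun k hk z => by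
    refine ⟨ULift.up (Additive.ofMul (Circle.exp (Complex.arg z.down.toMul / k))), ULift.ext _ _ ?_⟩
    change k • Additive.ofMul (Circle.exp (Complex.arg z.down.toMul / k)) = z.down
    rw [← ofMul_zpow, ← Circle.exp_zsmul, zsmul_eq_mul,
      mul_div_cancel₀ _ (Int.cast_ne_zero.2 hk : (k : ℝ) ≠ 0), Circle.exp_arg]
    rfl

variable [IsManifold (𝓡 n) ∞ M]

/-- The inclusion of the smooth circle-valued functions into all circle-valued functions. -/
def circleInclusion : smoothCircleSheaf n M ⟶ allSections (CircleValues M) where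
  hom :=
    { app := fun U => AddCommGrpCat.ofHom (AddMonoidHom.mk'
        (fun s : AbSheaf.sections (smoothCircleSheaf n M) U.unop =>
          (⟨fun x => ULift.up (s.1 x), trivial⟩ : (allSections (CircleValues M)).sections U.unop))
        fun _ _ => rfl)
      naturality := fun _ _ _ => rfl }

omit [IsManifold (𝓡 n) ∞ M] in
theorem circleInclusion_injective (U : Opens M) :
    Function.Injective (AbSheaf.app (circleInclusion n M) U) := fun _ _ h =>
  Subtype.ext (funext fun x => congrArg ULift.down (congrFun (congrArg Subtype.val h) x))

omit [IsManifold (𝓡 n) ∞ M] in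
/-- `H¹` of the sheaf of smooth circle-valued functions, computed from its embedding into the
injective sheaf of all circle-valued functions. -/
theorem nonempty_H_one_equiv_circleClass :
    Nonempty ((smoothCircleSheaf n M).H 1 ≃+ CircleClass n M ⧸ trivialCircleClasses n M) := by
  obtain ⟨w, h⟩ := shortExact_toQuotientSheaf (circleGerms n M) (circleInclusion n M)
    (circleInclusion_injective n M) (fun U t => by
      have := contMDiff_iff_contMDiffAt_of_forall_eq (n := n) (I := 𝓡 1)
        (f := fun x : U => (t x).down.toMul)
        (g := fun x => (extendByZero (T := CircleValues M) t x).down.toMul) fun x => by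
          rw [extendByZero_apply _ x.2]
      refine this.symm.trans ⟨fun h => ⟨⟨fun x => (t x).down, h⟩, rfl⟩, ?_⟩
      rintro ⟨s, rfl⟩
      exact s.2)
  exact exists_H_one_equiv h

/-- The connection classes that are induced by a global circle-valued function. -/
def trivialConnectionClasses : AddSubgroup (ConnectionClass n M) :=
  (AbSheaf.app (circleToConnection n M) ⊤).range

open Limits in
/-- An exactness criterion for a sequence `F → I ⊞ Ω → P` in terms of sections. -/
theorem AbSheaf.shortExact_biprod {X : Type u} [TopologicalSpace X] {F I Ω P : AbSheaf X}
    (j : F ⟶ I) (d : F ⟶ Ω) (β : I ⟶ P) (γ : Ω ⟶ P)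
    (hinj : ∀ U, Function.Injective (AbSheaf.app j U))
    (hker : ∀ U k a, AbSheaf.app β U k + AbSheaf.app γ U a = 0 ↔
      ∃ s, AbSheaf.app j U s = k ∧ AbSheaf.app d U s = a)
    (hloc : ∀ (U : Opens X) (q : P.sections U), ∀ x ∈ U, ∃ (V : Opens X) (i : V ≤ U), x ∈ V ∧
      ∃ k a, AbSheaf.app β V k + AbSheaf.app γ V a = P.res i q) :
    ∃ w, (ShortComplex.mk (biprod.lift j d) (biprod.desc β γ) w).ShortExact := by
  have app_comp : ∀ {A B C : AbSheaf X} (f : A ⟶ B) (g : B ⟶ C) U s,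
      AbSheaf.app (f ≫ g) U s = AbSheaf.app g U (AbSheaf.app f U s) := fun _ _ _ _ => rfl
  have app_add : ∀ {A B : AbSheaf X} (f g : A ⟶ B) U s,
      AbSheaf.app (f + g) U s = AbSheaf.app f U s + AbSheaf.app g U s := fun _ _ _ _ => rfl
  have app_id : ∀ {A : AbSheaf X} U (s : A.sections U), AbSheaf.app (𝟙 A) U s = s :=
    fun _ _ => rfl
  have w : biprod.lift j d ≫ biprod.desc β γ = 0 := by
    rw [biprod.lift_desc]
    ext U s
    exact (hker U.unop _ _).2 ⟨s, rfl, rfl⟩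
  have total : ∀ U (t : (I ⊞ Ω).sections U), t =
      AbSheaf.app (biprod.inl : I ⟶ I ⊞ Ω) U (AbSheaf.app (biprod.fst : I ⊞ Ω ⟶ I) U t) +
      AbSheaf.app (biprod.inr : Ω ⟶ I ⊞ Ω) U (AbSheaf.app (biprod.snd : I ⊞ Ω ⟶ Ω) U t) := by
    intro U t
    rw [← app_comp, ← app_comp, ← app_add, biprod.total, app_id]
  have desc : ∀ U (t : (I ⊞ Ω).sections U), AbSheaf.app (biprod.desc β γ) U t =
      AbSheaf.app β U (AbSheaf.app (biprod.fst : I ⊞ Ω ⟶ I) U t) +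
      AbSheaf.app γ U (AbSheaf.app (biprod.snd : I ⊞ Ω ⟶ Ω) U t) := by
    intro U t
    conv_lhs => rw [total U t]
    rw [map_add, ← app_comp _ (biprod.desc β γ), ← app_comp _ (biprod.desc β γ), biprod.inl_desc,
      biprod.inr_desc]
  refine ⟨w, AbSheaf.shortExact_of_sections _ _ w (fun U s t h => hinj U ?_) (fun U t ht => ?_)
    (AbSheaf.epi_of_locally _ fun U q x hx => ?_)⟩
  · have := congrArg (AbSheaf.app (biprod.fst : I ⊞ Ω ⟶ I) U) h
    rwa [← app_comp, ← app_comp, biprod.lift_fst] at this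
  · rw [desc] at ht
    obtain ⟨s, hs, hs'⟩ := (hker U _ _).1 ht
    refine ⟨s, ?_⟩
    rw [total U t, total U (AbSheaf.app (biprod.lift j d) U s), ← app_comp _ biprod.fst,
      ← app_comp _ biprod.snd, biprod.lift_fst, biprod.lift_snd, hs, hs']
  · obtain ⟨V, i, hV, k, a, h⟩ := hloc U q x hx
    refine ⟨V, i, hV, AbSheaf.app (biprod.inl : I ⟶ I ⊞ Ω) V k +
      AbSheaf.app (biprod.inr : Ω ⟶ I ⊞ Ω) V a, ?_⟩
    rw [map_add, ← app_comp _ (biprod.desc β γ), ← app_comp _ (biprod.desc β γ), biprod.inl_desc,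
      biprod.inr_desc, h]

/-- The hypercohomology of the Deligne complex, computed from the exact sequence
`U(1) → ∏ U(1) ⊞ Ω¹ → {(f, a)} / {(f, d log f)}`. -/
theorem nonempty_hypercohomology_equiv_connectionClass :
    Nonempty (Hypercohomology M (deligneComplex n M) 1 ≃+
      ConnectionClass n M ⧸ trivialConnectionClasses n M) := by
  obtain ⟨w, h⟩ := AbSheaf.shortExact_biprod (circleInclusion n M) (dlogHom n M)
    (circleToConnection n M) (formToConnection n M) (circleInclusion_injective n M)
    (fun U k a => by
      let f : M → Circle := fun y => (extendByZero k.1 y).down.toMul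
      let b : ∀ y : M, Covectors n M y := extendByZero (T := Covectors n M) a.1
      have key : AbSheaf.app (circleToConnection n M) U k +
          AbSheaf.app (formToConnection n M) U a = 0 ↔
          ∀ x : U, ContMDiffAt (𝓡 n) (𝓡 1) ∞ f x ∧ b x = circleDlog n f x := by
        have e : ∀ x : U, (dlogGerms n M).germ x (connectionFamily f 0) +
            (dlogGerms n M).germ x (connectionFamily 1 b) =
              (dlogGerms n M).germ x (connectionFamily f b) := fun x => by
          refine congrArg (QuotientAddGroup.mk (s := (dlogGerms n M).carrier x)) (funext fun y => ?_)
          exact ULift.ext _ _ (Prod.ext (add_zero _) (zero_add _))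
        constructor
        · intro h x
          have := congrFun (congrArg Subtype.val h) x
          exact (QuotientAddGroup.eq_zero_iff _).1 ((e x).symm.trans this)
        · intro h
          exact Subtype.ext (funext fun x => (e x).trans ((QuotientAddGroup.eq_zero_iff _).2 (h x)))
      rw [key]
      have hf : ∀ x : U, f x = (k.1 x).down.toMul := fun x => by
        simp only [f]
        rw [extendByZero_apply _ x.2]
      have hsm := contMDiff_iff_contMDiffAt_of_forall_eq (n := n) (I := 𝓡 1)
        (f := fun x : U => (k.1 x).down.toMul) (g := f) hf
      have hd : ∀ x : U, circleDlog n (extendByOne fun y : U => (k.1 y).down.toMul) (x : M) =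
          circleDlog n f x := fun x => by
        refine circleDlog_congr n ?_
        filter_upwards [U.isOpen.mem_nhds x.2] with y hy
        exact (dif_pos hy).trans (hf ⟨y, hy⟩).symm
      have hb : ∀ x : U, b x = a.1 x := fun x => extendByZero_apply _ x.2
      constructor
      · intro h
        refine ⟨⟨fun x => (k.1 x).down, hsm.2 fun x => (h x).1⟩, rfl,
          Subtype.ext (funext fun x => ?_)⟩
        exact (hd x).trans ((h x).2.symm.trans (hb x))
      · rintro ⟨s, rfl, rfl⟩ x
        exact ⟨hsm.1 s.2 x, (hb x).trans (hd x)⟩)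
    (fun U q x hx => by
      obtain ⟨t, ht⟩ := q.2 ⟨x, hx⟩
      obtain ⟨V, i, hV, h⟩ := nhds_coe_eventually ht
      let f : M → Circle := fun y => (t y).down.1.toMul
      refine ⟨V, i, hV, ⟨fun y => circleFamily f y, trivial⟩, ⟨fun y => (t y).down.2, fun y : V =>
        contMDiffAt_subtype_iff (U := V).2 (h y).1⟩, Subtype.ext (funext fun y => ?_)⟩
      refine Eq.trans ?_ (h y).2.symm
      refine GermSubgroups.mk_eq (dlogGerms n M) (t := connectionFamily
        (fun z => (extendByZero (T := CircleValues M) (fun w : V => circleFamily f w) z).down.toMul)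
          0 + connectionFamily 1 (extendByZero (T := Covectors n M) fun w : V => (t w).down.2)) ?_
      filter_upwards [V.isOpen.mem_nhds y.2] with z hz
      refine ULift.ext _ _ (Prod.ext ?_ ?_)
      · refine (add_zero _).trans ?_
        exact congrArg (fun t => t.down) (extendByZero_apply (T := CircleValues M) _ hz)
      · exact (zero_add _).trans (extendByZero_apply (T := Covectors n M) _ hz))
  exact exists_hypercohomology_equiv _ _ _ _ w h

end CohomologyClasses

/-! ### Manifolds from local coordinates, and submersions -/

section Coordinates

variable {E : Type*} [NormedAddCommGroup E] [NormedSpace ℝ E] [FiniteDimensional ℝ E]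

/-- A family of local coordinates with values in a vector space of dimension `d`, whose coordinate
changes are smooth, makes a topological space a manifold. -/
theorem exists_chartedSpace_of_contDiffOn {d : ℕ} (hd : Module.finrank ℝ E = d) {X : Type*}
    [TopologicalSpace X] (A : Set (OpenPartialHomeomorph X E)) (hcov : ∀ x, ∃ e ∈ A, x ∈ e.source)
    (hA : ∀ e ∈ A, ∀ e' ∈ A, ContDiffOn ℝ ∞ (e.symm ≫ₕ e') (e.symm ≫ₕ e').source) :
    ∃ _ : ChartedSpace (EuclideanSpace ℝ (Fin d)) X, IsManifold (𝓡 d) ∞ X ∧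
      ∀ e ∈ A, ContMDiffOn (𝓡 d) 𝓘(ℝ, E) ∞ e e.source ∧
        ContMDiffOn 𝓘(ℝ, E) (𝓡 d) ∞ e.symm e.target := by
  let L : E ≃L[ℝ] EuclideanSpace ℝ (Fin d) :=
    ContinuousLinearEquiv.ofFinrankEq (by rw [hd, finrank_euclideanSpace_fin])
  choose c hcA hc using hcov
  let inst : ChartedSpace (EuclideanSpace ℝ (Fin d)) X :=
    { atlas := (fun e => e.transHomeomorph L.toHomeomorph) '' A
      chartAt := fun x => (c x).transHomeomorph L.toHomeomorph
      mem_chart_source := hc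
      chart_mem_atlas := fun x => ⟨_, hcA x, rfl⟩ }
  have hM : IsManifold (𝓡 d) ∞ X := by
    refine isManifold_of_contDiffOn _ _ _ ?_
    rintro _ _ ⟨e, he, rfl⟩ ⟨e', he', rfl⟩
    have h := hA e he e' he'
    have h1 : ContDiffOn ℝ ∞ (L ∘ (e.symm ≫ₕ e') ∘ L.symm)
        (L.symm ⁻¹' (e.symm ≫ₕ e').source) :=
      L.contDiff.comp_contDiffOn (h.comp L.symm.contDiff.contDiffOn fun _ hx => hx)
    refine h1.mono ?_
    rintro x ⟨hx, -⟩
    exact hx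
  refine ⟨inst, hM, fun e he => ?_⟩
  have hmem : e.transHomeomorph L.toHomeomorph ∈ IsManifold.maximalAtlas (𝓡 d) ∞ X :=
    IsManifold.subset_maximalAtlas ⟨e, he, rfl⟩
  have h1 := contMDiffOn_of_mem_maximalAtlas hmem
  have h2 := contMDiffOn_symm_of_mem_maximalAtlas hmem
  constructor
  · have h3 := L.symm.contDiff.contMDiff (n := ∞) |>.comp_contMDiffOn h1
    refine h3.congr fun x hx => ?_
    exact (L.symm_apply_apply (e x)).symm
  · have h3 := h2.comp (L.contDiff.contMDiff (n := ∞)).contMDiffOn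
      (s := e.target) fun x hx => by
        change L.symm (L x) ∈ e.target
        rwa [L.symm_apply_apply]
    refine h3.congr fun x hx => ?_
    exact congrArg e.symm (L.symm_apply_apply x).symm

end Coordinates

section InverseFunction

variable {E F : Type*} [NormedAddCommGroup E] [NormedSpace ℝ E] [CompleteSpace E]
  [NormedAddCommGroup F] [NormedSpace ℝ F]

/-- The inverse function theorem, with a domain on which the function and its inverse are smooth. -/
theorem exists_openPartialHomeomorph_of_hasFDerivAt {f : E → F} {U : Set E} (hU : IsOpen U)
    (hf : ContDiffOn ℝ ∞ f U) {x : E} (hx : x ∈ U) (f' : E ≃L[ℝ] F)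
    (hf' : HasFDerivAt f (f' : E →L[ℝ] F) x) :
    ∃ e : OpenPartialHomeomorph E F, x ∈ e.source ∧ e.source ⊆ U ∧ (∀ y, e y = f y) ∧
      ContDiffOn ℝ ∞ e.symm e.target := by
  have hxf : ContDiffAt ℝ ∞ f x := hf.contDiffAt (hU.mem_nhds hx)
  let e₀ := hxf.toOpenPartialHomeomorph f hf' (by simp)
  let V : Set E := U ∩ fderiv ℝ f ⁻¹' Set.range ((↑) : (E ≃L[ℝ] F) → E →L[ℝ] F)
  have hV : IsOpen V := (hf.continuousOn_fderiv_of_isOpen hU (by simp)).isOpen_inter_preimage hU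
    ContinuousLinearEquiv.isOpen
  let e := e₀.restrOpen V hV
  refine ⟨e, ⟨hxf.mem_toOpenPartialHomeomorph_source hf' (by simp), hx, f', hf'.fderiv.symm⟩,
    fun y hy => hy.2.1, fun y => rfl, fun y hy => ?_⟩
  have hy' : e.symm y ∈ V := (e.map_target hy).2
  obtain ⟨L, hL⟩ := hy'.2
  have hc : ContDiffAt ℝ ∞ f (e.symm y) := hf.contDiffAt (hU.mem_nhds hy'.1)
  refine (e.contDiffAt_symm (f₀' := L) hy ?_ hc).contDiffWithinAt
  rw [hL]
  exact (hc.differentiableAt (by simp)).hasFDerivAt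

end InverseFunction

section LinearAlgebra

/-- A surjective linear map is the first component of an isomorphism onto a product. -/
theorem exists_continuousLinearEquiv_prod {d n : ℕ}
    (D : EuclideanSpace ℝ (Fin d) →L[ℝ] EuclideanSpace ℝ (Fin n)) (hD : Function.Surjective D) :
    ∃ (L : EuclideanSpace ℝ (Fin d) →L[ℝ] EuclideanSpace ℝ (Fin (d - n)))
      (e : EuclideanSpace ℝ (Fin d) ≃L[ℝ] EuclideanSpace ℝ (Fin n) × EuclideanSpace ℝ (Fin (d - n))),
      (e : EuclideanSpace ℝ (Fin d) →L[ℝ] _) = D.prod L := by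
  let K := LinearMap.ker (D : EuclideanSpace ℝ (Fin d) →ₗ[ℝ] EuclideanSpace ℝ (Fin n))
  have h1 : Module.finrank ℝ (LinearMap.range
      (D : EuclideanSpace ℝ (Fin d) →ₗ[ℝ] EuclideanSpace ℝ (Fin n))) + Module.finrank ℝ K =
      Module.finrank ℝ (EuclideanSpace ℝ (Fin d)) := LinearMap.finrank_range_add_finrank_ker _
  have h2 : Module.finrank ℝ (LinearMap.range
      (D : EuclideanSpace ℝ (Fin d) →ₗ[ℝ] EuclideanSpace ℝ (Fin n))) = n := by
    rw [LinearMap.range_eq_top.2 hD, finrank_top, finrank_euclideanSpace_fin]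
  rw [h2, finrank_euclideanSpace_fin] at h1
  have hK : Module.finrank ℝ K = d - n := by omega
  obtain ⟨q, hq⟩ := LinearMap.exists_leftInverse_of_injective K.subtype K.ker_subtype
  let k : K ≃ₗ[ℝ] EuclideanSpace ℝ (Fin (d - n)) :=
    LinearEquiv.ofFinrankEq _ _ (by rw [hK, finrank_euclideanSpace_fin])
  let L := LinearMap.toContinuousLinearMap (k.toLinearMap ∘ₗ q)
  have hinj : Function.Injective (D.prod L) := by
    rw [injective_iff_map_eq_zero]
    intro v hv
    have hv1 : D v = 0 := congrArg Prod.fst hv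
    have hv2 : k (q v) = 0 := congrArg Prod.snd hv
    have h3 := LinearMap.congr_fun hq ⟨v, hv1⟩
    have h4 : q v = 0 := k.injective (hv2.trans (map_zero k).symm)
    have h5 : q v = ⟨v, hv1⟩ := h3
    exact congrArg Subtype.val (h5.symm.trans h4)
  have hdim : Module.finrank ℝ (EuclideanSpace ℝ (Fin d)) =
      Module.finrank ℝ (EuclideanSpace ℝ (Fin n) × EuclideanSpace ℝ (Fin (d - n))) := by
    rw [Module.finrank_prod]
    simp only [finrank_euclideanSpace_fin]
    omega
  refine ⟨L, (LinearMap.linearEquivOfInjective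
    (D.prod L : EuclideanSpace ℝ (Fin d) →ₗ[ℝ] _) hinj hdim).toContinuousLinearEquiv, ?_⟩
  ext1 v
  rfl

end LinearAlgebra

namespace SubmersionOnto

variable {n : ℕ} {M : Type u} [TopologicalSpace M] [ChartedSpace (EuclideanSpace ℝ (Fin n)) M]
  [IsManifold (𝓡 n) ∞ M] (Y : SubmersionOnto n M)

/-- Coordinates around `y` in which a submersion is the projection `(u, v) ↦ u`, where `u` is the
preferred chart of `M` at the image of `y`. The dimension of the fibres is the difference of the
dimensions, which is not truncated because the differential is surjective. -/
structure Straightening (y : Y.Total) where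
  coord : OpenPartialHomeomorph Y.Total
    (EuclideanSpace ℝ (Fin n) × EuclideanSpace ℝ (Fin (Y.dim - n)))
  mem_source : y ∈ coord.source
  proj_mem : ∀ z ∈ coord.source, Y.proj z ∈ (chartAt (EuclideanSpace ℝ (Fin n)) (Y.proj y)).source
  coord_fst : ∀ z ∈ coord.source,
    (coord z).1 = chartAt (EuclideanSpace ℝ (Fin n)) (Y.proj y) (Y.proj z)
  contMDiffOn_coord : ContMDiffOn (𝓡 Y.dim)
    𝓘(ℝ, EuclideanSpace ℝ (Fin n) × EuclideanSpace ℝ (Fin (Y.dim - n))) ∞ coord coord.source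
  contMDiffOn_symm : ContMDiffOn
    𝓘(ℝ, EuclideanSpace ℝ (Fin n) × EuclideanSpace ℝ (Fin (Y.dim - n))) (𝓡 Y.dim) ∞
    coord.symm coord.target

/-- Straightenings exist by the inverse function theorem, applied to the submersion together with a
linear projection onto the kernel of its differential. -/
theorem nonempty_straightening (y : Y.Total) : Nonempty (Y.Straightening y) := by
  let φ := chartAt (EuclideanSpace ℝ (Fin Y.dim)) y
  let ψ := chartAt (EuclideanSpace ℝ (Fin n)) (Y.proj y)
  let f : EuclideanSpace ℝ (Fin Y.dim) → EuclideanSpace ℝ (Fin n) := ψ ∘ Y.proj ∘ φ.symm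
  let U : Set (EuclideanSpace ℝ (Fin Y.dim)) := φ.target ∩ φ.symm ⁻¹' (Y.proj ⁻¹' ψ.source)
  have hU : IsOpen U := φ.isOpen_inter_preimage_symm
    (ψ.open_source.preimage Y.contMDiff_proj.continuous)
  have hf : ContDiffOn ℝ ∞ f U := by
    rw [← contMDiffOn_iff_contDiffOn]
    refine (contMDiffOn_chart (I := 𝓡 n) (n := ∞) (x := Y.proj y)).comp (t := ψ.source)
      (Y.contMDiff_proj.comp_contMDiffOn ((contMDiffOn_chart_symm (I := 𝓡 Y.dim)).mono
        Set.inter_subset_left)) fun z hz => hz.2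
  have hy : y ∈ φ.source := mem_chart_source _ y
  have hu : φ y ∈ U := by
    refine ⟨φ.map_source hy, ?_⟩
    change Y.proj (φ.symm (φ y)) ∈ ψ.source
    rw [φ.left_inv hy]
    exact mem_chart_source _ _
  let D : EuclideanSpace ℝ (Fin Y.dim) →L[ℝ] EuclideanSpace ℝ (Fin n) := fderiv ℝ f (φ y)
  have hD : Function.Surjective D := by
    have h := Y.surjective_mfderiv y
    rw [(Y.contMDiff_proj.mdifferentiableAt (by simp)).mfderiv] at h
    simp only [mfld_simps, fderivWithin_univ] at h
    exact h
  obtain ⟨L, e', he'⟩ := exists_continuousLinearEquiv_prod D hD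
  have hfx : HasFDerivAt f D (φ y) :=
    ((hf.contDiffAt (hU.mem_nhds hu)).differentiableAt (by simp)).hasFDerivAt
  have hF : HasFDerivAt (fun v => (f v, L v)) (e' : EuclideanSpace ℝ (Fin Y.dim) →L[ℝ] _) (φ y) := by
    rw [he']
    exact hfx.prodMk L.hasFDerivAt
  obtain ⟨e, hxe, heU, hef, hes⟩ := exists_openPartialHomeomorph_of_hasFDerivAt hU
    (hf.prodMk L.contDiff.contDiffOn) hu e' hF
  have hsrc : ∀ z, z ∈ (φ ≫ₕ e).source → z ∈ φ.source ∧ φ z ∈ e.source := by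
    intro z hz
    rwa [OpenPartialHomeomorph.trans_source] at hz
  refine ⟨⟨φ ≫ₕ e, ?_, fun z hz => ?_, fun z hz => ?_, ?_, ?_⟩⟩
  · rw [OpenPartialHomeomorph.trans_source]
    exact ⟨hy, hxe⟩
  · have h1 := (heU (hsrc z hz).2).2
    have h2 : Y.proj (φ.symm (φ z)) ∈ ψ.source := h1
    rwa [φ.left_inv (hsrc z hz).1] at h2
  · change (e (φ z)).1 = _
    rw [hef]
    change ψ (Y.proj (φ.symm (φ z))) = _
    rw [φ.left_inv (hsrc z hz).1]
  · have h1 : ContDiffOn ℝ ∞ e e.source :=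
      ((hf.prodMk L.contDiff.contDiffOn).mono heU).congr fun z _ => hef z
    exact h1.contMDiffOn.comp ((contMDiffOn_chart (I := 𝓡 Y.dim) (n := ∞) (x := y)).mono
      fun z hz => (hsrc z hz).1) fun z hz => (hsrc z hz).2
  · refine (contMDiffOn_chart_symm (I := 𝓡 Y.dim) (n := ∞) (x := y)).comp (t := φ.target)
      (hes.contMDiffOn.mono ?_) ?_
    · intro z hz
      rw [OpenPartialHomeomorph.trans_target] at hz
      exact hz.1
    · intro z hz
      rw [OpenPartialHomeomorph.trans_target] at hz
      exact hz.2

end SubmersionOnto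

/-! ### Local sections and fibre products of submersions -/

/-- A smooth map with smooth local sections is a submersion. -/
theorem surjective_mfderiv_of_eventually_rightInverse {E H X E' H' X' : Type*}
    [NormedAddCommGroup E] [NormedSpace ℝ E] [TopologicalSpace H] {I : ModelWithCorners ℝ E H}
    [TopologicalSpace X] [ChartedSpace H X] [NormedAddCommGroup E'] [NormedSpace ℝ E']
    [TopologicalSpace H'] {I' : ModelWithCorners ℝ E' H'} [TopologicalSpace X'] [ChartedSpace H' X']
    {f : X → X'} {σ : X' → X} {x : X} (hσx : σ (f x) = x) (hf : MDifferentiableAt I I' f x)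
    (hσ : MDifferentiableAt I' I σ (f x)) (h : ∀ᶠ y in nhds (f x), f (σ y) = y) :
    Function.Surjective (mfderiv I I' f x) := by
  intro v
  have h1 : mfderiv I' I' (f ∘ σ) (f x) = mfderiv I' I' id (f x) :=
    Filter.EventuallyEq.mfderiv_eq (by filter_upwards [h] with y hy; exact hy)
  have hf' : MDifferentiableAt I I' f (σ (f x)) := by rwa [hσx]
  rw [mfderiv_comp (f x) hf' hσ, mfderiv_id] at h1
  have h2 : mfderiv I I' f (σ (f x)) (mfderiv I' I σ (f x) v) = v :=
    DFunLike.congr_fun h1 v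
  have key : ∀ y, y = x → ∀ w : E, (mfderiv I I' f y w : E') = mfderiv I I' f x w := by
    rintro _ rfl _
    rfl
  exact ⟨(mfderiv I' I σ (f x) v : E), (key _ hσx _).symm.trans h2⟩

namespace SubmersionOnto

variable {n : ℕ} {M : Type u} [TopologicalSpace M] [ChartedSpace (EuclideanSpace ℝ (Fin n)) M]
  [IsManifold (𝓡 n) ∞ M]

/-- `σ` is a smooth section of `Y → M` near `x`; its values away from `x` are arbitrary. -/
def IsLocalSection (Y : SubmersionOnto n M) (σ : M → Y.Total) (x : M) : Prop :=
  ∀ᶠ x' in nhds x, ContMDiffAt (𝓡 n) (𝓡 Y.dim) ∞ σ x' ∧ Y.proj (σ x') = x'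

theorem IsLocalSection.contMDiffAt {Y : SubmersionOnto n M} {σ : M → Y.Total} {x : M}
    (h : Y.IsLocalSection σ x) : ContMDiffAt (𝓡 n) (𝓡 Y.dim) ∞ σ x := h.self_of_nhds.1

theorem IsLocalSection.proj_eq {Y : SubmersionOnto n M} {σ : M → Y.Total} {x : M}
    (h : Y.IsLocalSection σ x) : Y.proj (σ x) = x := h.self_of_nhds.2

theorem IsLocalSection.eventually {Y : SubmersionOnto n M} {σ : M → Y.Total} {x : M}
    (h : Y.IsLocalSection σ x) : ∀ᶠ x' in nhds x, Y.IsLocalSection σ x' := h.eventually_nhds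

theorem exists_isLocalSection_of_eq (Y : SubmersionOnto n M) (y : Y.Total) :
    ∃ σ, Y.IsLocalSection σ (Y.proj y) ∧ σ (Y.proj y) = y := by
  obtain ⟨α⟩ := Y.nonempty_straightening y
  let c := chartAt (EuclideanSpace ℝ (Fin n)) (Y.proj y)
  let ι : M → EuclideanSpace ℝ (Fin n) × EuclideanSpace ℝ (Fin (Y.dim - n)) :=
    fun x => (c x, (α.coord y).2)
  have hc : ContMDiffOn (𝓡 n) (𝓡 n) ∞ c c.source := contMDiffOn_chart
  have hι : ContMDiffOn (𝓡 n) 𝓘(ℝ, EuclideanSpace ℝ (Fin n) × EuclideanSpace ℝ (Fin (Y.dim - n)))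
      ∞ ι c.source := hc.prodMk_space contMDiffOn_const
  have hy : (α.coord y) = ι (Y.proj y) := Prod.ext (α.coord_fst y α.mem_source) rfl
  have hmem : ι (Y.proj y) ∈ α.coord.target := hy ▸ α.coord.map_source α.mem_source
  have hx : Y.proj y ∈ c.source := mem_chart_source _ _
  refine ⟨α.coord.symm ∘ ι, ?_, ?_⟩
  · have h1 : ∀ᶠ x in nhds (Y.proj y), ι x ∈ α.coord.target :=
      ((hι.contMDiffAt (c.open_source.mem_nhds hx)).continuousAt).eventually
        (α.coord.open_target.mem_nhds hmem)
    filter_upwards [h1, c.open_source.mem_nhds hx] with x h1 h2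
    refine ⟨(α.contMDiffOn_symm.contMDiffAt (α.coord.open_target.mem_nhds h1)).comp x
      (hι.contMDiffAt (c.open_source.mem_nhds h2)), ?_⟩
    have h3 := α.coord.map_target h1
    refine c.injOn (α.proj_mem _ h3) h2 ?_
    rw [← α.coord_fst _ h3, α.coord.right_inv h1]
  · change α.coord.symm (ι (Y.proj y)) = y
    rw [← hy, α.coord.left_inv α.mem_source]

theorem exists_isLocalSection (Y : SubmersionOnto n M) (x : M) : ∃ σ, Y.IsLocalSection σ x := by
  obtain ⟨y, rfl⟩ := Y.surjective_proj x
  obtain ⟨σ, h, -⟩ := Y.exists_isLocalSection_of_eq y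
  exact ⟨σ, h⟩

section FibreProduct

variable (Y Z : SubmersionOnto n M)

/-- The vector space in which coordinates of `Y ×_M Z` take their values. -/
abbrev FibreModel : Type := EuclideanSpace ℝ (Fin n) × EuclideanSpace ℝ (Fin (Y.dim - n)) ×
  EuclideanSpace ℝ (Fin (Z.dim - n))

variable {Y Z} {y : Y.Total} {z : Z.Total}

theorem symm_mem_fibreProduct (α : Y.Straightening y) (β : Z.Straightening z)
    (h : Y.proj y = Z.proj z) {u : FibreModel Y Z} (hα : (u.1, u.2.1) ∈ α.coord.target)
    (hβ : (u.1, u.2.2) ∈ β.coord.target) :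
    (α.coord.symm (u.1, u.2.1), β.coord.symm (u.1, u.2.2)) ∈ Y.fibreProduct Z := by
  have h1 := α.coord.map_target hα
  have h2 := β.coord.map_target hβ
  have e1 := α.coord_fst _ h1
  have e2 := β.coord_fst _ h2
  have m1 := α.proj_mem _ h1
  have m2 := β.proj_mem _ h2
  rw [α.coord.right_inv hα] at e1
  rw [β.coord.right_inv hβ, ← h] at e2
  rw [← h] at m2
  exact (chartAt (EuclideanSpace ℝ (Fin n)) (Y.proj y)).injOn m1 m2 (e1.symm.trans e2)

open scoped Classical in
/-- Coordinates of `Y ×_M Z`, given by straightenings of `Y → M` and `Z → M`. -/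
def fibreCoord (α : Y.Straightening y) (β : Z.Straightening z) (h : Y.proj y = Z.proj z) :
    OpenPartialHomeomorph (Y.fibreProduct Z) (FibreModel Y Z) where
  toFun w := ((α.coord w.1.1).1, (α.coord w.1.1).2, (β.coord w.1.2).2)
  invFun u := if hu : (u.1, u.2.1) ∈ α.coord.target ∧ (u.1, u.2.2) ∈ β.coord.target then
    ⟨_, symm_mem_fibreProduct α β h hu.1 hu.2⟩ else ⟨(y, z), show (y, z) ∈ Y.fibreProduct Z from h⟩
  source := {w | w.1.1 ∈ α.coord.source ∧ w.1.2 ∈ β.coord.source}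
  target := {u | (u.1, u.2.1) ∈ α.coord.target ∧ (u.1, u.2.2) ∈ β.coord.target}
  map_source' w hw := by
    have e : (α.coord w.1.1).1 = (β.coord w.1.2).1 := by
      rw [α.coord_fst _ hw.1, β.coord_fst _ hw.2, h]
      exact congrArg _ w.2
    refine ⟨α.coord.map_source hw.1, ?_⟩
    have := β.coord.map_source hw.2
    change ((α.coord w.1.1).1, (β.coord w.1.2).2) ∈ _
    rwa [e]
  map_target' u hu := by
    rw [dif_pos (show (u.1, u.2.1) ∈ α.coord.target ∧ (u.1, u.2.2) ∈ β.coord.target from hu)]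
    exact ⟨α.coord.map_target hu.1, β.coord.map_target hu.2⟩
  left_inv' w hw := by
    have e : (α.coord w.1.1).1 = (β.coord w.1.2).1 := by
      rw [α.coord_fst _ hw.1, β.coord_fst _ hw.2, h]
      exact congrArg _ w.2
    have hu : ((α.coord w.1.1).1, (α.coord w.1.1).2) ∈ α.coord.target ∧
        ((α.coord w.1.1).1, (β.coord w.1.2).2) ∈ β.coord.target := by
      refine ⟨α.coord.map_source hw.1, ?_⟩
      have := β.coord.map_source hw.2
      rwa [e]
    rw [dif_pos hu]
    refine Subtype.ext (Prod.ext (α.coord.left_inv hw.1) ?_)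
    change β.coord.symm ((α.coord w.1.1).1, (β.coord w.1.2).2) = w.1.2
    rw [e]
    exact β.coord.left_inv hw.2
  right_inv' u hu := by
    rw [dif_pos (show (u.1, u.2.1) ∈ α.coord.target ∧ (u.1, u.2.2) ∈ β.coord.target from hu)]
    change ((α.coord (α.coord.symm (u.1, u.2.1))).1, (α.coord (α.coord.symm (u.1, u.2.1))).2,
      (β.coord (β.coord.symm (u.1, u.2.2))).2) = u
    rw [α.coord.right_inv hu.1, β.coord.right_inv hu.2]
  open_source := (α.coord.open_source.preimage (continuous_fst.comp continuous_subtype_val)).inter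
    (β.coord.open_source.preimage (continuous_snd.comp continuous_subtype_val))
  open_target := (α.coord.open_target.preimage (by fun_prop)).inter
    (β.coord.open_target.preimage (by fun_prop))
  continuousOn_toFun := by
    have h1 : ContinuousOn (fun w : Y.fibreProduct Z => α.coord w.1.1)
        {w | w.1.1 ∈ α.coord.source ∧ w.1.2 ∈ β.coord.source} :=
      α.coord.continuousOn.comp (by fun_prop) fun w hw => hw.1
    have h2 : ContinuousOn (fun w : Y.fibreProduct Z => β.coord w.1.2)
        {w | w.1.1 ∈ α.coord.source ∧ w.1.2 ∈ β.coord.source} :=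
      β.coord.continuousOn.comp (by fun_prop) fun w hw => hw.2
    exact h1.fst.prodMk (h1.snd.prodMk h2.snd)
  continuousOn_invFun := by
    rw [Topology.IsEmbedding.subtypeVal.continuousOn_iff]
    have h1 : ContinuousOn (fun u : FibreModel Y Z =>
        (α.coord.symm (u.1, u.2.1), β.coord.symm (u.1, u.2.2)))
        {u | (u.1, u.2.1) ∈ α.coord.target ∧ (u.1, u.2.2) ∈ β.coord.target} :=
      (α.coord.continuousOn_symm.comp (by fun_prop) fun u hu => hu.1).prodMk
        (β.coord.continuousOn_symm.comp (by fun_prop) fun u hu => hu.2)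
    refine h1.congr fun u hu => ?_
    exact congrArg Subtype.val (dif_pos hu)

theorem fibreCoord_symm_apply (α : Y.Straightening y) (β : Z.Straightening z)
    (h : Y.proj y = Z.proj z) {u : FibreModel Y Z} (hu : u ∈ (fibreCoord α β h).target) :
    ((fibreCoord α β h).symm u).1 = (α.coord.symm (u.1, u.2.1), β.coord.symm (u.1, u.2.2)) :=
  congrArg Subtype.val (dif_pos hu)

theorem contMDiffOn_fst_fibreCoord_symm (α : Y.Straightening y) (β : Z.Straightening z)
    (h : Y.proj y = Z.proj z) : ContMDiffOn 𝓘(ℝ, FibreModel Y Z) (𝓡 Y.dim) ∞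
      (fun u => ((fibreCoord α β h).symm u).1.1) (fibreCoord α β h).target := by
  have h1 : ContMDiff 𝓘(ℝ, FibreModel Y Z)
      𝓘(ℝ, EuclideanSpace ℝ (Fin n) × EuclideanSpace ℝ (Fin (Y.dim - n))) ∞
      fun u : FibreModel Y Z => (u.1, u.2.1) :=
    ContDiff.contMDiff (contDiff_fst.prodMk (contDiff_fst.comp contDiff_snd))
  refine (α.contMDiffOn_symm.comp h1.contMDiffOn fun u hu => hu.1).congr fun u hu => ?_
  rw [fibreCoord_symm_apply α β h hu]
  rfl

theorem contMDiffOn_snd_fibreCoord_symm (α : Y.Straightening y) (β : Z.Straightening z)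
    (h : Y.proj y = Z.proj z) : ContMDiffOn 𝓘(ℝ, FibreModel Y Z) (𝓡 Z.dim) ∞
      (fun u => ((fibreCoord α β h).symm u).1.2) (fibreCoord α β h).target := by
  have h1 : ContMDiff 𝓘(ℝ, FibreModel Y Z)
      𝓘(ℝ, EuclideanSpace ℝ (Fin n) × EuclideanSpace ℝ (Fin (Z.dim - n))) ∞
      fun u : FibreModel Y Z => (u.1, u.2.2) :=
    ContDiff.contMDiff (contDiff_fst.prodMk (contDiff_snd.comp contDiff_snd))
  refine (β.contMDiffOn_symm.comp h1.contMDiffOn fun u hu => hu.2).congr fun u hu => ?_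
  rw [fibreCoord_symm_apply α β h hu]
  rfl

/-- The coordinates of the fibre product, as a map that is defined on `Y × Z`. -/
theorem contMDiffOn_fibreCoord_extension (α : Y.Straightening y) (β : Z.Straightening z) :
    ContMDiffOn ((𝓡 Y.dim).prod (𝓡 Z.dim)) 𝓘(ℝ, FibreModel Y Z) ∞
      (fun w : Y.Total × Z.Total => ((α.coord w.1).1, (α.coord w.1).2, (β.coord w.2).2))
      (α.coord.source ×ˢ β.coord.source) := by
  have h1 := α.contMDiffOn_coord.comp (contMDiffOn_fst (I := 𝓡 Y.dim) (J := 𝓡 Z.dim)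
    (s := α.coord.source ×ˢ β.coord.source)) fun w hw => hw.1
  have h2 := β.contMDiffOn_coord.comp (contMDiffOn_snd (I := 𝓡 Y.dim) (J := 𝓡 Z.dim)
    (s := α.coord.source ×ˢ β.coord.source)) fun w hw => hw.2
  have h3 := contDiff_fst.contMDiff (n := ∞) |>.comp_contMDiffOn h1
  have h4 := contDiff_snd.contMDiff (n := ∞) |>.comp_contMDiffOn h1
  have h5 := contDiff_snd.contMDiff (n := ∞) |>.comp_contMDiffOn h2
  exact h3.prodMk_space (h4.prodMk_space h5)

variable (Y Z)

/-- The fibre product of two submersions, with the coordinates that are given by straightenings. -/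
theorem exists_isFibreProduct [T2Space M] : ∃ (W : SubmersionOnto n M) (p : W.Total → Y.Total)
    (q : W.Total → Z.Total), Y.IsFibreProduct Z W p q := by
  let A : Set (OpenPartialHomeomorph (Y.fibreProduct Z) (FibreModel Y Z)) :=
    {e | ∃ (y : Y.Total) (z : Z.Total) (α : Y.Straightening y) (β : Z.Straightening z)
      (h : Y.proj y = Z.proj z), e = fibreCoord α β h}
  have hcov : ∀ w : Y.fibreProduct Z, ∃ (α : Y.Straightening w.1.1) (β : Z.Straightening w.1.2),
      w ∈ (fibreCoord α β w.2).source := fun w => by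
    obtain ⟨α⟩ := Y.nonempty_straightening w.1.1
    obtain ⟨β⟩ := Z.nonempty_straightening w.1.2
    exact ⟨α, β, α.mem_source, β.mem_source⟩
  obtain ⟨cs, hW, hA⟩ := exists_chartedSpace_of_contDiffOn (E := FibreModel Y Z)
    (d := n + ((Y.dim - n) + (Z.dim - n)))
    (by simp only [FibreModel, Module.finrank_prod, finrank_euclideanSpace_fin]) A (fun w => by
      obtain ⟨α, β, h⟩ := hcov w
      exact ⟨_, ⟨_, _, α, β, w.2, rfl⟩, h⟩) (by
      rintro _ ⟨y, z, α, β, h, rfl⟩ _ ⟨y', z', α', β', h', rfl⟩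
      rw [← contMDiffOn_iff_contDiffOn]
      have h1 := (contMDiffOn_fst_fibreCoord_symm α β h).prodMk
        (contMDiffOn_snd_fibreCoord_symm α β h)
      refine (contMDiffOn_fibreCoord_extension α' β').comp (h1.mono ?_) ?_
      · intro u hu
        rw [OpenPartialHomeomorph.trans_source] at hu
        exact hu.1
      · intro u hu
        rw [OpenPartialHomeomorph.trans_source] at hu
        exact hu.2)
  let d := n + ((Y.dim - n) + (Z.dim - n))
  have hp : ContMDiff (𝓡 d) (𝓡 Y.dim) ∞ fun w : Y.fibreProduct Z => w.1.1 := fun w => by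
    obtain ⟨α, β, hw⟩ := hcov w
    have he := (hA _ ⟨_, _, α, β, w.2, rfl⟩).1
    refine (((contMDiffOn_fst_fibreCoord_symm α β w.2).comp he fun v hv =>
      (fibreCoord α β w.2).map_source hv).congr fun v hv => ?_).contMDiffAt
        ((fibreCoord α β w.2).open_source.mem_nhds hw)
    exact congrArg (fun v => v.1.1) ((fibreCoord α β w.2).left_inv hv).symm
  have hq : ContMDiff (𝓡 d) (𝓡 Z.dim) ∞ fun w : Y.fibreProduct Z => w.1.2 := fun w => by
    obtain ⟨α, β, hw⟩ := hcov w
    have he := (hA _ ⟨_, _, α, β, w.2, rfl⟩).1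
    refine (((contMDiffOn_snd_fibreCoord_symm α β w.2).comp he fun v hv =>
      (fibreCoord α β w.2).map_source hv).congr fun v hv => ?_).contMDiffAt
        ((fibreCoord α β w.2).open_source.mem_nhds hw)
    exact congrArg (fun v => v.1.2) ((fibreCoord α β w.2).left_inv hv).symm
  classical
  -- The inverse of the inclusion of the fibre product; its values elsewhere are arbitrary.
  let r : Y.Total × Z.Total → Y.fibreProduct Z := fun x =>
    if h : x ∈ Y.fibreProduct Z then ⟨x, h⟩ else
      ⟨(x.1, (Z.surjective_proj (Y.proj x.1)).choose),
        (Z.surjective_proj (Y.proj x.1)).choose_spec.symm⟩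
  have hrx : ∀ x (h : x ∈ Y.fibreProduct Z), r x = ⟨x, h⟩ := fun x h => dif_pos h
  have hr : ContMDiffOn ((𝓡 Y.dim).prod (𝓡 Z.dim)) (𝓡 d) ∞ r (Y.fibreProduct Z) := by
    intro x hx
    obtain ⟨α, β, hw⟩ := hcov ⟨x, hx⟩
    have he := (hA _ ⟨_, _, α, β, hx, rfl⟩).2
    have hmem : x ∈ α.coord.source ×ˢ β.coord.source := hw
    have hopen : IsOpen (α.coord.source ×ˢ β.coord.source) :=
      α.coord.open_source.prod β.coord.open_source
    have h1 : ContMDiffOn ((𝓡 Y.dim).prod (𝓡 Z.dim)) (𝓡 d) ∞ r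
        ((α.coord.source ×ˢ β.coord.source) ∩ Y.fibreProduct Z) := by
      refine (he.comp ((contMDiffOn_fibreCoord_extension α β).mono Set.inter_subset_left)
        ?_).congr ?_
      · rintro v ⟨hv, hv'⟩
        exact (fibreCoord α β hx).map_source (x := ⟨v, hv'⟩) hv
      · rintro v ⟨hv, hv'⟩
        rw [hrx v hv']
        exact ((fibreCoord α β hx).left_inv (x := ⟨v, hv'⟩) hv).symm
    refine (h1 x ⟨hmem, hx⟩).mono_of_mem_nhdsWithin ?_
    exact Filter.inter_mem (mem_nhdsWithin_of_mem_nhds (hopen.mem_nhds hmem))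
      self_mem_nhdsWithin
  have hclosed : IsClosed (Y.fibreProduct Z) := isClosed_eq
    (Y.contMDiff_proj.continuous.comp continuous_fst)
    (Z.contMDiff_proj.continuous.comp continuous_snd)
  have hpara : ParacompactSpace (Y.fibreProduct Z) := by
    have := Manifold.locallyCompact_of_finiteDimensional (M := Y.Total) (𝓡 Y.dim)
    have := Manifold.locallyCompact_of_finiteDimensional (M := Z.Total) (𝓡 Z.dim)
    exact hclosed.isClosedEmbedding_subtypeVal.paracompactSpace
  have hproj : ContMDiff (𝓡 d) (𝓡 n) ∞ fun w : Y.fibreProduct Z => Y.proj w.1.1 :=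
    Y.contMDiff_proj.comp hp
  refine ⟨{
    dim := d
    Total := Y.fibreProduct Z
    proj := fun w => Y.proj w.1.1
    contMDiff_proj := hproj
    surjective_proj := fun x => by
      obtain ⟨y, hy⟩ := Y.surjective_proj x
      obtain ⟨z, hz⟩ := Z.surjective_proj x
      exact ⟨⟨(y, z), hy.trans hz.symm⟩, hy⟩
    surjective_mfderiv := fun w => by
      obtain ⟨σ, hσ, hσw⟩ := Y.exists_isLocalSection_of_eq w.1.1
      obtain ⟨τ, hτ, hτw⟩ := Z.exists_isLocalSection_of_eq w.1.2
      have hw : Y.proj w.1.1 = Z.proj w.1.2 := w.2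
      rw [← hw] at hτ hτw
      have hmem : ∀ᶠ x in nhds (Y.proj w.1.1), (σ x, τ x) ∈ Y.fibreProduct Z := by
        filter_upwards [hσ, hτ] with x h1 h2
        exact h1.2.trans h2.2.symm
      refine surjective_mfderiv_of_eventually_rightInverse (σ := fun x => r (σ x, τ x)) ?_
        ((hproj w).mdifferentiableAt (by simp)) ?_ ?_
      · rw [hrx _ hmem.self_of_nhds]
        exact Subtype.ext (Prod.ext hσw hτw)
      · have h1 : ContMDiffAt (𝓡 n) ((𝓡 Y.dim).prod (𝓡 Z.dim)) ∞ (fun x => (σ x, τ x))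
            (Y.proj w.1.1) := hσ.contMDiffAt.prodMk hτ.contMDiffAt
        have h2 : ContMDiffWithinAt (𝓡 n) (𝓡 d) ∞ (r ∘ fun x => (σ x, τ x))
            {x | (σ x, τ x) ∈ Y.fibreProduct Z} (Y.proj w.1.1) :=
          ContMDiffWithinAt.comp (Y.proj w.1.1) (hr _ hmem.self_of_nhds) h1.contMDiffWithinAt
            fun x hx => hx
        exact (h2.contMDiffAt hmem).mdifferentiableAt (by simp)
      · filter_upwards [hmem, hσ] with x h1 h2
        rw [hrx _ h1]
        exact h2.2 }, fun w => w.1.1, fun w => w.1.2, hp, hq, fun _ => rfl, fun w => w.2.symm, r, hr,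
          fun w => hrx _ w.2, fun x hx => ?_⟩
  rw [hrx x hx]
  exact ⟨rfl, rfl⟩

end FibreProduct

end SubmersionOnto

/-! ### Groups of classes -/

section Classes

variable {G Q : Type*} [AddCommGroup Q] {N : AddSubgroup Q} {Rep : G → Q → Prop}
  {R : G → G → Prop} {prod : G → G → G → Prop} {dual : G → G} {triv : G → Prop}

/-- Suppose that objects with products and duals are represented by the elements of an abelian
group `Q`, uniquely modulo a subgroup `N`, in such a way that the trivial objects are those that
are represented by elements of `N`. If `R` relates `A` to its products with trivial objects, then
the classes of the equivalence relation generated by `R` form the group `Q ⧸ N`. The reason is that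
`A` and `B` are related by way of `A ⊗ (B* ⊗ B)` if `A ⊗ B*` is trivial. -/
theorem exists_commGroup_quot (hex : ∀ A, ∃ q, Rep A q) (hsurj : ∀ q, ∃ A, Rep A q)
    (huniq : ∀ {A q q'}, Rep A q → Rep A q' → q - q' ∈ N)
    (hprod : ∀ {A B C q q'}, prod A B C → Rep A q → Rep B q' → Rep C (q + q'))
    (hdual : ∀ {A q}, Rep A q → Rep (dual A) (-q)) (htriv : ∀ {A}, triv A ↔ ∃ q ∈ N, Rep A q)
    (hpex : ∀ A B, ∃ C, prod A B C)
    (hR : ∀ {A B}, R A B → ∃ T C, triv T ∧ prod B T C ∧ ∀ q, Rep C q → Rep A q)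
    (hexch : ∀ {A B C T D}, prod A (dual B) D → triv D → prod (dual B) B T → triv T →
      prod A T C → R C A ∧ R C B) :
    (∀ A B, Quot.mk R A = Quot.mk R B ↔ ∃ C, prod A (dual B) C ∧ triv C) ∧
    ∃ _ : CommGroup (Quot R),
      (∀ A B C, prod A B C → Quot.mk R C = Quot.mk R A * Quot.mk R B) ∧
      (∀ A, Quot.mk R A = 1 ↔ triv A) ∧ (∀ A, Quot.mk R (dual A) = (Quot.mk R A)⁻¹) ∧
      ∃ e : Quot R ≃* Multiplicative (Q ⧸ N), ∀ A q, Rep A q →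
        e (Quot.mk R A) = Multiplicative.ofAdd (q : Q ⧸ N) := by
  choose c hc using hex
  let Φ : G → Q ⧸ N := fun A => c A
  have hΦ : ∀ {A q}, Rep A q → Φ A = q := fun {A q} h => by
    rw [QuotientAddGroup.eq, neg_add_eq_sub]
    exact huniq h (hc A)
  have hΦprod : ∀ {A B C}, prod A B C → Φ C = Φ A + Φ B := fun {A B C} h => by
    rw [hΦ (hprod h (hc A) (hc B))]
    rfl
  have hΦdual : ∀ A, Φ (dual A) = -Φ A := fun A => hΦ (hdual (hc A))
  have hΦtriv : ∀ {A}, triv A ↔ Φ A = 0 := fun {A} => by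
    rw [htriv]
    constructor
    · rintro ⟨q, hq, h⟩
      rw [hΦ h, QuotientAddGroup.eq_zero_iff]
      exact hq
    · intro h
      exact ⟨c A, (QuotientAddGroup.eq_zero_iff _).1 h, hc A⟩
  have hΦR : ∀ A B, R A B → Φ A = Φ B := fun A B h => by
    obtain ⟨T, C, hT, hC, h⟩ := hR h
    rw [hΦ (h _ (hc C))]
    refine (hΦprod hC).trans ?_
    rw [hΦtriv.1 hT, add_zero]
  -- `C = A ⊗ (B* ⊗ B)` is the product of `A` with a trivial object, and the product of `B` with the
  -- trivial object `A ⊗ B*`.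
  have hrel : ∀ {A B}, Φ A = Φ B → Quot.mk R A = Quot.mk R B := fun {A B} h => by
    obtain ⟨D, hD⟩ := hpex A (dual B)
    obtain ⟨T, hT⟩ := hpex (dual B) B
    obtain ⟨C, hC⟩ := hpex A T
    have h1 : triv D := hΦtriv.2 (by rw [hΦprod hD, hΦdual, h, add_neg_cancel])
    have h2 : triv T := hΦtriv.2 (by rw [hΦprod hT, hΦdual, neg_add_cancel])
    obtain ⟨h3, h4⟩ := hexch hD h1 hT h2 hC
    exact (Quot.sound h3).symm.trans (Quot.sound h4)
  let e : Quot R ≃ Multiplicative (Q ⧸ N) := Equiv.ofBijective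
    (Quot.lift (fun A => Multiplicative.ofAdd (Φ A)) fun A B h =>
      congrArg Multiplicative.ofAdd (hΦR A B h)) (by
    constructor
    · rintro ⟨A⟩ ⟨B⟩ h
      exact hrel (Multiplicative.ofAdd.injective h)
    · intro x
      obtain ⟨q, hq⟩ := QuotientAddGroup.mk_surjective x.toAdd
      obtain ⟨A, hA⟩ := hsurj q
      exact ⟨Quot.mk R A, congrArg Multiplicative.ofAdd ((hΦ hA).trans hq)⟩)
  have he : ∀ A, e (Quot.mk R A) = Multiplicative.ofAdd (Φ A) := fun A => rfl
  refine ⟨fun A B => ⟨fun h => ?_, ?_⟩, e.commGroup, fun A B C h => ?_, fun A => ?_, fun A => ?_,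
    e.mulEquiv, fun A q h => ?_⟩
  · have h1 : Φ A = Φ B := Multiplicative.ofAdd.injective (congrArg e h)
    obtain ⟨D, hD⟩ := hpex A (dual B)
    exact ⟨D, hD, hΦtriv.2 (by rw [hΦprod hD, hΦdual, h1, add_neg_cancel])⟩
  · rintro ⟨D, hD, h⟩
    have h1 := hΦtriv.1 h
    rw [hΦprod hD, hΦdual, ← sub_eq_add_neg, sub_eq_zero] at h1
    exact hrel h1
  · exact e.injective (((congrArg Multiplicative.ofAdd (hΦprod h))).trans
      (e.apply_symm_apply _).symm)
  · rw [hΦtriv]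
    refine (e.injective.eq_iff (b := e.symm 1)).symm.trans ?_
    rw [e.apply_symm_apply, he]
    exact Multiplicative.ofAdd.injective.eq_iff' rfl
  · exact e.injective ((congrArg Multiplicative.ofAdd (hΦdual A)).trans
      (e.apply_symm_apply _).symm)
  · exact congrArg Multiplicative.ofAdd (hΦ h)

end Classes

/-! ### Products of bundle 0-gerbes -/

namespace SubmersionOnto

variable {n : ℕ} {M : Type u} [TopologicalSpace M] [ChartedSpace (EuclideanSpace ℝ (Fin n)) M]
  [IsManifold (𝓡 n) ∞ M]

/-- `Y ×_M (Z ×_M Z') = Z' ×_M (Y ×_M Z)`. -/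
theorem IsFibreProduct.exchange {Y Z Z' T C N : SubmersionOnto n M} {a : C.Total → Y.Total}
    {t : C.Total → T.Total} {b : T.Total → Z.Total} {b' : T.Total → Z'.Total}
    {a₁ : N.Total → Y.Total} {b₁ : N.Total → Z.Total} (hC : Y.IsFibreProduct T C a t)
    (hT : Z.IsFibreProduct Z' T b b') (hN : Y.IsFibreProduct Z N a₁ b₁) :
    ∃ m : C.Total → N.Total, Z'.IsFibreProduct N C (b' ∘ t) m ∧ (∀ w, a₁ (m w) = a w) ∧
      ∀ w, b₁ (m w) = b (t w) := by
  obtain ⟨rC, hrC, hrC₁, hrC₂⟩ := hC.exists_inverse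
  obtain ⟨rT, hrT, hrT₁, hrT₂⟩ := hT.exists_inverse
  obtain ⟨rN, hrN, hrN₁, hrN₂⟩ := hN.exists_inverse
  have hm : ∀ w, (a w, b (t w)) ∈ Y.fibreProduct Z := fun w =>
    (hC.proj_fst w).trans ((hC.proj_snd w).symm.trans (hT.proj_fst (t w)).symm)
  have hx : ∀ x ∈ Z'.fibreProduct N, (b₁ x.2, x.1) ∈ Z.fibreProduct Z' := fun x hx =>
    (hN.proj_snd x.2).trans (Eq.symm hx)
  have hx' : ∀ x ∈ Z'.fibreProduct N, (a₁ x.2, rT (b₁ x.2, x.1)) ∈ Y.fibreProduct T := fun x h => by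
    have h1 := (hrT₂ _ (hx x h)).1
    change Y.proj (a₁ x.2) = T.proj (rT (b₁ x.2, x.1))
    rw [← hT.proj_fst, h1, hN.proj_fst, hN.proj_snd]
  refine ⟨fun w => rN (a w, b (t w)), ⟨?_, ?_, ?_, ?_, fun x => rC (a₁ x.2, rT (b₁ x.2, x.1)),
    ?_, ?_, ?_⟩, fun w => (hrN₂ _ (hm w)).1, fun w => (hrN₂ _ (hm w)).2⟩
  · exact hT.contMDiff_snd.comp hC.contMDiff_snd
  · exact hrN.comp_contMDiff (hC.contMDiff_fst.prodMk (hT.contMDiff_fst.comp hC.contMDiff_snd)) hm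
  · exact fun w => (hT.proj_snd _).trans (hC.proj_snd w)
  · intro w
    rw [← hN.proj_fst, (hrN₂ _ (hm w)).1, hC.proj_fst]
  · have h1 : ContMDiffOn ((𝓡 Z'.dim).prod (𝓡 N.dim)) (𝓡 T.dim) ∞
        (fun x : Z'.Total × N.Total => rT (b₁ x.2, x.1)) (Z'.fibreProduct N) :=
      hrT.comp ((hN.contMDiff_snd.comp _root_.contMDiff_snd).prodMk _root_.contMDiff_fst).contMDiffOn hx
    exact hrC.comp ((hN.contMDiff_fst.comp _root_.contMDiff_snd).contMDiffOn.prodMk h1) hx'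
  · intro w
    change rC (a₁ (rN (a w, b (t w))), rT (b₁ (rN (a w, b (t w))), b' (t w))) = w
    rw [(hrN₂ _ (hm w)).1, (hrN₂ _ (hm w)).2, hrT₁, hrC₁]
  · intro x h
    have h1 := hrC₂ _ (hx' x h)
    have h2 := hrT₂ _ (hx x h)
    change b' (t (rC _)) = _ ∧ rN (a (rC _), b (t (rC _))) = _
    rw [h1.1, h1.2, h2.1, h2.2]
    exact ⟨rfl, hrN₁ x.2⟩

end SubmersionOnto

namespace BundleZeroGerbe

variable {n : ℕ} {M : Type u} [TopologicalSpace M] [ChartedSpace (EuclideanSpace ℝ (Fin n)) M]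
  [IsManifold (𝓡 n) ∞ M]

/-- The product of two bundle 0-gerbes on a given fibre product of the underlying submersions. -/
def product (A B : BundleZeroGerbe n M) {W : SubmersionOnto n M} {p : W.Total → A.Total}
    {q : W.Total → B.Total} (h : A.IsFibreProduct B.toSubmersionOnto W p q) :
    BundleZeroGerbe n M where
  toSubmersionOnto := W
  g x := A.g (p x.1, p x.2) * B.g (q x.1, q x.2)
  contMDiffOn_g := by
    refine ContMDiffOn.mul ?_ ?_
    · exact A.contMDiffOn_g.comp ((h.contMDiff_fst.comp contMDiff_fst).prodMk
        (h.contMDiff_fst.comp contMDiff_snd)).contMDiffOn fun x hx =>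
          (h.proj_fst x.1).trans (Eq.trans hx (h.proj_fst x.2).symm)
    · exact B.contMDiffOn_g.comp ((h.contMDiff_snd.comp contMDiff_fst).prodMk
        (h.contMDiff_snd.comp contMDiff_snd)).contMDiffOn fun x hx =>
          (h.proj_snd x.1).trans (Eq.trans hx (h.proj_snd x.2).symm)
  cocycle y₁ y₂ y₃ h₁ h₂ := by
    have a := A.cocycle (p y₁) (p y₂) (p y₃) (by rw [h.proj_fst, h.proj_fst, h₁])
      (by rw [h.proj_fst, h.proj_fst, h₂])
    have b := B.cocycle (q y₁) (q y₂) (q y₃) (by rw [h.proj_snd, h.proj_snd, h₁])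
      (by rw [h.proj_snd, h.proj_snd, h₂])
    rw [← a, ← b, mul_mul_mul_comm]

theorem isProductVia_product (A B : BundleZeroGerbe n M) {W : SubmersionOnto n M}
    {p : W.Total → A.Total} {q : W.Total → B.Total}
    (h : A.IsFibreProduct B.toSubmersionOnto W p q) : A.IsProductVia B (A.product B h) p q :=
  ⟨h, fun _ _ _ => rfl⟩

theorem exists_isProduct [T2Space M] (A B : BundleZeroGerbe n M) : ∃ C, A.IsProduct B C := by
  obtain ⟨W, p, q, h⟩ := A.exists_isFibreProduct B.toSubmersionOnto
  exact ⟨A.product B h, p, q, A.isProductVia_product B h⟩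

theorem isIsomorphism_refl (A : BundleZeroGerbe n M) :
    A.IsIsomorphism A (Diffeomorph.refl _ _ _) := ⟨fun _ => rfl, fun _ _ _ => rfl⟩

/-- `A ⊗ (B* ⊗ B) = B ⊗ (A ⊗ B*)`. -/
theorem IsProduct.exchange {A B C T D : BundleZeroGerbe n M} (hD : A.IsProduct B.dual D)
    (hT : B.dual.IsProduct B T) (hC : A.IsProduct T C) : B.IsProduct D C := by
  obtain ⟨a, t, hC, hCg⟩ := hC
  obtain ⟨b, b', hT, hTg⟩ := hT
  obtain ⟨a₁, b₁, hD, hDg⟩ := hD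
  obtain ⟨m, hm, ha, hb⟩ := hC.exchange hT hD
  refine ⟨b' ∘ t, m, hm, fun z₁ z₂ h => ?_⟩
  rw [hCg z₁ z₂ h, hTg _ _ ((hC.proj_snd z₁).trans (h.trans (hC.proj_snd z₂).symm)),
    hDg _ _ ((hm.proj_snd z₁).trans (h.trans (hm.proj_snd z₂).symm)), ha, ha, hb, hb]
  change _ * (_ * B.g (b' (t z₁), b' (t z₂))) = B.g (b' (t z₁), b' (t z₂)) * _
  rw [← mul_assoc, mul_comm]

/-- If `A ⊗ B*` and `B* ⊗ B` are trivial, then `A` and `B` are both related to `A ⊗ (B* ⊗ B)`. -/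
theorem stableIso_exchange {A B C T D : BundleZeroGerbe n M} (hD : A.IsProduct B.dual D)
    (hDt : D.IsTrivial) (hT : B.dual.IsProduct B T) (hTt : T.IsTrivial) (hC : A.IsProduct T C) :
    StableIso C A ∧ StableIso C B :=
  ⟨⟨T, C, hTt, hC, _, C.isIsomorphism_refl⟩,
    ⟨D, C, hDt, hD.exchange hT hC, _, C.isIsomorphism_refl⟩⟩

end BundleZeroGerbe

/-! ### The class of a bundle 0-gerbe -/

section Germs

variable {n : ℕ} {M : Type u} [TopologicalSpace M] [ChartedSpace (EuclideanSpace ℝ (Fin n)) M]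

theorem extendByZero_top {X : Type u} [TopologicalSpace X] {T : X → Type*} [∀ x, AddCommGroup (T x)]
    (t : ∀ x : (⊤ : Opens X), T x) (y : X) : extendByZero t y = t ⟨y, trivial⟩ :=
  extendByZero_apply t (show y ∈ (⊤ : Opens X) from trivial)

/-- The value of the class `q` at `x` is induced by the circle-valued function `f`. -/
def IsCircleGerm (q : CircleClass n M) (x : M) (f : M → Circle) : Prop :=
  q.1 ⟨x, trivial⟩ = (circleGerms n M).germ x (circleFamily f)

/-- Two functions induce the same value of a class at `x` if and only if their quotient is smooth
at `x`. -/
theorem IsCircleGerm.iff {q : CircleClass n M} {x : M} {f f' : M → Circle}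
    (h : IsCircleGerm q x f) :
    IsCircleGerm q x f' ↔ ContMDiffAt (𝓡 n) (𝓡 1) ∞ (fun y => (f y)⁻¹ * f' y) x := by
  unfold IsCircleGerm at h ⊢
  rw [h, QuotientAddGroup.eq]
  exact Iff.rfl

theorem IsCircleGerm.add {q q' : CircleClass n M} {x : M} {f f' : M → Circle}
    (h : IsCircleGerm q x f) (h' : IsCircleGerm q' x f') :
    IsCircleGerm (q + q') x fun y => f y * f' y :=
  congrArg₂ (· + ·) h h'

theorem IsCircleGerm.neg {q : CircleClass n M} {x : M} {f : M → Circle}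
    (h : IsCircleGerm q x f) : IsCircleGerm (-q) x fun y => (f y)⁻¹ :=
  congrArg (-·) h

theorem IsCircleGerm.sub {q q' : CircleClass n M} {x : M} {f f' : M → Circle}
    (h : IsCircleGerm q x f) (h' : IsCircleGerm q' x f') :
    IsCircleGerm (q - q') x fun y => f y * (f' y)⁻¹ := by
  rw [sub_eq_add_neg]
  exact h.add h'.neg

theorem exists_isCircleGerm (q : CircleClass n M) (x : M) :
    ∃ f, ∀ᶠ y in nhds x, IsCircleGerm q y f := by
  obtain ⟨t, ht⟩ := q.2 ⟨x, trivial⟩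
  obtain ⟨V, i, hV, h⟩ := nhds_coe_eventually ht
  refine ⟨fun y => (t y).down.toMul, ?_⟩
  filter_upwards [V.isOpen.mem_nhds hV] with y hy
  exact (h ⟨y, hy⟩).2

/-- Functions `f x`, defined near `x`, with smooth quotients define a class. -/
theorem exists_forall_isCircleGerm {f : M → M → Circle}
    (hf : ∀ x, ∀ᶠ y in nhds x, ContMDiffAt (𝓡 n) (𝓡 1) ∞ (fun z => (f y z)⁻¹ * f x z) y) :
    ∃ q : CircleClass n M, ∀ x, IsCircleGerm q x (f x) :=
  ⟨⟨fun x => (circleGerms n M).germ x (circleFamily (f x)), fun x => ⟨circleFamily (f x), by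
    filter_upwards [((continuous_subtype_val.tendsto x).eventually (hf x) :)] with y hy
    exact ⟨trivial, QuotientAddGroup.eq.2 hy⟩⟩⟩, fun x => rfl⟩

theorem mem_trivialCircleClasses_iff {q : CircleClass n M} :
    q ∈ trivialCircleClasses n M ↔ ∃ k, ∀ x, IsCircleGerm q x k := by
  constructor
  · rintro ⟨t, rfl⟩
    exact ⟨fun y => (extendByZero t.1 y).down.toMul, fun x => rfl⟩
  · rintro ⟨k, hk⟩
    refine ⟨⟨fun x => circleFamily k x, trivial⟩, Subtype.ext (funext fun x => ?_)⟩
    refine Eq.trans ?_ (hk x).symm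
    exact congrArg (QuotientAddGroup.mk (s := (circleGerms n M).carrier x))
      (funext fun y => extendByZero_top (T := CircleValues M) _ y)

end Germs

namespace BundleZeroGerbe

variable {n : ℕ} {M : Type u} [TopologicalSpace M] [ChartedSpace (EuclideanSpace ℝ (Fin n)) M]
  [IsManifold (𝓡 n) ∞ M]

theorem contMDiffAt_g (A : BundleZeroGerbe n M) {E H X : Type*} [NormedAddCommGroup E]
    [NormedSpace ℝ E] [TopologicalSpace H] {I : ModelWithCorners ℝ E H} [TopologicalSpace X]
    [ChartedSpace H X] {a b : X → A.Total} {x : X} (ha : ContMDiffAt I (𝓡 A.dim) ∞ a x)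
    (hb : ContMDiffAt I (𝓡 A.dim) ∞ b x) (h : ∀ᶠ y in nhds x, A.proj (a y) = A.proj (b y)) :
    ContMDiffAt I (𝓡 1) ∞ (fun y => A.g (a y, b y)) x := by
  have h1 : ContMDiffWithinAt I (𝓡 1) ∞ (A.g ∘ fun y => (a y, b y))
      {y | A.proj (a y) = A.proj (b y)} x :=
    ContMDiffWithinAt.comp x (A.contMDiffOn_g _ h.self_of_nhds)
      (ha.prodMk hb).contMDiffWithinAt fun y hy => hy
  exact h1.contMDiffAt h

/-- `g(y₁, y₂) = h(y₁)⁻¹ h(y₂)`, without a smoothness condition on `h`. -/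
def IsPotential (A : BundleZeroGerbe n M) (h : A.Total → Circle) : Prop :=
  ∀ y₁ y₂, A.proj y₁ = A.proj y₂ → A.g (y₁, y₂) = (h y₁)⁻¹ * h y₂

/-- A potential is given by `g(s(π(y)), y)`, where `s` is a section of `Y → M`, which need not be
continuous. -/
theorem exists_isPotential (A : BundleZeroGerbe n M) : ∃ h, A.IsPotential h := by
  obtain ⟨s, hs⟩ := A.surjective_proj.hasRightInverse
  refine ⟨fun y => A.g (s (A.proj y), y), fun y₁ y₂ h => ?_⟩
  beta_reduce
  rw [← h, eq_inv_mul_iff_mul_eq]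
  exact A.cocycle _ _ _ (hs _) h

variable {A B C : BundleZeroGerbe n M}

theorem IsPotential.contMDiffAt {h : A.Total → Circle} (hh : A.IsPotential h) {E H X : Type*}
    [NormedAddCommGroup E] [NormedSpace ℝ E] [TopologicalSpace H] {I : ModelWithCorners ℝ E H}
    [TopologicalSpace X] [ChartedSpace H X] {a b : X → A.Total} {x : X}
    (ha : ContMDiffAt I (𝓡 A.dim) ∞ a x) (hb : ContMDiffAt I (𝓡 A.dim) ∞ b x)
    (hab : ∀ᶠ y in nhds x, A.proj (a y) = A.proj (b y)) :
    ContMDiffAt I (𝓡 1) ∞ (fun y => (h (a y))⁻¹ * h (b y)) x := by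
  refine (A.contMDiffAt_g ha hb hab).congr_of_eventuallyEq ?_
  filter_upwards [hab] with y hy
  rw [hh _ _ hy]

/-- Two potentials differ by a function on `M`. -/
theorem IsPotential.exists_eq_mul {h h' : A.Total → Circle} (hh : A.IsPotential h)
    (hh' : A.IsPotential h') : ∃ k : M → Circle, ∀ y, h' y = h y * k (A.proj y) := by
  obtain ⟨s, hs⟩ := A.surjective_proj.hasRightInverse
  refine ⟨fun x => (h (s x))⁻¹ * h' (s x), fun y => ?_⟩
  have e := (hh y _ (hs (A.proj y)).symm).symm.trans (hh' y _ (hs (A.proj y)).symm)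
  rw [← mul_assoc, mul_comm (h y), ← inv_inj, mul_inv, mul_inv, inv_inv, mul_comm _ (h y)⁻¹, e,
    mul_inv_cancel_right]

theorem IsPotential.mul {h : A.Total → Circle} (hh : A.IsPotential h) (k : M → Circle) :
    A.IsPotential fun y => h y * k (A.proj y) := fun y₁ y₂ e => by
  beta_reduce
  rw [hh _ _ e, ← e, mul_inv]
  rw [mul_mul_mul_comm, inv_mul_cancel, mul_one]

theorem IsPotential.inv {h : A.Total → Circle} (hh : A.IsPotential h) :
    A.dual.IsPotential fun y => (h y)⁻¹ := fun y₁ y₂ e => by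
  change (A.g (y₁, y₂))⁻¹ = _
  rw [hh _ _ e, mul_inv]

theorem IsProductVia.isPotential {p : C.Total → A.Total} {q : C.Total → B.Total}
    (hC : A.IsProductVia B C p q) {h : A.Total → Circle} {h' : B.Total → Circle}
    (hh : A.IsPotential h) (hh' : B.IsPotential h') :
    C.IsPotential fun z => h (p z) * h' (q z) := fun y₁ y₂ e => by
  rw [hC.2 _ _ e, hh _ _ (by rw [hC.1.proj_fst, hC.1.proj_fst, e]),
    hh' _ _ (by rw [hC.1.proj_snd, hC.1.proj_snd, e]), mul_inv, mul_mul_mul_comm]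

end BundleZeroGerbe

namespace SubmersionOnto

variable {n : ℕ} {M : Type u} [TopologicalSpace M] [ChartedSpace (EuclideanSpace ℝ (Fin n)) M]
  [IsManifold (𝓡 n) ∞ M]

theorem IsLocalSection.comp {Y Z : SubmersionOnto n M} {σ : M → Y.Total} {x : M}
    (h : Y.IsLocalSection σ x) {φ : Y.Total → Z.Total} (hφ : ContMDiff (𝓡 Y.dim) (𝓡 Z.dim) ∞ φ)
    (hφ' : ∀ y, Z.proj (φ y) = Y.proj y) : Z.IsLocalSection (φ ∘ σ) x := by
  filter_upwards [h] with y hy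
  exact ⟨(hφ _).comp y hy.1, (hφ' _).trans hy.2⟩

theorem IsLocalSection.eventually_proj_eq {Y : SubmersionOnto n M} {σ τ : M → Y.Total} {x : M}
    (h : Y.IsLocalSection σ x) (h' : Y.IsLocalSection τ x) :
    ∀ᶠ y in nhds x, Y.proj (σ y) = Y.proj (τ y) := by
  filter_upwards [h, h'] with y hy hy'
  exact hy.2.trans hy'.2.symm

end SubmersionOnto

namespace BundleZeroGerbe

variable {n : ℕ} {M : Type u} [TopologicalSpace M] [ChartedSpace (EuclideanSpace ℝ (Fin n)) M]
  [IsManifold (𝓡 n) ∞ M] {A B C : BundleZeroGerbe n M}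

/-- The class `q` is that of the functions `h ∘ σ`, where `h` is a fixed potential and `σ` ranges
over the smooth local sections. -/
def Represents (A : BundleZeroGerbe n M) (q : CircleClass n M) : Prop :=
  ∃ h, A.IsPotential h ∧ ∀ x σ, A.IsLocalSection σ x → IsCircleGerm q x (h ∘ σ)

theorem IsPotential.isCircleGerm {h : A.Total → Circle} (hh : A.IsPotential h) {x : M}
    {σ τ : M → A.Total} {q : CircleClass n M} (hq : IsCircleGerm q x (h ∘ σ))
    (hσ : A.IsLocalSection σ x) (hτ : A.IsLocalSection τ x) : IsCircleGerm q x (h ∘ τ) :=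
  hq.iff.2 (hh.contMDiffAt hσ.contMDiffAt hτ.contMDiffAt (hσ.eventually_proj_eq hτ))

theorem IsPotential.exists_isCircleGerm {h : A.Total → Circle} (hh : A.IsPotential h) :
    ∃ q : CircleClass n M, ∀ x σ, A.IsLocalSection σ x → IsCircleGerm q x (h ∘ σ) := by
  choose τ hτ using A.exists_isLocalSection
  obtain ⟨q, hq⟩ := exists_forall_isCircleGerm (f := fun x => h ∘ τ x) fun x => by
    filter_upwards [(hτ x).eventually] with y hy
    exact hh.contMDiffAt (hτ y).contMDiffAt hy.contMDiffAt ((hτ y).eventually_proj_eq hy)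
  exact ⟨q, fun x σ hσ => hh.isCircleGerm (hq x) (hτ x) hσ⟩

theorem exists_represents (A : BundleZeroGerbe n M) : ∃ q, A.Represents q := by
  obtain ⟨h, hh⟩ := A.exists_isPotential
  obtain ⟨q, hq⟩ := hh.exists_isCircleGerm
  exact ⟨q, h, hh, hq⟩

/-- The class is unique up to the choice of the potential, that is, up to a function on `M`. -/
theorem Represents.sub_mem {q q' : CircleClass n M} (h : A.Represents q) (h' : A.Represents q') :
    q - q' ∈ trivialCircleClasses n M := by
  obtain ⟨f, hf, hq⟩ := h
  obtain ⟨f', hf', hq'⟩ := h'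
  obtain ⟨k, hk⟩ := hf'.exists_eq_mul hf
  refine mem_trivialCircleClasses_iff.2 ⟨k, fun x => ?_⟩
  obtain ⟨σ, hσ⟩ := A.exists_isLocalSection x
  refine ((hq x σ hσ).sub (hq' x σ hσ)).iff.2 ?_
  refine (contMDiffAt_const (c := (1 : Circle))).congr_of_eventuallyEq ?_
  filter_upwards [hσ] with y hy
  simp only [Function.comp]
  rw [hk, hy.2, mul_right_comm, mul_inv_cancel, one_mul, inv_mul_cancel]

theorem IsProduct.represents {q q' : CircleClass n M} (hC : A.IsProduct B C)
    (h : A.Represents q) (h' : B.Represents q') : C.Represents (q + q') := by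
  obtain ⟨a, b, hC⟩ := hC
  obtain ⟨f, hf, hq⟩ := h
  obtain ⟨f', hf', hq'⟩ := h'
  exact ⟨_, hC.isPotential hf hf', fun x σ hσ =>
    (hq x _ (hσ.comp hC.1.contMDiff_fst hC.1.proj_fst)).add
      (hq' x _ (hσ.comp hC.1.contMDiff_snd hC.1.proj_snd))⟩

theorem Represents.dual {q : CircleClass n M} (h : A.Represents q) : A.dual.Represents (-q) := by
  obtain ⟨f, hf, hq⟩ := h
  exact ⟨_, hf.inv, fun x σ hσ => (hq x σ hσ).neg⟩

theorem IsIsomorphism.represents {φ : Diffeomorph (𝓡 A.dim) (𝓡 B.dim) A.Total B.Total ∞}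
    (hφ : A.IsIsomorphism B φ) {q : CircleClass n M} (h : B.Represents q) : A.Represents q := by
  obtain ⟨f, hf, hq⟩ := h
  refine ⟨f ∘ φ, fun y₁ y₂ e => ?_, fun x σ hσ => hq x _ (hσ.comp φ.contMDiff hφ.1)⟩
  rw [hφ.2 _ _ e]
  exact hf _ _ (by rw [hφ.1, hφ.1, e])

/-- A potential is smooth if it is smooth along one local section at each point. -/
theorem IsPotential.contMDiff {h : A.Total → Circle} (hh : A.IsPotential h)
    (hs : ∀ x, ∃ σ, A.IsLocalSection σ x ∧ ContMDiffAt (𝓡 n) (𝓡 1) ∞ (h ∘ σ) x) :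
    ContMDiff (𝓡 A.dim) (𝓡 1) ∞ h := by
  intro y
  obtain ⟨σ, hσ, hs⟩ := hs (A.proj y)
  have h1 : ContMDiffAt (𝓡 A.dim) (𝓡 A.dim) ∞ (σ ∘ A.proj) y :=
    hσ.contMDiffAt.comp y (A.contMDiff_proj y)
  have h2 : ContMDiffAt (𝓡 A.dim) (𝓡 1) ∞ ((h ∘ σ) ∘ A.proj) y := hs.comp y (A.contMDiff_proj y)
  have h3 : ∀ᶠ z in nhds y, A.proj (σ (A.proj z)) = A.proj z := by
    filter_upwards [(A.contMDiff_proj.continuous.tendsto y).eventually hσ] with z hz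
    exact hz.2
  -- `h(z) = h(σ(π(z))) * (h(σ(π(z)))⁻¹ * h(z))`, where the second factor is `g(σ(π(z)), z)`.
  refine (h2.mul (hh.contMDiffAt h1 contMDiffAt_id h3)).congr_of_eventuallyEq ?_
  exact Filter.Eventually.of_forall fun z => (mul_inv_cancel_left _ _).symm

/-- If the class of a potential `h` is that of a function `k` on `M`, then `h / k` is a smooth
potential; and the class of a smooth potential is zero. -/
theorem isTrivial_iff_represents :
    A.IsTrivial ↔ ∃ q ∈ trivialCircleClasses n M, A.Represents q := by
  constructor
  · rintro ⟨h, hs, hh⟩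
    refine ⟨0, zero_mem _, h, hh, fun x σ hσ => ?_⟩
    refine IsCircleGerm.iff (f := 1) (show IsCircleGerm 0 x 1 from rfl) |>.2 ?_
    simp only [Pi.one_apply, inv_one, one_mul]
    exact (hs _).comp x hσ.contMDiffAt
  · rintro ⟨q, hq, h, hh, hq'⟩
    obtain ⟨k, hk⟩ := mem_trivialCircleClasses_iff.1 hq
    refine ⟨fun y => h y * (k (A.proj y))⁻¹, IsPotential.contMDiff (hh.mul fun x => (k x)⁻¹)
      fun x => ?_, hh.mul fun x => (k x)⁻¹⟩
    obtain ⟨σ, hσ⟩ := A.exists_isLocalSection x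
    refine ⟨σ, hσ, ((hk x).iff.1 (hq' x σ hσ)).congr_of_eventuallyEq ?_⟩
    filter_upwards [hσ] with y hy
    simp only [Function.comp]
    rw [hy.2, mul_comm]

end BundleZeroGerbe

/-! ### Pullbacks of 1-forms -/

section Pullback

variable {n m : ℕ} {X Y : Type*} [TopologicalSpace X] [ChartedSpace (EuclideanSpace ℝ (Fin n)) X]
  [TopologicalSpace Y] [ChartedSpace (EuclideanSpace ℝ (Fin m)) Y]

variable (n m) in
/-- The pullback of a 1-form. -/
def formPullback (σ : X → Y) (a : ∀ y : Y, TangentSpace (𝓡 m) y →L[ℝ] ℝ) (x : X) :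
    TangentSpace (𝓡 n) x →L[ℝ] ℝ :=
  (a (σ x)).comp (mfderiv (𝓡 n) (𝓡 m) σ x)

theorem formPullback_comp {k : ℕ} {Z : Type*} [TopologicalSpace Z]
    [ChartedSpace (EuclideanSpace ℝ (Fin k)) Z] {σ : X → Y} {τ : Y → Z} {x : X}
    (a : ∀ z : Z, TangentSpace (𝓡 k) z →L[ℝ] ℝ) (hσ : ContMDiffAt (𝓡 n) (𝓡 m) ∞ σ x)
    (hτ : ContMDiffAt (𝓡 m) (𝓡 k) ∞ τ (σ x)) :
    formPullback n k (τ ∘ σ) a x = formPullback n m σ (formPullback m k τ a) x := by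
  unfold formPullback
  rw [mfderiv_comp x (hτ.mdifferentiableAt (by simp)) (hσ.mdifferentiableAt (by simp))]
  rfl

theorem circleDlog_comp {σ : X → Y} {f : Y → Circle} {x : X}
    (hσ : ContMDiffAt (𝓡 n) (𝓡 m) ∞ σ x) (hf : ContMDiffAt (𝓡 m) (𝓡 1) ∞ f (σ x)) :
    circleDlog n (f ∘ σ) x = formPullback n m σ (circleDlog m f) x := by
  have hf' : MDifferentiableAt (𝓡 m) 𝓘(ℝ, ℂ) (fun y => (f y : ℂ)) (σ x) :=
    ((contMDiff_circle_coe (f (σ x))).comp (σ x) hf).mdifferentiableAt (by simp)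
  have h : mfderiv (𝓡 n) 𝓘(ℝ, ℂ) (fun y => ((f ∘ σ) y : ℂ)) x = _ :=
    mfderiv_comp (g := fun y => (f y : ℂ)) x hf' (hσ.mdifferentiableAt (by simp))
  unfold circleDlog formPullback
  rw [h]
  rfl

theorem contMDiffAt_covector_add [IsManifold (𝓡 n) ∞ X]
    {a b : ∀ x : X, TangentSpace (𝓡 n) x →L[ℝ] ℝ} {x : X}
    (ha : ContMDiffAt (𝓡 n) ((𝓡 n).prod 𝓘(ℝ, EuclideanSpace ℝ (Fin n) →L[ℝ] ℝ)) ∞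
      (fun y : X => covector n y (a y)) x)
    (hb : ContMDiffAt (𝓡 n) ((𝓡 n).prod 𝓘(ℝ, EuclideanSpace ℝ (Fin n) →L[ℝ] ℝ)) ∞
      (fun y : X => covector n y (b y)) x) :
    ContMDiffAt (𝓡 n) ((𝓡 n).prod 𝓘(ℝ, EuclideanSpace ℝ (Fin n) →L[ℝ] ℝ)) ∞
      (fun y : X => covector n y (a y + b y)) x :=
  ((connectionGerms n X).carrier x).add_mem (x := connectionFamily 1 a) (y := connectionFamily 1 b)
    ha hb

theorem contMDiffAt_formPullback [IsManifold (𝓡 n) ∞ X] [IsManifold (𝓡 m) ∞ Y] {σ : X → Y}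
    {a : ∀ y : Y, TangentSpace (𝓡 m) y →L[ℝ] ℝ} {x : X} (hσ : ContMDiffAt (𝓡 n) (𝓡 m) ∞ σ x)
    (ha : ContMDiffAt (𝓡 m) ((𝓡 m).prod 𝓘(ℝ, EuclideanSpace ℝ (Fin m) →L[ℝ] ℝ)) ∞
      (fun y : Y => covector m y (a y)) (σ x)) :
    ContMDiffAt (𝓡 n) ((𝓡 n).prod 𝓘(ℝ, EuclideanSpace ℝ (Fin n) →L[ℝ] ℝ)) ∞
      (fun y : X => covector n y (formPullback n m σ a y)) x := by
  rw [contMDiffAt_hom_bundle (E₂ := Bundle.Trivial Y ℝ)] at ha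
  rw [contMDiffAt_hom_bundle (E₂ := Bundle.Trivial X ℝ)]
  refine ⟨contMDiffAt_id, ((ha.2.comp x hσ).clm_comp
    (hσ.mfderiv_const (m := ∞) le_rfl)).congr_of_eventuallyEq ?_⟩
  have hb : ∀ᶠ y in nhds x, σ y ∈ (trivializationAt (EuclideanSpace ℝ (Fin m))
      (TangentSpace (𝓡 m)) (σ x)).baseSet := hσ.continuousAt.eventually
    ((Bundle.Trivialization.open_baseSet _).mem_nhds
      (FiberBundle.mem_baseSet_trivializationAt (EuclideanSpace ℝ (Fin m)) (TangentSpace (𝓡 m)) (σ x)))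
  filter_upwards [hb] with y hy
  ext v
  have e : Bundle.Trivialization.continuousLinearMapAt ℝ
      (trivializationAt ℝ (Bundle.Trivial X ℝ) x) y = ContinuousLinearMap.id ℝ ℝ :=
    Bundle.Trivial.continuousLinearMapAt_trivialization ℝ X ℝ y
  have e' : Bundle.Trivialization.continuousLinearMapAt ℝ
      (trivializationAt ℝ (Bundle.Trivial Y ℝ) (σ x)) (σ y) = ContinuousLinearMap.id ℝ ℝ :=
    Bundle.Trivial.continuousLinearMapAt_trivialization ℝ Y ℝ (σ y)
  have h1 := Bundle.Trivialization.symmL_continuousLinearMapAt (R := ℝ)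
    (trivializationAt (EuclideanSpace ℝ (Fin m)) (TangentSpace (𝓡 m)) (σ x)) hy
      (mfderiv (𝓡 n) (𝓡 m) σ y (Bundle.Trivialization.symmL ℝ
        (trivializationAt (EuclideanSpace ℝ (Fin n)) (TangentSpace (𝓡 n)) x) y v))
  refine (DFunLike.congr_fun e _).trans (Eq.symm ((DFunLike.congr_fun e' _).trans ?_))
  exact congrArg (a (σ y)) h1

end Pullback

/-! ### The defining equation of a connection -/

namespace ConnectiveZeroGerbe

variable {n : ℕ} {M : Type u} [TopologicalSpace M] [ChartedSpace (EuclideanSpace ℝ (Fin n)) M]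
  [IsManifold (𝓡 n) ∞ M]

/-- The equation `δ(A) = d log g`, pulled back by a map `(a, b)` to `Y ×_M Y`. -/
theorem circleDlog_g (A : ConnectiveZeroGerbe n M) {m : ℕ} {X : Type*} [TopologicalSpace X]
    [ChartedSpace (EuclideanSpace ℝ (Fin m)) X] {a b : X → A.Total} {x : X}
    (ha : ContMDiffAt (𝓡 m) (𝓡 A.dim) ∞ a x) (hb : ContMDiffAt (𝓡 m) (𝓡 A.dim) ∞ b x)
    (h : ∀ᶠ y in nhds x, A.proj (a y) = A.proj (b y)) :
    circleDlog m (fun y => A.g (a y, b y)) x =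
      formPullback m A.dim b A.conn x - formPullback m A.dim a A.conn x := by
  obtain ⟨D, hD, hD'⟩ := A.delta_conn _ _ h.self_of_nhds
  have ha' := (ha.mdifferentiableAt (by simp)).hasMFDerivAt
  have hb' := (hb.mdifferentiableAt (by simp)).hasMFDerivAt
  have h1 : HasMFDerivWithinAt (𝓡 m) 𝓘(ℝ, ℂ) (fun y => (A.g (a y, b y) : ℂ))
      {y | A.proj (a y) = A.proj (b y)} x _ :=
    HasMFDerivWithinAt.comp (g := fun p => (A.g p : ℂ)) (f := fun y => (a y, b y)) x hD
      (ha'.prodMk hb').hasMFDerivWithinAt fun y hy => hy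
  have h2 := (h1.hasMFDerivAt h).mfderiv
  have e : mfderiv (𝓡 m) (𝓡 n) (A.proj ∘ a) x = mfderiv (𝓡 m) (𝓡 n) (A.proj ∘ b) x :=
    Filter.EventuallyEq.mfderiv_eq h
  rw [mfderiv_comp x ((A.contMDiff_proj _).mdifferentiableAt (by simp)) ha'.mdifferentiableAt,
    mfderiv_comp x ((A.contMDiff_proj _).mdifferentiableAt (by simp)) hb'.mdifferentiableAt] at e
  ext v
  refine Eq.trans ?_ (hD' _ _ (DFunLike.congr_fun e v)).symm
  unfold circleDlog
  rw [h2]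
  rfl

end ConnectiveZeroGerbe

namespace BundleZeroGerbe

variable {n : ℕ} {M : Type u} [TopologicalSpace M] [ChartedSpace (EuclideanSpace ℝ (Fin n)) M]
  [IsManifold (𝓡 n) ∞ M]

/-- A 1-form on `Y` that is locally of the form `π^* b + d log w` for local trivialisations `w` over
`M` is a connection. -/
theorem exists_hasMFDerivWithinAt_of_circleDlog (A : BundleZeroGerbe n M)
    {a : ∀ y : A.Total, TangentSpace (𝓡 A.dim) y →L[ℝ] ℝ} {y₁ y₂ : A.Total}
    (h : A.proj y₁ = A.proj y₂) {w : A.Total → Circle}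
    (b : ∀ x : M, TangentSpace (𝓡 n) x →L[ℝ] ℝ)
    (hw₁ : ContMDiffAt (𝓡 A.dim) (𝓡 1) ∞ w y₁) (hw₂ : ContMDiffAt (𝓡 A.dim) (𝓡 1) ∞ w y₂)
    (hg : ∀ᶠ x in nhds (A.proj y₁), ∀ z₁ z₂, A.proj z₁ = x → A.proj z₂ = x →
      A.g (z₁, z₂) = (w z₁)⁻¹ * w z₂)
    (h₁ : a y₁ = formPullback A.dim n A.proj b y₁ + circleDlog A.dim w y₁)
    (h₂ : a y₂ = formPullback A.dim n A.proj b y₂ + circleDlog A.dim w y₂) :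
    ∃ D : TangentSpace ((𝓡 A.dim).prod (𝓡 A.dim)) (y₁, y₂) →L[ℝ] ℂ,
      HasMFDerivWithinAt ((𝓡 A.dim).prod (𝓡 A.dim)) 𝓘(ℝ, ℂ) (fun p => (A.g p : ℂ))
        (A.fibreProduct A.toSubmersionOnto) (y₁, y₂) D ∧
      ∀ (v₁ : TangentSpace (𝓡 A.dim) y₁) (v₂ : TangentSpace (𝓡 A.dim) y₂),
        A.TangentToFibreProduct A.toSubmersionOnto y₁ y₂ v₁ v₂ →
        a y₂ v₂ - a y₁ v₁ = (starRingEnd ℂ (A.g (y₁, y₂)) * D (v₁, v₂)).im := by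
  have hc : ∀ {y}, ContMDiffAt (𝓡 A.dim) (𝓡 1) ∞ w y →
      MDifferentiableAt (𝓡 A.dim) 𝓘(ℝ, ℂ) (fun z => (w z : ℂ)) y := fun {y} hw =>
    ((contMDiff_circle_coe (w y)).comp y hw).mdifferentiableAt (by simp)
  have d₁ := (hasMFDerivWithinAt_conj (g := fun p : A.Total × A.Total => w p.1)
    (HasMFDerivAt.comp (g := fun z => (w z : ℂ)) (f := Prod.fst) (y₁, y₂) (hc hw₁).hasMFDerivAt
      (hasMFDerivAt_fst (I := 𝓡 A.dim) (I' := 𝓡 A.dim) (y₁, y₂))).hasMFDerivWithinAt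
        (s := Set.univ)).hasMFDerivAt Filter.univ_mem
  have d₂ := HasMFDerivAt.comp (g := fun z => (w z : ℂ)) (f := Prod.snd) (y₁, y₂)
    (hc hw₂).hasMFDerivAt (hasMFDerivAt_snd (I := 𝓡 A.dim) (I' := 𝓡 A.dim) (y₁, y₂))
  have d := d₁.mul d₂
  refine ⟨_, d.hasMFDerivWithinAt.congr_of_eventuallyEq ?_ ?_, fun v₁ v₂ hv => ?_⟩
  · have := (A.contMDiff_proj.continuous.comp continuous_fst).tendsto (y₁, y₂)
    filter_upwards [mem_nhdsWithin_of_mem_nhds (this.eventually hg), self_mem_nhdsWithin]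
      with p hp hp'
    rw [hp p.1 p.2 rfl (Eq.symm hp')]
    rfl
  · rw [hg.self_of_nhds y₁ y₂ rfl h.symm]
    rfl
  · rw [hg.self_of_nhds y₁ y₂ rfl h.symm, h₁, h₂]
    have hb : formPullback A.dim n A.proj b y₁ v₁ = formPullback A.dim n A.proj b y₂ v₂ := by
      have key : ∀ x x', x = x' → ∀ v : EuclideanSpace ℝ (Fin n), b x v = b x' v := by
        rintro _ _ rfl _
        rfl
      exact (key _ _ h _).trans (congrArg (b (A.proj y₂)) hv)
    have key : ∀ D₁ D₂ : ℂ, (starRingEnd ℂ (w y₂ : ℂ) * D₂).im - (starRingEnd ℂ (w y₁ : ℂ) * D₁).im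
        = (starRingEnd ℂ (((w y₁)⁻¹ * w y₂ : Circle) : ℂ) * ((((w y₁)⁻¹ : Circle) : ℂ) * D₂ +
          (w y₂ : ℂ) * starRingEnd ℂ D₁)).im := fun D₁ D₂ => by
      have e₁ : (w y₁ : ℂ) * starRingEnd ℂ (w y₁ : ℂ) = 1 := by
        rw [mul_comm, ← Complex.normSq_eq_conj_mul_self]; simp
      have e₂ : starRingEnd ℂ (w y₂ : ℂ) * (w y₂ : ℂ) = 1 := by
        rw [← Complex.normSq_eq_conj_mul_self]; simp
      have e : starRingEnd ℂ (((w y₁)⁻¹ * w y₂ : Circle) : ℂ) * ((((w y₁)⁻¹ : Circle) : ℂ) * D₂ +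
          (w y₂ : ℂ) * starRingEnd ℂ D₁) = starRingEnd ℂ (w y₂ : ℂ) * D₂ +
            starRingEnd ℂ (starRingEnd ℂ (w y₁ : ℂ) * D₁) := by
        rw [Circle.coe_mul, Circle.coe_inv_eq_conj, map_mul, map_mul, Complex.conj_conj]
        linear_combination (starRingEnd ℂ (w y₂ : ℂ) * D₂) * e₁ +
          ((w y₁ : ℂ) * starRingEnd ℂ D₁) * e₂
      rw [e, Complex.add_im, Complex.conj_im, sub_eq_add_neg]
    have sub_eq : ∀ {s t c d : ℝ}, s = t → t + c - (s + d) = c - d := by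
      rintro s _ c d rfl
      exact add_sub_add_left_eq_sub c d s
    exact (sub_eq hb).trans (key _ _)

end BundleZeroGerbe

/-! ### The class of a bundle 0-gerbe with connection -/

section Germs

variable {n : ℕ} {M : Type u} [TopologicalSpace M] [ChartedSpace (EuclideanSpace ℝ (Fin n)) M]
  [IsManifold (𝓡 n) ∞ M]

/-- The value of the class `q` at `x` is induced by the circle-valued function `f` and the
1-form `a`. -/
def IsConnectionGerm (q : ConnectionClass n M) (x : M) (f : M → Circle)
    (a : ∀ x : M, TangentSpace (𝓡 n) x →L[ℝ] ℝ) : Prop :=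
  q.1 ⟨x, trivial⟩ = (dlogGerms n M).germ x (connectionFamily f a)

variable {q q' : ConnectionClass n M} {x : M} {f f' : M → Circle}
  {a a' : ∀ x : M, TangentSpace (𝓡 n) x →L[ℝ] ℝ}

theorem IsConnectionGerm.iff (h : IsConnectionGerm q x f a) :
    IsConnectionGerm q x f' a' ↔ ContMDiffAt (𝓡 n) (𝓡 1) ∞ (fun y => (f y)⁻¹ * f' y) x ∧
      a' x - a x = circleDlog n (fun y => (f y)⁻¹ * f' y) x := by
  unfold IsConnectionGerm at h ⊢
  rw [h, QuotientAddGroup.eq, sub_eq_neg_add]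
  exact Iff.rfl

theorem IsConnectionGerm.add (h : IsConnectionGerm q x f a) (h' : IsConnectionGerm q' x f' a') :
    IsConnectionGerm (q + q') x (fun y => f y * f' y) (fun y => a y + a' y) :=
  congrArg₂ (· + ·) h h'

theorem IsConnectionGerm.neg (h : IsConnectionGerm q x f a) :
    IsConnectionGerm (-q) x (fun y => (f y)⁻¹) (fun y => -a y) :=
  congrArg (-·) h

theorem IsConnectionGerm.sub (h : IsConnectionGerm q x f a) (h' : IsConnectionGerm q' x f' a') :
    IsConnectionGerm (q - q') x (fun y => f y * (f' y)⁻¹) (fun y => a y + -a' y) := by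
  rw [sub_eq_add_neg]
  exact h.add h'.neg

theorem IsConnectionGerm.congr (h : IsConnectionGerm q x f a)
    (hf : ∀ᶠ y in nhds x, f y = f' y ∧ a y = a' y) : IsConnectionGerm q x f' a' :=
  h.trans ((dlogGerms n M).mk_eq (by
    filter_upwards [hf] with y hy
    exact ULift.ext _ _ (Prod.ext hy.1 hy.2)))

theorem exists_isConnectionGerm (q : ConnectionClass n M) (x : M) :
    ∃ (f : M → Circle) (a : ∀ x : M, TangentSpace (𝓡 n) x →L[ℝ] ℝ), ∀ᶠ y in nhds x,
      ContMDiffAt (𝓡 n) ((𝓡 n).prod 𝓘(ℝ, EuclideanSpace ℝ (Fin n) →L[ℝ] ℝ)) ∞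
        (fun y : M => covector n y (a y)) y ∧ IsConnectionGerm q y f a := by
  obtain ⟨t, ht⟩ := q.2 ⟨x, trivial⟩
  obtain ⟨V, i, hV, h⟩ := nhds_coe_eventually ht
  refine ⟨fun y => (t y).down.1.toMul, fun y => (t y).down.2, ?_⟩
  filter_upwards [V.isOpen.mem_nhds hV] with y hy
  exact ⟨(h ⟨y, hy⟩).1, (h ⟨y, hy⟩).2⟩

theorem exists_forall_isConnectionGerm {f : M → M → Circle}
    {a : ∀ _ x : M, TangentSpace (𝓡 n) x →L[ℝ] ℝ}
    (hf : ∀ x, ∀ᶠ y in nhds x,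
      ContMDiffAt (𝓡 n) ((𝓡 n).prod 𝓘(ℝ, EuclideanSpace ℝ (Fin n) →L[ℝ] ℝ)) ∞
        (fun z : M => covector n z (a x z)) y ∧
      ContMDiffAt (𝓡 n) (𝓡 1) ∞ (fun z => (f y z)⁻¹ * f x z) y ∧
      a x y - a y y = circleDlog n (fun z => (f y z)⁻¹ * f x z) y) :
    ∃ q : ConnectionClass n M, ∀ x, IsConnectionGerm q x (f x) (a x) :=
  ⟨⟨fun x => (dlogGerms n M).germ x (connectionFamily (f x) (a x)), fun x =>
    ⟨connectionFamily (f x) (a x), by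
      filter_upwards [((continuous_subtype_val.tendsto x).eventually (hf x) :)] with y hy
      refine ⟨hy.1, QuotientAddGroup.eq.2 ⟨hy.2.1, ?_⟩⟩
      have := hy.2.2
      rw [sub_eq_neg_add] at this
      exact this⟩⟩, fun x => rfl⟩

theorem mem_trivialConnectionClasses_iff :
    q ∈ trivialConnectionClasses n M ↔ ∃ k, ∀ x, IsConnectionGerm q x k 0 := by
  constructor
  · rintro ⟨t, rfl⟩
    exact ⟨fun y => (extendByZero t.1 y).down.toMul, fun x => rfl⟩
  · rintro ⟨k, hk⟩
    refine ⟨⟨fun x => circleFamily k x, trivial⟩, Subtype.ext (funext fun x => ?_)⟩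
    refine Eq.trans ?_ (hk x).symm
    refine congrArg (QuotientAddGroup.mk (s := (dlogGerms n M).carrier x)) (funext fun y => ?_)
    exact ULift.ext _ _ (Prod.ext (congrArg (fun t => t.down)
      (extendByZero_top (T := CircleValues M) _ y)) rfl)

end Germs

namespace ConnectiveZeroGerbe

variable {n : ℕ} {M : Type u} [TopologicalSpace M] [ChartedSpace (EuclideanSpace ℝ (Fin n)) M]
  [IsManifold (𝓡 n) ∞ M] {A B C : ConnectiveZeroGerbe n M}

/-- The class `q` is that of the pairs `(h ∘ σ, σ^* A)`, where `h` is a fixed potential and `σ`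
ranges over the smooth local sections. -/
def Represents (A : ConnectiveZeroGerbe n M) (q : ConnectionClass n M) : Prop :=
  ∃ h, A.IsPotential h ∧ ∀ x σ, A.IsLocalSection σ x →
    IsConnectionGerm q x (h ∘ σ) (formPullback n A.dim σ A.conn)

/-- Although a potential `h` need not be smooth, `δ(A) = d log (h⁻¹ h)`. -/
theorem circleDlog_potential {h : A.Total → Circle} (hh : A.IsPotential h) {m : ℕ} {X : Type*}
    [TopologicalSpace X] [ChartedSpace (EuclideanSpace ℝ (Fin m)) X] {a b : X → A.Total} {x : X}
    (ha : ContMDiffAt (𝓡 m) (𝓡 A.dim) ∞ a x) (hb : ContMDiffAt (𝓡 m) (𝓡 A.dim) ∞ b x)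
    (hab : ∀ᶠ y in nhds x, A.proj (a y) = A.proj (b y)) :
    circleDlog m (fun y => (h (a y))⁻¹ * h (b y)) x =
      formPullback m A.dim b A.conn x - formPullback m A.dim a A.conn x := by
  rw [← A.circleDlog_g ha hb hab]
  refine circleDlog_congr m ?_
  filter_upwards [hab] with y hy
  rw [hh _ _ hy]

theorem isConnectionGerm_of_isLocalSection {h : A.Total → Circle} (hh : A.IsPotential h) {x : M}
    {σ τ : M → A.Total} {q : ConnectionClass n M}
    (hq : IsConnectionGerm q x (h ∘ σ) (formPullback n A.dim σ A.conn))
    (hσ : A.IsLocalSection σ x) (hτ : A.IsLocalSection τ x) :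
    IsConnectionGerm q x (h ∘ τ) (formPullback n A.dim τ A.conn) :=
  hq.iff.2 ⟨hh.contMDiffAt hσ.contMDiffAt hτ.contMDiffAt (hσ.eventually_proj_eq hτ),
    (circleDlog_potential hh hσ.contMDiffAt hτ.contMDiffAt (hσ.eventually_proj_eq hτ)).symm⟩

theorem exists_represents (A : ConnectiveZeroGerbe n M) : ∃ q, A.Represents q := by
  obtain ⟨h, hh⟩ := A.exists_isPotential
  choose τ hτ using A.exists_isLocalSection
  obtain ⟨q, hq⟩ := exists_forall_isConnectionGerm (f := fun x => h ∘ τ x)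
      (a := fun x => formPullback n A.dim (τ x) A.conn) fun x => by
    filter_upwards [(hτ x).eventually] with y hy
    exact ⟨contMDiffAt_formPullback hy.contMDiffAt (A.contMDiff_conn _),
      hh.contMDiffAt (hτ y).contMDiffAt hy.contMDiffAt ((hτ y).eventually_proj_eq hy),
      (circleDlog_potential hh (hτ y).contMDiffAt hy.contMDiffAt
        ((hτ y).eventually_proj_eq hy)).symm⟩
  exact ⟨q, h, hh, fun x σ hσ => isConnectionGerm_of_isLocalSection hh (hq x) (hτ x) hσ⟩

theorem Represents.sub_mem {q q' : ConnectionClass n M} (h : A.Represents q)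
    (h' : A.Represents q') : q - q' ∈ trivialConnectionClasses n M := by
  obtain ⟨f, hf, hq⟩ := h
  obtain ⟨f', hf', hq'⟩ := h'
  obtain ⟨k, hk⟩ := hf'.exists_eq_mul hf
  refine mem_trivialConnectionClasses_iff.2 ⟨k, fun x => ?_⟩
  obtain ⟨σ, hσ⟩ := A.exists_isLocalSection x
  refine ((hq x σ hσ).sub (hq' x σ hσ)).congr ?_
  filter_upwards [hσ] with y hy
  refine ⟨?_, add_neg_cancel _⟩
  simp only [Function.comp]
  rw [hk, hy.2, mul_right_comm, mul_inv_cancel, one_mul]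

theorem IsProduct.represents {q q' : ConnectionClass n M} (hC : A.IsProduct B C)
    (h : A.Represents q) (h' : B.Represents q') : C.Represents (q + q') := by
  obtain ⟨a, b, hC, hconn⟩ := hC
  obtain ⟨f, hf, hq⟩ := h
  obtain ⟨f', hf', hq'⟩ := h'
  refine ⟨_, hC.isPotential hf hf', fun x σ hσ =>
    ((hq x _ (hσ.comp hC.1.contMDiff_fst hC.1.proj_fst)).add
      (hq' x _ (hσ.comp hC.1.contMDiff_snd hC.1.proj_snd))).congr ?_⟩
  filter_upwards [hσ] with y hy
  refine ⟨rfl, ?_⟩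
  rw [formPullback_comp A.conn hy.1 (hC.1.contMDiff_fst _),
    formPullback_comp B.conn hy.1 (hC.1.contMDiff_snd _)]
  exact (congrArg (fun c => c.comp (mfderiv (𝓡 n) (𝓡 C.dim) σ y)) (hconn (σ y))).symm

theorem Represents.dual {q : ConnectionClass n M} (h : A.Represents q) :
    A.dual.Represents (-q) := by
  obtain ⟨f, hf, hq⟩ := h
  exact ⟨_, hf.inv, fun x σ hσ => (hq x σ hσ).neg⟩

theorem IsIsomorphism.represents {φ : Diffeomorph (𝓡 A.dim) (𝓡 B.dim) A.Total B.Total ∞}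
    (hφ : A.IsIsomorphism B φ) {q : ConnectionClass n M} (h : B.Represents q) :
    A.Represents q := by
  obtain ⟨f, hf, hq⟩ := h
  refine ⟨f ∘ φ, fun y₁ y₂ e => ?_, fun x σ hσ =>
    (hq x _ (hσ.comp φ.contMDiff hφ.1.1)).congr ?_⟩
  · rw [hφ.1.2 _ _ e]
    exact hf _ _ (by rw [hφ.1.1, hφ.1.1, e])
  · filter_upwards [hσ] with y hy
    refine ⟨rfl, ?_⟩
    rw [formPullback_comp B.conn hy.1 (φ.contMDiff _)]
    exact (congrArg (fun c => c.comp (mfderiv (𝓡 n) (𝓡 A.dim) σ y)) (hφ.2 (σ y))).symm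

/-- If the class of a potential `f` is that of a pair `(k, 0)`, then `f / k` is a smooth potential
whose logarithmic derivative is the connection; and the class of such a potential is zero. -/
theorem isDTrivial_iff_represents :
    A.IsDTrivial ↔ ∃ q ∈ trivialConnectionClasses n M, A.Represents q := by
  constructor
  · rintro ⟨h, ⟨hs, hh⟩, hd⟩
    refine ⟨0, zero_mem _, h, hh, fun x σ hσ => ?_⟩
    refine IsConnectionGerm.iff (f := 1) (a := 0)
      (show IsConnectionGerm 0 x 1 0 from rfl) |>.2 ?_
    simp only [Pi.one_apply, inv_one, one_mul]
    refine ⟨(hs _).comp x hσ.contMDiffAt, (sub_zero _).trans ?_⟩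
    refine Eq.trans ?_ (circleDlog_comp hσ.contMDiffAt (hs _)).symm
    unfold formPullback
    rw [hd]
  · rintro ⟨q, hq, f, hf, hq'⟩
    obtain ⟨k, hk⟩ := mem_trivialConnectionClasses_iff.1 hq
    let h : A.Total → Circle := fun y => f y * (k (A.proj y))⁻¹
    have hh : A.IsPotential h := hf.mul fun x => (k x)⁻¹
    have hloc : ∀ x σ, A.IsLocalSection σ x → ContMDiffAt (𝓡 n) (𝓡 1) ∞ (h ∘ σ) x ∧
        circleDlog n (h ∘ σ) x = formPullback n A.dim σ A.conn x := fun x σ hσ => by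
      have h1 := (hk x).iff.1 (hq' x σ hσ)
      have e : h ∘ σ =ᶠ[nhds x] fun y => (k y)⁻¹ * (f ∘ σ) y := by
        filter_upwards [hσ] with y hy
        simp only [Function.comp, h]
        rw [hy.2, mul_comm]
      refine ⟨h1.1.congr_of_eventuallyEq e, ?_⟩
      rw [circleDlog_congr n e, ← h1.2]
      exact sub_zero _
    have hs : ContMDiff (𝓡 A.dim) (𝓡 1) ∞ h := hh.contMDiff fun x => by
      obtain ⟨σ, hσ⟩ := A.exists_isLocalSection x
      exact ⟨σ, hσ, (hloc x σ hσ).1⟩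
    -- It remains to compare `d log h` with the connection on all of `Y`, not only along sections:
    -- `h` is the product of `h ∘ σ ∘ π` and `g(σ ∘ π, id)`.
    refine ⟨h, ⟨hs, hh⟩, fun y => ?_⟩
    obtain ⟨σ, hσ⟩ := A.exists_isLocalSection (A.proj y)
    have hπ := A.contMDiff_proj y
    have h1 : ContMDiffAt (𝓡 A.dim) (𝓡 A.dim) ∞ (σ ∘ A.proj) y := hσ.contMDiffAt.comp y hπ
    have h2 : ∀ᶠ z in nhds y, A.proj (σ (A.proj z)) = A.proj z := by
      filter_upwards [(A.contMDiff_proj.continuous.tendsto y).eventually hσ] with z hz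
      exact hz.2
    have h3 := circleDlog_potential hh h1 contMDiffAt_id h2
    have h4 := circleDlog_mul A.dim (hs.contMDiffAt.comp y h1)
      (hh.contMDiffAt h1 contMDiffAt_id h2)
    have e : (fun z => (h ∘ σ ∘ A.proj) z * ((h ((σ ∘ A.proj) z))⁻¹ * h (id z))) = h :=
      funext fun z => mul_inv_cancel_left _ _
    have h5 : circleDlog A.dim (h ∘ σ ∘ A.proj) y =
        formPullback A.dim A.dim (σ ∘ A.proj) A.conn y := by
      rw [formPullback_comp A.conn hπ hσ.contMDiffAt]
      refine (circleDlog_comp (f := h ∘ σ) hπ (hloc _ σ hσ).1).trans ?_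
      unfold formPullback
      rw [(hloc _ σ hσ).2]
      rfl
    have h6 : formPullback A.dim A.dim id A.conn y = A.conn y := by
      unfold formPullback
      rw [mfderiv_id]
      exact ContinuousLinearMap.comp_id _
    rw [e, h5, h3, h6] at h4
    rw [h4]
    exact add_sub_cancel _ _

end ConnectiveZeroGerbe

/-! ### Products of bundle 0-gerbes with connection -/

namespace ConnectiveZeroGerbe

variable {n : ℕ} {M : Type u} [TopologicalSpace M] [ChartedSpace (EuclideanSpace ℝ (Fin n)) M]
  [IsManifold (𝓡 n) ∞ M]

/-- Over a local section, the pullback of a connection is of the form `π^* b + d log w`. -/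
theorem formPullback_conn (A : ConnectiveZeroGerbe n M) {W : SubmersionOnto n M}
    {p : W.Total → A.Total} {y : W.Total} {σ : M → A.Total} (hp : ContMDiff (𝓡 W.dim) (𝓡 A.dim) ∞ p)
    (hp' : ∀ w, A.proj (p w) = W.proj w) (hσ : A.IsLocalSection σ (W.proj y)) :
    ContMDiffAt (𝓡 W.dim) (𝓡 1) ∞ (fun z => A.g (σ (W.proj z), p z)) y ∧
    formPullback W.dim A.dim p A.conn y =
      formPullback W.dim n W.proj (formPullback n A.dim σ A.conn) y +
        circleDlog W.dim (fun z => A.g (σ (W.proj z), p z)) y := by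
  have hπ := W.contMDiff_proj y
  have h : ∀ᶠ z in nhds y, A.proj (σ (W.proj z)) = A.proj (p z) := by
    filter_upwards [(W.contMDiff_proj.continuous.tendsto y).eventually hσ] with z hz
    exact hz.2.trans (hp' z).symm
  have h' := A.circleDlog_g (hσ.contMDiffAt.comp y hπ) (hp y) h
  rw [formPullback_comp A.conn hπ hσ.contMDiffAt] at h'
  exact ⟨A.contMDiffAt_g (hσ.contMDiffAt.comp y hπ) (hp y) h, eq_add_of_sub_eq' h'.symm⟩

/-- The sum of the pulled back connections is a connection, because it is of the form `π^* b + d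
log w` over local sections. -/
theorem exists_isProduct [T2Space M] (A B : ConnectiveZeroGerbe n M) :
    ∃ C, A.IsProduct B C := by
  obtain ⟨W, p, q, h⟩ := A.exists_isFibreProduct B.toSubmersionOnto
  refine ⟨{
    toBundleZeroGerbe := A.toBundleZeroGerbe.product B.toBundleZeroGerbe h
    conn := fun z => formPullback W.dim A.dim p A.conn z + formPullback W.dim B.dim q B.conn z
    contMDiff_conn := fun z => contMDiffAt_covector_add
      (contMDiffAt_formPullback (h.contMDiff_fst z) (A.contMDiff_conn _))
      (contMDiffAt_formPullback (h.contMDiff_snd z) (B.contMDiff_conn _))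
    delta_conn := fun y₁ y₂ hy => by
      have hy : W.proj y₁ = W.proj y₂ := hy
      obtain ⟨σ, hσ⟩ := A.exists_isLocalSection (W.proj y₁)
      obtain ⟨τ, hτ⟩ := B.exists_isLocalSection (W.proj y₁)
      have key : ∀ y, W.proj y₁ = W.proj y → ContMDiffAt (𝓡 W.dim) (𝓡 1) ∞
          (fun z => A.g (σ (W.proj z), p z) * B.g (τ (W.proj z), q z)) y ∧
          formPullback W.dim A.dim p A.conn y + formPullback W.dim B.dim q B.conn y =
          formPullback W.dim n W.proj
            (fun x => formPullback n A.dim σ A.conn x + formPullback n B.dim τ B.conn x) y +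
          circleDlog W.dim (fun z => A.g (σ (W.proj z), p z) * B.g (τ (W.proj z), q z)) y :=
        fun y hy => by
          obtain ⟨h1, h2⟩ := A.formPullback_conn h.contMDiff_fst h.proj_fst (hy ▸ hσ)
          obtain ⟨h3, h4⟩ := B.formPullback_conn h.contMDiff_snd h.proj_snd (hy ▸ hτ)
          refine ⟨h1.mul h3, ?_⟩
          rw [circleDlog_mul W.dim h1 h3, h2, h4]
          exact add_add_add_comm _ _ _ _
      refine (A.toBundleZeroGerbe.product B.toBundleZeroGerbe
        h).exists_hasMFDerivWithinAt_of_circleDlog (a := fun z =>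
          formPullback W.dim A.dim p A.conn z + formPullback W.dim B.dim q B.conn z) hy
        (fun x => formPullback n A.dim σ A.conn x + formPullback n B.dim τ B.conn x)
        (key y₁ rfl).1 (key y₂ hy).1 ?_ (key y₁ rfl).2 (key y₂ hy).2
      have hg : ∀ {x : M}, A.proj (σ x) = x → B.proj (τ x) = x → ∀ z₁ z₂ : W.Total,
          W.proj z₁ = x → W.proj z₂ = x → A.g (p z₁, p z₂) * B.g (q z₁, q z₂) =
          (A.g (σ (W.proj z₁), p z₁) * B.g (τ (W.proj z₁), q z₁))⁻¹ *
            (A.g (σ (W.proj z₂), p z₂) * B.g (τ (W.proj z₂), q z₂)) := fun {x} h1 h2 z₁ z₂ hz₁ hz₂ => by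
        rw [hz₁, hz₂, ← A.cocycle (σ x) (p z₁) (p z₂) (by rw [h1, h.proj_fst, hz₁])
          (by rw [h.proj_fst, h.proj_fst, hz₁, hz₂]), ← B.cocycle (τ x) (q z₁) (q z₂)
          (by rw [h2, h.proj_snd, hz₁]) (by rw [h.proj_snd, h.proj_snd, hz₁, hz₂]),
          mul_mul_mul_comm, inv_mul_cancel_left]
      filter_upwards [hσ, hτ] with x h1 h2 z₁ z₂ hz₁ hz₂
      exact hg h1.2 h2.2 z₁ z₂ hz₁ hz₂ },
    p, q, A.toBundleZeroGerbe.isProductVia_product B.toBundleZeroGerbe h, fun z => rfl⟩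

theorem isIsomorphism_refl (A : ConnectiveZeroGerbe n M) :
    A.IsIsomorphism A (Diffeomorph.refl _ _ _) := ⟨A.toBundleZeroGerbe.isIsomorphism_refl, fun y =>
  ((congrArg (A.conn y).comp (mfderiv_id (I := 𝓡 A.dim))).trans
    (ContinuousLinearMap.comp_id _)).symm⟩

/-- `A ⊗ (B* ⊗ B) = B ⊗ (A ⊗ B*)`. -/
theorem IsProduct.exchange {A B C T D : ConnectiveZeroGerbe n M} (hD : A.IsProduct B.dual D)
    (hT : B.dual.IsProduct B T) (hC : A.IsProduct T C) : B.IsProduct D C := by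
  obtain ⟨a, t, ⟨hC, hCg⟩, hCc⟩ := hC
  obtain ⟨b, b', ⟨hT, hTg⟩, hTc⟩ := hT
  obtain ⟨a₁, b₁, ⟨hD, hDg⟩, hDc⟩ := hD
  obtain ⟨m, hm, ha, hb⟩ := hC.exchange hT hD
  refine ⟨b' ∘ t, m, ⟨hm, fun z₁ z₂ h => ?_⟩, fun z => ?_⟩
  · rw [hCg z₁ z₂ h, hTg _ _ ((hC.proj_snd z₁).trans (h.trans (hC.proj_snd z₂).symm)),
      hDg _ _ ((hm.proj_snd z₁).trans (h.trans (hm.proj_snd z₂).symm)), ha, ha, hb, hb]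
    change _ * (_ * B.g (b' (t z₁), b' (t z₂))) = B.g (b' (t z₁), b' (t z₂)) * _
    rw [← mul_assoc, mul_comm]
  · have e₁ : T.conn = fun z => formPullback T.dim B.dual.dim b B.dual.conn z +
      formPullback T.dim B.dim b' B.conn z := funext hTc
    have e₂ : D.conn = fun z => formPullback D.dim A.dim a₁ A.conn z +
      formPullback D.dim B.dual.dim b₁ B.dual.conn z := funext hDc
    have ea : a₁ ∘ m = a := funext ha
    have eb : b₁ ∘ m = b ∘ t := funext hb
    have h₁ : formPullback C.dim T.dim t T.conn z =
        formPullback C.dim B.dual.dim (b ∘ t) B.dual.conn z +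
          formPullback C.dim B.dim (b' ∘ t) B.conn z := by
      rw [formPullback_comp B.dual.conn (hC.contMDiff_snd z) (hT.contMDiff_fst _),
        formPullback_comp B.conn (hC.contMDiff_snd z) (hT.contMDiff_snd _), e₁]
      exact ContinuousLinearMap.add_comp _ _ _
    have h₂ : formPullback C.dim D.dim m D.conn z =
        formPullback C.dim A.dim a A.conn z +
          formPullback C.dim B.dual.dim (b ∘ t) B.dual.conn z := by
      rw [← ea, ← eb, formPullback_comp A.conn (hm.contMDiff_snd z) (hD.contMDiff_fst _),
        formPullback_comp B.dual.conn (hm.contMDiff_snd z) (hD.contMDiff_snd _), e₂]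
      exact ContinuousLinearMap.add_comp _ _ _
    have h₃ : C.conn z = formPullback C.dim A.dim a A.conn z +
      formPullback C.dim T.dim t T.conn z := hCc z
    change _ = formPullback C.dim B.dim (b' ∘ t) B.conn z + formPullback C.dim D.dim m D.conn z
    rw [h₃, h₁, h₂, ← add_assoc, add_comm]

/-- If `A ⊗ B*` and `B* ⊗ B` are `D`-trivial, then `A` and `B` are both related to `A ⊗ (B* ⊗ B)`.
-/
theorem dStableIso_exchange {A B C T D : ConnectiveZeroGerbe n M} (hD : A.IsProduct B.dual D)
    (hDt : D.IsDTrivial) (hT : B.dual.IsProduct B T) (hTt : T.IsDTrivial) (hC : A.IsProduct T C) :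
    DStableIso C A ∧ DStableIso C B :=
  ⟨⟨T, C, hTt, hC, _, C.isIsomorphism_refl⟩,
    ⟨D, C, hDt, hD.exchange hT hC, _, C.isIsomorphism_refl⟩⟩

end ConnectiveZeroGerbe

/-! ### The principal bundle of a cocycle -/

section LocalModel

variable {E : Type*} [NormedAddCommGroup E] [NormedSpace ℝ E] [FiniteDimensional ℝ E]
  {E' H' N : Type*} [NormedAddCommGroup E'] [NormedSpace ℝ E'] [TopologicalSpace H']
  {I : ModelWithCorners ℝ E' H'} [TopologicalSpace N] [ChartedSpace H' N]

/-- A space that is locally identified with open subsets of a manifold `N`, with smooth transition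
functions, is a manifold. Here `C` is a set of smooth charts that covers `N`. -/
theorem exists_chartedSpace_of_contMDiffOn {d : ℕ} (hd : Module.finrank ℝ E = d) {X : Type*}
    [TopologicalSpace X] (C : Set (OpenPartialHomeomorph N E)) (hC : ∀ x, ∃ c ∈ C, x ∈ c.source)
    (hCs : ∀ c ∈ C, ContMDiffOn I 𝓘(ℝ, E) ∞ c c.source ∧
      ContMDiffOn 𝓘(ℝ, E) I ∞ c.symm c.target)
    (A : Set (OpenPartialHomeomorph X N)) (hcov : ∀ x, ∃ e ∈ A, x ∈ e.source)
    (hA : ∀ e ∈ A, ∀ e' ∈ A, ContMDiffOn I I ∞ (e.symm ≫ₕ e') (e.symm ≫ₕ e').source) :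
    ∃ _ : ChartedSpace (EuclideanSpace ℝ (Fin d)) X, IsManifold (𝓡 d) ∞ X ∧
      ∀ e ∈ A, ContMDiffOn (𝓡 d) I ∞ e e.source ∧ ContMDiffOn I (𝓡 d) ∞ e.symm e.target := by
  obtain ⟨cs, hX, h⟩ := exists_chartedSpace_of_contDiffOn hd
    {k : OpenPartialHomeomorph X E | ∃ e ∈ A, ∃ c ∈ C, k = e ≫ₕ c}
    (fun x => by
      obtain ⟨e, he, hx⟩ := hcov x
      obtain ⟨c, hc, hx'⟩ := hC (e x)
      exact ⟨_, ⟨e, he, c, hc, rfl⟩, by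
        rw [OpenPartialHomeomorph.trans_source]
        exact ⟨hx, hx'⟩⟩)
    (by
      rintro _ ⟨e, he, c, hc, rfl⟩ _ ⟨e', he', c', hc', rfl⟩
      rw [← contMDiffOn_iff_contDiffOn]
      have hsub : ∀ u ∈ ((e ≫ₕ c).symm ≫ₕ (e' ≫ₕ c')).source, u ∈ c.target ∧
          c.symm u ∈ (e.symm ≫ₕ e').source ∧ e' (e.symm (c.symm u)) ∈ c'.source := fun u hu => by
        rw [OpenPartialHomeomorph.trans_source, OpenPartialHomeomorph.symm_source,
          OpenPartialHomeomorph.trans_target, OpenPartialHomeomorph.trans_source] at hu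
        refine ⟨hu.1.1, ?_, hu.2.2⟩
        rw [OpenPartialHomeomorph.trans_source]
        exact ⟨hu.1.2, hu.2.1⟩
      exact (hCs c' hc').1.comp ((hA e he e' he').comp ((hCs c hc).2.mono fun u hu => (hsub u hu).1)
        fun u hu => (hsub u hu).2.1) fun u hu => (hsub u hu).2.2)
  refine ⟨cs, hX, fun e he => ⟨fun x hx => ?_, fun y hy => ?_⟩⟩
  · obtain ⟨c, hc, hx'⟩ := hC (e x)
    have hmem : x ∈ (e ≫ₕ c).source := by
      rw [OpenPartialHomeomorph.trans_source]
      exact ⟨hx, hx'⟩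
    have h1 := (h _ ⟨e, he, c, hc, rfl⟩).1.contMDiffAt ((e ≫ₕ c).open_source.mem_nhds hmem)
    have h2 := (hCs c hc).2.contMDiffAt (c.open_target.mem_nhds (c.map_source hx'))
    refine ((h2.comp x h1).congr_of_eventuallyEq ?_).contMDiffWithinAt
    filter_upwards [(e ≫ₕ c).open_source.mem_nhds hmem] with z hz
    rw [OpenPartialHomeomorph.trans_source] at hz
    exact (c.left_inv hz.2).symm
  · obtain ⟨c, hc, hy'⟩ := hC y
    have hmem : c y ∈ (e ≫ₕ c).target := by
      rw [OpenPartialHomeomorph.trans_target]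
      exact ⟨c.map_source hy', show c.symm (c y) ∈ e.target by rwa [c.left_inv hy']⟩
    have h1 := (hCs c hc).1.contMDiffAt (c.open_source.mem_nhds hy')
    have h2 := (h _ ⟨e, he, c, hc, rfl⟩).2.contMDiffAt ((e ≫ₕ c).open_target.mem_nhds hmem)
    refine ((h2.comp y h1).congr_of_eventuallyEq ?_).contMDiffWithinAt
    filter_upwards [c.open_source.mem_nhds hy'] with z hz
    exact congrArg e.symm (c.left_inv hz).symm

end LocalModel

section Topology

variable {F B X : Type*} [TopologicalSpace F] [TopologicalSpace B] [TopologicalSpace X] {π : X → B}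

theorem t2Space_of_trivialization [T2Space F] [T2Space B] (hπ : Continuous π)
    (h : ∀ x : B, ∃ e : Bundle.Trivialization F π, x ∈ e.baseSet) : T2Space X := by
  refine ⟨fun p p' hp => ?_⟩
  by_cases hx : π p = π p'
  · obtain ⟨e, he⟩ := h (π p)
    have h1 : p ∈ e.source := e.mem_source.2 he
    have h2 : p' ∈ e.source := e.mem_source.2 (hx ▸ he)
    obtain ⟨U, V, hU, hV, hpU, hpV, hd⟩ := t2_separation fun h' => hp (e.injOn h1 h2 h')
    refine ⟨e.source ∩ e ⁻¹' U, e.source ∩ e ⁻¹' V, e.toOpenPartialHomeomorph.isOpen_inter_preimage hU,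
      e.toOpenPartialHomeomorph.isOpen_inter_preimage hV, ⟨h1, hpU⟩, ⟨h2, hpV⟩, ?_⟩
    exact (hd.preimage e).mono Set.inter_subset_right Set.inter_subset_right
  · obtain ⟨U, V, hU, hV, hpU, hpV, hd⟩ := t2_separation hx
    exact ⟨_, _, hU.preimage hπ, hV.preimage hπ, hpU, hpV, hd.preimage π⟩

/-- A bundle with compact fibres is proper over its base. -/
theorem isCompact_preimage_of_trivialization [CompactSpace F] [T2Space B] [LocallyCompactSpace B]
    (h : ∀ x : B, ∃ e : Bundle.Trivialization F π, x ∈ e.baseSet) {K : Set B} (hK : IsCompact K) :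
    IsCompact (π ⁻¹' K) := by
  refine hK.induction_on (p := fun s => ∃ t, s ⊆ t ∧ IsCompact (π ⁻¹' (K ∩ t))) ?_ ?_ ?_ ?_ |>.elim
    fun t ht => ?_
  · exact ⟨∅, subset_rfl, by simp⟩
  · rintro s s' hs ⟨t, ht, h'⟩
    exact ⟨t, hs.trans ht, h'⟩
  · rintro s s' ⟨t, ht, h1⟩ ⟨t', ht', h2⟩
    refine ⟨t ∪ t', Set.union_subset_union ht ht', ?_⟩
    rw [Set.inter_union_distrib_left, Set.preimage_union]
    exact h1.union h2
  · intro x hx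
    obtain ⟨e, he⟩ := h x
    obtain ⟨N, hN, hNe, hNc⟩ := local_compact_nhds (e.open_baseSet.mem_nhds he)
    refine ⟨N, mem_nhdsWithin_of_mem_nhds hN, N, subset_rfl, ?_⟩
    have h1 : IsCompact ((K ∩ N) ×ˢ (Set.univ : Set F)) := (hK.inter hNc).prod isCompact_univ
    have h2 : (K ∩ N) ×ˢ (Set.univ : Set F) ⊆ e.target := fun p hp =>
      e.mem_target.2 (hNe hp.1.2)
    have h3 := h1.image_of_continuousOn (e.toOpenPartialHomeomorph.continuousOn_symm.mono h2)
    convert h3 using 1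
    ext p
    constructor
    · intro hp
      have hps : p ∈ e.source := e.mem_source.2 (hNe hp.2)
      exact ⟨e p, ⟨by rw [e.coe_fst hps]; exact hp, trivial⟩,
        e.toOpenPartialHomeomorph.left_inv hps⟩
    · rintro ⟨y, hy, rfl⟩
      change π (e.toOpenPartialHomeomorph.symm y) ∈ K ∩ N
      rw [e.proj_symm_apply (h2 hy)]
      exact hy.1
  · have e : K ∩ t = K := Set.inter_eq_left.2 ht.1
    rw [← e]
    exact ht.2

/-- The total space of a bundle with compact fibres is paracompact, because the projection is
proper. -/
theorem paracompactSpace_of_trivialization {B : Type u} [TopologicalSpace B] {π : X → B}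
    [CompactSpace F] [T2Space B] [LocallyCompactSpace B] [ParacompactSpace B] [T2Space X]
    [LocallyCompactSpace X] (hπ : Continuous π)
    (h : ∀ x : B, ∃ e : Bundle.Trivialization F π, x ∈ e.baseSet) : ParacompactSpace X := by
  obtain ⟨ι, p, hp, hσ⟩ := exists_isLocallyConstant_isSigmaCompact B
  refine ParacompactSpace.of_isLocallyConstant (hp.comp_continuous hπ) fun i => ?_
  obtain ⟨K, hK, hKi⟩ := hσ i
  refine ⟨fun k => π ⁻¹' K k, fun k => isCompact_preimage_of_trivialization h (hK k), ?_⟩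
  rw [← Set.preimage_iUnion, hKi]
  rfl

end Topology

section Cocycle

variable (n : ℕ) (M : Type u) [TopologicalSpace M] [ChartedSpace (EuclideanSpace ℝ (Fin n)) M]

/-- Circle-valued functions `f i`, for `i` in `M`, such that `(f i)⁻¹ * f j` is smooth on the
intersection of neighbourhoods of `i` and `j`. These quotients form a cocycle. -/
structure CircleCocycle where
  baseSet : M → Set M
  isOpen_baseSet : ∀ i, IsOpen (baseSet i)
  mem_baseSet : ∀ i, i ∈ baseSet i
  f : M → M → Circle
  contMDiffAt : ∀ {i j x}, x ∈ baseSet i → x ∈ baseSet j →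
    ContMDiffAt (𝓡 n) (𝓡 1) ∞ (fun y => (f i y)⁻¹ * f j y) x

namespace CircleCocycle

variable {n M} (Z : CircleCocycle n M)

theorem contMDiffOn_coordChange (i j : M) : ContMDiffOn ((𝓡 n).prod (𝓡 1)) ((𝓡 n).prod (𝓡 1)) ∞
    (fun p : M × Circle => (p.1, (Z.f j p.1)⁻¹ * Z.f i p.1 * p.2))
    ((Z.baseSet i ∩ Z.baseSet j) ×ˢ Set.univ) := fun p hp =>
  (contMDiffAt_fst.prodMk (((Z.contMDiffAt hp.1.2 hp.1.1).comp p
    contMDiffAt_fst).mul contMDiffAt_snd)).contMDiffWithinAt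

/-- The fibre bundle with these transition functions. A point in the fibre over `x` is given by its
coordinate with respect to the index `x`. -/
def core : FiberBundleCore M M Circle where
  baseSet := Z.baseSet
  isOpen_baseSet := Z.isOpen_baseSet
  indexAt := id
  mem_baseSet_at := Z.mem_baseSet
  coordChange i j x z := (Z.f j x)⁻¹ * Z.f i x * z
  coordChange_self i x _ z := by rw [inv_mul_cancel, one_mul]
  continuousOn_coordChange i j := (Z.contMDiffOn_coordChange i j).continuousOn.snd
  coordChange_comp i j k x _ z := by group

/-- The total space of the bundle. -/
abbrev Total : Type u := Z.core.TotalSpace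

/-- The coordinate of a point with respect to its own base point. -/
def coord (p : Z.Total) : Circle := p.2

/-- The function on the total space that is `f i` times the coordinate with respect to `i`. -/
def potential (p : Z.Total) : Circle := Z.f p.1 p.1 * Z.coord p

theorem localTriv_apply (i : M) (p : Z.Total) :
    Z.core.localTriv i p = (p.1, (Z.f i p.1)⁻¹ * Z.potential p) := by
  rw [Z.core.localTriv_apply, potential, ← mul_assoc]
  rfl

theorem mem_source {i : M} {p : Z.Total} : p ∈ (Z.core.localTriv i).source ↔ p.1 ∈ Z.baseSet i :=
  Z.core.mem_localTriv_source i p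

/-- The circle acts by multiplication on the coordinate. -/
instance : MulAction Circle Z.Total where
  smul c p := ⟨p.1, c * Z.coord p⟩
  one_smul p := congrArg (Bundle.TotalSpace.mk p.1) (one_mul (Z.coord p))
  mul_smul c c' p := congrArg (Bundle.TotalSpace.mk p.1) (mul_assoc c c' (Z.coord p))

theorem smul_proj (c : Circle) (p : Z.Total) : (c • p).1 = p.1 := rfl

theorem potential_smul (c : Circle) (p : Z.Total) : Z.potential (c • p) = c * Z.potential p :=
  mul_left_comm _ _ _

theorem localTriv_smul (i : M) (c : Circle) (p : Z.Total) :
    Z.core.localTriv i (c • p) = (p.1, c * (Z.core.localTriv i p).2) := by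
  rw [localTriv_apply, localTriv_apply, potential_smul, smul_proj, mul_left_comm]

theorem exists_mem_baseSet (x : M) : ∃ e : Bundle.Trivialization Circle Z.core.proj,
    x ∈ e.baseSet :=
  ⟨Z.core.localTriv x, Z.mem_baseSet x⟩

/-- The total space is a manifold, in such a way that the local trivialisations are smooth. -/
theorem exists_chartedSpace [IsManifold (𝓡 n) ∞ M] :
    ∃ _ : ChartedSpace (EuclideanSpace ℝ (Fin (n + 1))) Z.Total, IsManifold (𝓡 (n + 1)) ∞ Z.Total ∧
      ∀ i, ContMDiffOn (𝓡 (n + 1)) ((𝓡 n).prod (𝓡 1)) ∞ (Z.core.localTriv i)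
          (Z.core.localTriv i).source ∧
        ContMDiffOn ((𝓡 n).prod (𝓡 1)) (𝓡 (n + 1)) ∞
          (Z.core.localTriv i).toOpenPartialHomeomorph.symm (Z.core.localTriv i).target := by
  obtain ⟨cs, hX, h⟩ := exists_chartedSpace_of_contMDiffOn (I := (𝓡 n).prod (𝓡 1))
    (E := EuclideanSpace ℝ (Fin n) × EuclideanSpace ℝ (Fin 1)) (d := n + 1) (X := Z.Total)
    (by simp only [Module.finrank_prod, finrank_euclideanSpace_fin])
    {c : OpenPartialHomeomorph (M × Circle)
      (EuclideanSpace ℝ (Fin n) × EuclideanSpace ℝ (Fin 1)) | ∃ (x : M) (z : Circle),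
      c = (chartAt (EuclideanSpace ℝ (Fin n)) x).prod (chartAt (EuclideanSpace ℝ (Fin 1)) z)}
    (fun p => ⟨_, ⟨p.1, p.2, rfl⟩, mem_chart_source _ p.1, mem_chart_source _ p.2⟩)
    (by
      rintro _ ⟨x, z, rfl⟩
      have h1 : ContMDiffOn (𝓡 n) (𝓡 n) ∞ _ (chartAt (EuclideanSpace ℝ (Fin n)) x).source :=
        contMDiffOn_chart
      have h2 : ContMDiffOn (𝓡 1) (𝓡 1) ∞ _ (chartAt (EuclideanSpace ℝ (Fin 1)) z).source :=
        contMDiffOn_chart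
      have h3 : ContMDiffOn (𝓡 n) (𝓡 n) ∞ _ (chartAt (EuclideanSpace ℝ (Fin n)) x).target :=
        contMDiffOn_chart_symm
      have h4 : ContMDiffOn (𝓡 1) (𝓡 1) ∞ _ (chartAt (EuclideanSpace ℝ (Fin 1)) z).target :=
        contMDiffOn_chart_symm
      refine ⟨(h1.comp contMDiffOn_fst fun p hp => hp.1).prodMk_space
        (h2.comp contMDiffOn_snd fun p hp => hp.2), ?_⟩
      exact (h3.comp contDiff_fst.contMDiff.contMDiffOn fun p hp => hp.1).prodMk
        (h4.comp contDiff_snd.contMDiff.contMDiffOn fun p hp => hp.2))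
    {e | ∃ i, e = (Z.core.localTriv i).toOpenPartialHomeomorph}
    (fun p => ⟨_, ⟨p.1, rfl⟩, Z.mem_source.2 (Z.mem_baseSet _)⟩)
    (by
      rintro _ ⟨i, rfl⟩ _ ⟨j, rfl⟩
      have hs : ∀ p ∈ ((Z.core.localTriv i).toOpenPartialHomeomorph.symm ≫ₕ
          (Z.core.localTriv j).toOpenPartialHomeomorph).source,
          p ∈ (Z.baseSet i ∩ Z.baseSet j) ×ˢ (Set.univ : Set Circle) := fun p hp => by
        rw [OpenPartialHomeomorph.trans_source] at hp
        exact ⟨⟨(Z.core.mem_localTriv_target i p).1 hp.1, Z.mem_source.1 hp.2⟩, trivial⟩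
      refine ((Z.contMDiffOn_coordChange i j).mono hs).congr fun p hp => ?_
      obtain ⟨⟨hi, hj⟩, -⟩ := hs p hp
      have h1 : p ∈ (Z.core.localTriv i).target := (Z.core.mem_localTriv_target i p).2 hi
      have h2 := (Z.core.localTriv i).toOpenPartialHomeomorph.right_inv h1
      set r := (Z.core.localTriv i).toOpenPartialHomeomorph.symm p with hr
      have h3 : (r.1, (Z.f i r.1)⁻¹ * Z.potential r) = p := (Z.localTriv_apply i r).symm.trans h2
      refine (Z.localTriv_apply j r).trans ?_
      rw [← h3]
      refine Prod.ext rfl ?_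
      change _ = (Z.f j r.1)⁻¹ * Z.f i r.1 * ((Z.f i r.1)⁻¹ * Z.potential r)
      rw [mul_assoc, mul_inv_cancel_left])
  exact ⟨cs, hX, fun i => h _ ⟨i, rfl⟩⟩

/-- The principal bundle of a cocycle, with an equivariant function that induces the cocycle. -/
theorem exists_principalCircleBundle [IsManifold (𝓡 n) ∞ M] [T2Space M] [ParacompactSpace M] :
    ∃ (P : PrincipalCircleBundle n M) (h : P.Total → Circle),
      (∀ (c : Circle) p, h (c • p) = c * h p) ∧ ∀ i p, P.proj p ∈ Z.baseSet i →
        ContMDiffAt (𝓡 P.dim) (𝓡 1) ∞ (fun p => (Z.f i (P.proj p))⁻¹ * h p) p := by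
  obtain ⟨cs, hX, hs⟩ := Z.exists_chartedSpace
  have : T2Space Z.Total := t2Space_of_trivialization Z.core.continuous_proj Z.exists_mem_baseSet
  have := Manifold.locallyCompact_of_finiteDimensional (M := Z.Total) (𝓡 (n + 1))
  have := Manifold.locallyCompact_of_finiteDimensional (M := M) (𝓡 n)
  have : ParacompactSpace Z.Total :=
    paracompactSpace_of_trivialization Z.core.continuous_proj Z.exists_mem_baseSet
  have htriv : ∀ i (p : Z.Total), p.1 ∈ Z.baseSet i →
      ContMDiffAt (𝓡 (n + 1)) ((𝓡 n).prod (𝓡 1)) ∞ (Z.core.localTriv i) p := fun i p hp =>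
    (hs i).1.contMDiffAt
      ((Z.core.localTriv i).toOpenPartialHomeomorph.open_source.mem_nhds (Z.mem_source.2 hp))
  have hproj : ContMDiff (𝓡 (n + 1)) (𝓡 n) ∞ Z.core.proj := fun p => by
    refine (contMDiffAt_fst.comp p (htriv p.1 p (Z.mem_baseSet _))).congr_of_eventuallyEq ?_
    exact Filter.Eventually.of_forall fun p' => by
      rw [Function.comp, Z.localTriv_apply]
  refine ⟨{
    dim := n + 1
    Total := Z.Total
    proj := Z.core.proj
    contMDiff_proj := hproj
    contMDiff_smul := fun x => by
      let e := Z.core.localTriv x.2.1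
      have hx : x.2 ∈ e.source := Z.mem_source.2 (Z.mem_baseSet _)
      have h1 : ContMDiffAt ((𝓡 1).prod (𝓡 (n + 1))) ((𝓡 n).prod (𝓡 1)) ∞
          (fun y : Circle × Z.Total => e y.2) x :=
        (htriv x.2.1 x.2 (Z.mem_baseSet _)).comp x contMDiffAt_snd
      have h2 : ContMDiffAt ((𝓡 1).prod (𝓡 (n + 1))) ((𝓡 n).prod (𝓡 1)) ∞
          (fun y : Circle × Z.Total => ((e y.2).1, y.1 * (e y.2).2)) x :=
        h1.fst.prodMk (contMDiffAt_fst.mul h1.snd)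
      have hmem : ((e x.2).1, x.1 * (e x.2).2) ∈ e.target := by
        rw [e.mem_target, e.coe_fst hx]
        exact Z.mem_baseSet _
      have h3 := ((hs x.2.1).2.contMDiffAt
        (e.toOpenPartialHomeomorph.open_target.mem_nhds hmem)).comp x h2
      refine h3.congr_of_eventuallyEq ?_
      filter_upwards [continuous_snd.continuousAt.eventually
        (e.toOpenPartialHomeomorph.open_source.mem_nhds hx)] with y hy
      have h4 : e (y.1 • y.2) = ((e y.2).1, y.1 * (e y.2).2) := by
        rw [e.coe_fst hy]
        exact Z.localTriv_smul _ _ _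
      have h5 : y.1 • y.2 ∈ e.source := Z.mem_source.2 (Z.mem_source.1 hy)
      exact (e.toOpenPartialHomeomorph.left_inv h5).symm.trans
        (congrArg e.toOpenPartialHomeomorph.symm h4)
    proj_smul := fun c p => rfl
    locally_trivial := fun i => ⟨Z.core.localTriv i, Z.mem_baseSet i, (hs i).1, (hs i).2,
      fun c p _ => congrArg Prod.snd (Z.localTriv_smul i c p)⟩ },
    Z.potential, Z.potential_smul, fun i p hp => ?_⟩
  refine (contMDiffAt_snd.comp p (htriv i p hp)).congr_of_eventuallyEq ?_
  exact Filter.Eventually.of_forall fun p' => by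
    rw [Function.comp, Z.localTriv_apply]

end CircleCocycle

end Cocycle

/-! ### Principal bundles as bundle 0-gerbes -/

namespace PrincipalCircleBundle

variable {n : ℕ} {M : Type u} [TopologicalSpace M] [ChartedSpace (EuclideanSpace ℝ (Fin n)) M]
  [IsManifold (𝓡 n) ∞ M] {P Q R : PrincipalCircleBundle n M}

/-- `h` is equivariant, without a continuity condition. Such functions on `P` correspond to the
sections of `P` that need not be continuous. -/
def IsEquivariant (P : PrincipalCircleBundle n M) (h : P.Total → Circle) : Prop :=
  ∀ (c : Circle) p, h (c • p) = c * h p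

theorem exists_smul_eq {p p' : P.Total} (h : P.proj p = P.proj p') : ∃ c : Circle, c • p = p' := by
  obtain ⟨e, he, -, -, heq⟩ := P.locally_trivial (P.proj p)
  have hp : p ∈ e.source := e.mem_source.2 he
  have hp' : p' ∈ e.source := e.mem_source.2 (h ▸ he)
  let c := (e p').2 * (e p).2⁻¹
  have hc : c • p ∈ e.source := e.mem_source.2 (by rwa [P.proj_smul])
  have h1 : (e (c • p)).1 = (e p').1 := by rw [e.coe_fst hc, e.coe_fst hp', P.proj_smul, h]
  have h2 : (e (c • p)).2 = (e p').2 := by rw [heq c p hp, inv_mul_cancel_right]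
  exact ⟨c, e.injOn hc hp' (Prod.ext h1 h2)⟩

theorem IsEquivariant.smul_eq {h : P.Total → Circle} (hh : P.IsEquivariant h) {p p' : P.Total}
    (hp : P.proj p = P.proj p') : ((h p)⁻¹ * h p') • p = p' := by
  obtain ⟨c, rfl⟩ := exists_smul_eq hp
  rw [hh, mul_comm c, inv_mul_cancel_left]

theorem IsEquivariant.eq_of_eq {h : P.Total → Circle} (hh : P.IsEquivariant h) {p p' : P.Total}
    (hp : P.proj p = P.proj p') (h' : h p = h p') : p = p' := by
  rw [← hh.smul_eq hp, h', inv_mul_cancel, one_smul]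

theorem IsEquivariant.inv_mul_eq {h h' : P.Total → Circle} (hh : P.IsEquivariant h)
    (hh' : P.IsEquivariant h') {p p' : P.Total} (hp : P.proj p = P.proj p') :
    (h p)⁻¹ * h p' = (h' p)⁻¹ * h' p' := by
  obtain ⟨c, rfl⟩ := exists_smul_eq hp
  rw [hh, hh', mul_comm c, inv_mul_cancel_left, mul_comm c, inv_mul_cancel_left]

theorem exists_isEquivariant (P : PrincipalCircleBundle n M) : ∃ h, P.IsEquivariant h := by
  choose e he _ _ heq using P.locally_trivial
  refine ⟨fun p => (e (P.proj p) p).2, fun c p => ?_⟩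
  beta_reduce
  rw [P.proj_smul]
  exact heq _ c p ((e _).mem_source.2 (he _))

/-- A smooth equivariant function over a neighbourhood of a point. -/
theorem exists_contMDiffAt_isEquivariant (P : PrincipalCircleBundle n M) (x : M) :
    ∃ w : P.Total → Circle, P.IsEquivariant w ∧
      ∀ᶠ y in nhds x, ∀ p, P.proj p = y → ContMDiffAt (𝓡 P.dim) (𝓡 1) ∞ w p := by
  obtain ⟨e, he, hs, -, heq⟩ := P.locally_trivial x
  obtain ⟨h, hh⟩ := P.exists_isEquivariant
  classical
  refine ⟨fun p => if P.proj p ∈ e.baseSet then (e p).2 else h p, fun c p => ?_, ?_⟩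
  · beta_reduce
    rw [P.proj_smul]
    split_ifs with hp
    · exact heq c p (e.mem_source.2 hp)
    · exact hh c p
  · filter_upwards [e.open_baseSet.mem_nhds he] with y hy p hp
    have hp' : p ∈ e.source := e.mem_source.2 (hp ▸ hy)
    have hn := e.toOpenPartialHomeomorph.open_source.mem_nhds hp'
    refine (contMDiffAt_snd.comp p (hs.contMDiffAt hn)).congr_of_eventuallyEq ?_
    filter_upwards [hn] with p' hp'
    exact if_pos (e.mem_source.1 hp')

/-- Local sections through a given point, which show that the projection is a submersion. -/
theorem exists_section (P : PrincipalCircleBundle n M) (p : P.Total) : ∃ σ : M → P.Total,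
    (∀ᶠ x in nhds (P.proj p), ContMDiffAt (𝓡 n) (𝓡 P.dim) ∞ σ x ∧ P.proj (σ x) = x) ∧
      σ (P.proj p) = p := by
  obtain ⟨e, he, -, hs, -⟩ := P.locally_trivial (P.proj p)
  have hp : p ∈ e.source := e.mem_source.2 he
  refine ⟨fun x => e.toOpenPartialHomeomorph.symm (x, (e p).2), ?_, ?_⟩
  · filter_upwards [e.open_baseSet.mem_nhds he] with x hx
    have hx' : (x, (e p).2) ∈ e.target := e.mem_target.2 hx
    refine ⟨?_, e.proj_symm_apply hx'⟩
    exact (hs.contMDiffAt (e.toOpenPartialHomeomorph.open_target.mem_nhds hx')).comp x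
      (contMDiffAt_id.prodMk contMDiffAt_const)
  · have h1 : e p = (P.proj p, (e p).2) := Prod.ext (e.coe_fst hp) rfl
    exact (congrArg e.toOpenPartialHomeomorph.symm h1.symm).trans
      (e.toOpenPartialHomeomorph.left_inv hp)

theorem surjective_proj (P : PrincipalCircleBundle n M) : Function.Surjective P.proj := fun x => by
  obtain ⟨e, he, -⟩ := P.locally_trivial x
  exact ⟨_, e.proj_symm_apply (x := (x, 1)) (e.mem_target.2 he)⟩

/-- The quotient does not depend on the equivariant function, and there are smooth ones locally. -/
theorem IsEquivariant.contMDiffOn_inv_mul {h : P.Total → Circle} (hh : P.IsEquivariant h) :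
    ContMDiffOn ((𝓡 P.dim).prod (𝓡 P.dim)) (𝓡 1) ∞
      (fun x : P.Total × P.Total => (h x.1)⁻¹ * h x.2) {x | P.proj x.1 = P.proj x.2} := by
  rintro ⟨p, p'⟩ hp
  have hp : P.proj p = P.proj p' := hp
  obtain ⟨w, hw, hws⟩ := P.exists_contMDiffAt_isEquivariant (P.proj p)
  have h1 := hws.self_of_nhds p rfl
  have h2 := hws.self_of_nhds p' hp.symm
  have h3 : ContMDiffAt ((𝓡 P.dim).prod (𝓡 P.dim)) (𝓡 1) ∞
      (fun x : P.Total × P.Total => (w x.1)⁻¹ * w x.2) (p, p') :=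
    (h1.comp (p, p') contMDiffAt_fst).inv.mul (h2.comp (p, p') contMDiffAt_snd)
  exact h3.contMDiffWithinAt.congr (fun x hx => hh.inv_mul_eq hw hx) (hh.inv_mul_eq hw hp)

/-- The submersion underlying a principal bundle. -/
def toSubmersionOnto (P : PrincipalCircleBundle n M) : SubmersionOnto n M where
  dim := P.dim
  Total := P.Total
  proj := P.proj
  contMDiff_proj := P.contMDiff_proj
  surjective_proj := P.surjective_proj
  surjective_mfderiv p := by
    obtain ⟨σ, hσ, hp⟩ := P.exists_section p
    refine surjective_mfderiv_of_eventually_rightInverse hp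
      ((P.contMDiff_proj p).mdifferentiableAt (by simp))
      (hσ.self_of_nhds.1.mdifferentiableAt (by simp)) ?_
    filter_upwards [hσ] with x hx
    exact hx.2

/-- The bundle 0-gerbe of a principal bundle `P`: the value of `g` at `(p, p')` is the element `c`
of the circle with `c • p = p'`, written in terms of an equivariant function on `P`. -/
def gerbe (P : PrincipalCircleBundle n M) (h : P.Total → Circle) (hh : P.IsEquivariant h) :
    BundleZeroGerbe n M where
  toSubmersionOnto := P.toSubmersionOnto
  g x := (h x.1)⁻¹ * h x.2
  contMDiffOn_g := hh.contMDiffOn_inv_mul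
  cocycle p₁ p₂ p₃ _ _ := by
    rw [mul_assoc, mul_inv_cancel_left]

/-- All equivariant functions are potentials of the bundle 0-gerbe, which does not depend on `h`. -/
theorem isPotential_gerbe {h h' : P.Total → Circle} (hh : P.IsEquivariant h)
    (hh' : P.IsEquivariant h') : (P.gerbe h hh).IsPotential h' :=
  fun _ _ e => hh.inv_mul_eq hh' e

/-- The class of a principal bundle, in terms of an equivariant function and local sections. -/
def Represents (P : PrincipalCircleBundle n M) (q : CircleClass n M) : Prop :=
  ∃ h, P.IsEquivariant h ∧
    ∀ x σ, P.toSubmersionOnto.IsLocalSection σ x → IsCircleGerm q x (h ∘ σ)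

theorem Represents.gerbe {q : CircleClass n M} (hq : P.Represents q) {h : P.Total → Circle}
    (hh : P.IsEquivariant h) : (P.gerbe h hh).Represents q := by
  obtain ⟨f, hf, hq⟩ := hq
  exact ⟨f, isPotential_gerbe hh hf, hq⟩

theorem exists_represents (P : PrincipalCircleBundle n M) : ∃ q, P.Represents q := by
  obtain ⟨h, hh⟩ := P.exists_isEquivariant
  obtain ⟨q, hq⟩ := (isPotential_gerbe hh hh).exists_isCircleGerm
  exact ⟨q, h, hh, hq⟩

theorem Represents.sub_mem {q q' : CircleClass n M} (h : P.Represents q) (h' : P.Represents q') :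
    q - q' ∈ trivialCircleClasses n M := by
  obtain ⟨f, hf⟩ := P.exists_isEquivariant
  exact (h.gerbe hf).sub_mem (h'.gerbe hf)

theorem Iso.represents (h : P.Iso Q) {q : CircleClass n M} (hq : Q.Represents q) :
    P.Represents q := by
  obtain ⟨φ, hφ, hφ'⟩ := h
  obtain ⟨f, hf, hq⟩ := hq
  refine ⟨f ∘ φ, fun c p => ?_, fun x σ hσ => hq x _
    (hσ.comp (Y := P.toSubmersionOnto) (Z := Q.toSubmersionOnto) φ.contMDiff hφ)⟩
  rw [Function.comp, hφ', hf]
  rfl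

/-- Every class is that of the principal bundle with the transition functions `(f i)⁻¹ * f j`, where
`f i` represents the class near `i`. -/
theorem exists_principalCircleBundle_represents [T2Space M] [ParacompactSpace M]
    (q : CircleClass n M) : ∃ P : PrincipalCircleBundle n M, P.Represents q := by
  choose f hf using exists_isCircleGerm q
  choose U hU hUo hmem using fun i => eventually_nhds_iff.1 (hf i)
  obtain ⟨P, h, hh, hs⟩ := CircleCocycle.exists_principalCircleBundle
    ⟨U, hUo, hmem, f, fun {i j x} hi hj => (hU i x hi).iff.1 (hU j x hj)⟩
  refine ⟨P, h, hh, fun x σ hσ => (hU x x (hmem x)).iff.2 ?_⟩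
  have h1 : P.proj (σ x) = x := hσ.proj_eq
  have h2 := (hs x (σ x) (h1.symm ▸ hmem x)).comp x hσ.contMDiffAt
  refine h2.congr_of_eventuallyEq ?_
  filter_upwards [hσ] with y hy
  have h3 : P.proj (σ y) = y := hy.2
  simp only [Function.comp]
  rw [h3]

/-- A map to a principal bundle is smooth if it is smooth on the base, and in terms of an
equivariant function and local sections. -/
theorem IsEquivariant.contMDiffWithinAt {h : P.Total → Circle} (hh : P.IsEquivariant h)
    {E H X : Type*} [NormedAddCommGroup E] [NormedSpace ℝ E] [TopologicalSpace H]
    {I : ModelWithCorners ℝ E H} [TopologicalSpace X] [ChartedSpace H X] {r : X → P.Total}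
    {s : Set X} {x : X} {b : X → M} {w : X → Circle} {τ : M → P.Total}
    (hb : ContMDiffAt I (𝓡 n) ∞ b x) (hr : ∀ y ∈ s, P.proj (r y) = b y)
    (hτ : P.toSubmersionOnto.IsLocalSection τ (b x)) (hw : ContMDiffAt I (𝓡 1) ∞ w x)
    (hw' : ∀ᶠ y in nhdsWithin x s, h (r y) = h (τ (b y)) * w y) (hx : x ∈ s) :
    ContMDiffWithinAt I (𝓡 P.dim) ∞ r s x := by
  have h1 : ContMDiffAt I (𝓡 P.dim) ∞ (fun y => w y • τ (b y)) x :=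
    (P.contMDiff_smul _).comp x (hw.prodMk (hτ.contMDiffAt.comp x hb))
  have h2 : ∀ᶠ y in nhdsWithin x s, r y = w y • τ (b y) := by
    filter_upwards [hw', mem_nhdsWithin_of_mem_nhds (hb.continuousAt.eventually hτ),
      self_mem_nhdsWithin] with y hy hτy hys
    have h3 : P.proj (τ (b y)) = b y := hτy.2
    refine hh.eq_of_eq ?_ ?_
    · rw [P.proj_smul, hr y hys, h3]
    · rw [hh, hy, mul_comm]
  exact h1.contMDiffWithinAt.congr_of_eventuallyEq h2 (h2.self_of_nhdsWithin hx)

/-- The points of the fibre over `x` are in bijection with the values `z` of an equivariant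
function. -/
theorem IsEquivariant.exists_point {h : P.Total → Circle} (hh : P.IsEquivariant h) :
    ∃ s : M → Circle → P.Total, ∀ x z, P.proj (s x z) = x ∧ h (s x z) = z := by
  obtain ⟨t, ht⟩ := P.surjective_proj.hasRightInverse
  refine ⟨fun x z => (z * (h (t x))⁻¹) • t x, fun x z => ⟨?_, ?_⟩⟩
  · rw [P.proj_smul]
    exact ht x
  · rw [hh, inv_mul_cancel_right]

theorem IsEquivariant.contMDiffAt_section {h : P.Total → Circle} (hh : P.IsEquivariant h)
    {σ : M → P.Total} {p : P.Total} (hσ : P.toSubmersionOnto.IsLocalSection σ (P.proj p)) :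
    ContMDiffAt (𝓡 P.dim) (𝓡 1) ∞ (fun p => (h (σ (P.proj p)))⁻¹ * h p) p := by
  refine (isPotential_gerbe hh hh).contMDiffAt (a := fun p => σ (P.proj p)) (b := id)
    (hσ.contMDiffAt.comp p (P.contMDiff_proj p)) contMDiffAt_id ?_
  filter_upwards [(P.contMDiff_proj.continuous.tendsto p).eventually hσ] with z hz
  exact hz.2

/-- Bundles with the same cocycle are isomorphic, by the map that preserves the equivariant
functions. -/
theorem exists_map {h : P.Total → Circle} {h' : Q.Total → Circle} (hh' : Q.IsEquivariant h')
    (hh : P.IsEquivariant h) {q : CircleClass n M}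
    (hP : ∀ x σ, P.toSubmersionOnto.IsLocalSection σ x → IsCircleGerm q x (h ∘ σ))
    (hQ : ∀ x σ, Q.toSubmersionOnto.IsLocalSection σ x → IsCircleGerm q x (h' ∘ σ)) :
    ∃ φ : P.Total → Q.Total, ContMDiff (𝓡 P.dim) (𝓡 Q.dim) ∞ φ ∧
      ∀ p, Q.proj (φ p) = P.proj p ∧ h' (φ p) = h p := by
  obtain ⟨s, hs⟩ := hh'.exists_point
  refine ⟨fun p => s (P.proj p) (h p), fun p => ?_, fun p => hs _ _⟩
  obtain ⟨σ, hσ⟩ := P.toSubmersionOnto.exists_isLocalSection (P.proj p)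
  obtain ⟨τ, hτ⟩ := Q.toSubmersionOnto.exists_isLocalSection (P.proj p)
  have h1 := ((hQ _ τ hτ).iff.1 (hP _ σ hσ)).comp p (P.contMDiff_proj p)
  refine (hh'.contMDiffWithinAt (s := Set.univ) (b := P.proj) (P.contMDiff_proj p)
    (fun y _ => (hs _ _).1) hτ (h1.mul (hh.contMDiffAt_section hσ))
    (Filter.Eventually.of_forall fun y => ?_) trivial).contMDiffAt Filter.univ_mem
  rw [(hs _ _).2]
  simp only [Function.comp, Pi.mul_apply]
  rw [mul_assoc, mul_inv_cancel_left, mul_inv_cancel_left]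

/-- Bundles whose classes differ by a function `k` on `M` have equivariant functions with the same
class, after that of `Q` has been multiplied by `k`. -/
theorem iso_of_represents {q q' : CircleClass n M} (hP : P.Represents q) (hQ : Q.Represents q')
    (h : q - q' ∈ trivialCircleClasses n M) : P.Iso Q := by
  obtain ⟨f, hf, hP⟩ := hP
  obtain ⟨f', hf', hQ⟩ := hQ
  obtain ⟨k, hk⟩ := mem_trivialCircleClasses_iff.1 h
  let f'' : Q.Total → Circle := fun p => f' p * k (Q.proj p)
  have hf'' : Q.IsEquivariant f'' := fun c p => by
    simp only [f'']
    rw [hf', Q.proj_smul, mul_assoc]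
  have hQ' : ∀ x σ, Q.toSubmersionOnto.IsLocalSection σ x → IsCircleGerm q x (f'' ∘ σ) :=
    fun x σ hσ => by
      have h1 := (hQ x σ hσ).add (hk x)
      rw [add_sub_cancel] at h1
      refine h1.iff.2 ((contMDiffAt_const (c := (1 : Circle))).congr_of_eventuallyEq ?_)
      filter_upwards [hσ] with y hy
      have h2 : Q.proj (σ y) = y := hy.2
      simp only [Function.comp, f'']
      rw [h2, inv_mul_cancel]
  obtain ⟨φ, hφ, hφ'⟩ := exists_map hf'' hf hP hQ'
  obtain ⟨ψ, hψ, hψ'⟩ := exists_map hf hf'' hQ' hP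
  refine ⟨⟨⟨φ, ψ, fun p => hf.eq_of_eq ?_ ?_, fun p => hf''.eq_of_eq ?_ ?_⟩, hφ, hψ⟩,
    fun p => (hφ' p).1, fun c p => hf''.eq_of_eq ?_ ?_⟩
  · rw [(hψ' _).1, (hφ' _).1]
  · rw [(hψ' _).2, (hφ' _).2]
  · rw [(hφ' _).1, (hψ' _).1]
  · rw [(hφ' _).2, (hψ' _).2]
  · change Q.proj (φ (c • p)) = Q.proj (c • φ p)
    rw [(hφ' _).1, P.proj_smul, Q.proj_smul, (hφ' _).1]
  · change f'' (φ (c • p)) = f'' (c • φ p)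
    rw [(hφ' _).2, hf, hf'', (hφ' _).2]

/-! ### Products of principal bundles -/

/-- The product of `P` and `Q` is a bundle whose class is the sum of their classes. The map
`P ×_M Q → R` is the one under which the equivariant functions are multiplied. -/
theorem exists_isProduct [T2Space M] [ParacompactSpace M] (P Q : PrincipalCircleBundle n M) :
    ∃ R, P.IsProduct Q R := by
  obtain ⟨q, f, hf, hq⟩ := P.exists_represents
  obtain ⟨q', f', hf', hq'⟩ := Q.exists_represents
  obtain ⟨R, k, hk, hR⟩ := exists_principalCircleBundle_represents (q + q')
  obtain ⟨s, hs⟩ := hk.exists_point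
  refine ⟨R, fun x => s (P.proj x.1) (f x.1 * f' x.2), fun x hx => ?_, fun p p' hp =>
    ⟨(hs _ _).1, fun a b => hk.eq_of_eq ?_ ?_⟩⟩
  · have hx : P.proj x.1 = Q.proj x.2 := hx
    obtain ⟨σ, hσ⟩ := P.toSubmersionOnto.exists_isLocalSection (P.proj x.1)
    obtain ⟨σ', hσ'⟩ := Q.toSubmersionOnto.exists_isLocalSection (P.proj x.1)
    obtain ⟨τ, hτ⟩ := R.toSubmersionOnto.exists_isLocalSection (P.proj x.1)
    have hb : ContMDiffAt ((𝓡 P.dim).prod (𝓡 Q.dim)) (𝓡 n) ∞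
        (fun x : P.Total × Q.Total => P.proj x.1) x :=
      (P.contMDiff_proj x.1).comp x contMDiffAt_fst
    have h1 := ((hR _ τ hτ).iff.1 ((hq _ σ hσ).add (hq' _ σ' hσ'))).comp x hb
    have h2 : ContMDiffAt ((𝓡 P.dim).prod (𝓡 Q.dim)) (𝓡 1) ∞ _ x :=
      (hf.contMDiffAt_section hσ).comp x contMDiffAt_fst
    have h3 : ContMDiffAt ((𝓡 P.dim).prod (𝓡 Q.dim)) (𝓡 1) ∞ _ x :=
      (hf'.contMDiffAt_section (hx ▸ hσ')).comp x contMDiffAt_snd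
    refine hk.contMDiffWithinAt hb (fun y _ => (hs _ _).1) hτ (h1.mul (h2.mul h3)) ?_ hx
    filter_upwards [self_mem_nhdsWithin] with y hy
    have hy : P.proj y.1 = Q.proj y.2 := hy
    rw [(hs _ _).2]
    simp only [Function.comp, Pi.mul_apply]
    rw [← hy, mul_mul_mul_comm (f (σ (P.proj y.1)))⁻¹, mul_assoc, mul_inv_cancel_left, ← mul_inv,
      mul_inv_cancel_left]
  · rw [R.proj_smul, (hs _ _).1, (hs _ _).1, P.proj_smul]
  · rw [hk, (hs _ _).2, (hs _ _).2, hf, hf', mul_mul_mul_comm]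

theorem IsProduct.represents (hR : P.IsProduct Q R) {q q' : CircleClass n M}
    (hP : P.Represents q) (hQ : Q.Represents q') : R.Represents (q + q') := by
  obtain ⟨μ, hμs, hμ⟩ := hR
  obtain ⟨f, hf, hq⟩ := hP
  obtain ⟨f', hf', hq'⟩ := hQ
  obtain ⟨k, hk⟩ := R.exists_isEquivariant
  obtain ⟨s, hs⟩ := P.surjective_proj.hasRightInverse
  obtain ⟨s', hs'⟩ := Q.surjective_proj.hasRightInverse
  -- `l` corrects the equivariant function `k` on `R`, so that it becomes the product of `f`
  -- and `f'`.
  let l : M → Circle := fun x => (k (μ (s x, s' x)))⁻¹ * (f (s x) * f' (s' x))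
  let h : R.Total → Circle := fun r => k r * l (R.proj r)
  have hh : R.IsEquivariant h := fun c r => by
    simp only [h]
    rw [hk, R.proj_smul, mul_assoc]
  have hμh : ∀ p p', P.proj p = Q.proj p' → h (μ (p, p')) = f p * f' p' := fun p p' hp => by
    obtain ⟨a, ha⟩ := exists_smul_eq (hs (P.proj p))
    obtain ⟨b, hb⟩ := exists_smul_eq ((hs' (P.proj p)).trans hp)
    have h1 := hμ (s (P.proj p)) (s' (P.proj p)) ((hs _).trans (hs' _).symm)
    have h2 := h1.2 a b
    rw [ha, hb] at h2
    rw [h2, hh]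
    simp only [h, l]
    rw [h1.1, hs, mul_inv_cancel_left, mul_mul_mul_comm, ← hf, ← hf', ha, hb]
  refine ⟨h, hh, fun x τ hτ => ?_⟩
  obtain ⟨σ, hσ⟩ := P.toSubmersionOnto.exists_isLocalSection x
  obtain ⟨σ', hσ'⟩ := Q.toSubmersionOnto.exists_isLocalSection x
  have hmem : ∀ᶠ y in nhds x, P.proj (σ y) = Q.proj (σ' y) := by
    filter_upwards [hσ, hσ'] with y h1 h2
    exact h1.2.trans h2.2.symm
  have hsec : R.toSubmersionOnto.IsLocalSection (fun y => μ (σ y, σ' y)) x := by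
    filter_upwards [hσ.eventually, hσ'.eventually, hmem.eventually_nhds] with y h1 h2 h3
    refine ⟨?_, (hμ _ _ h3.self_of_nhds).1.trans h1.proj_eq⟩
    have h4 : ContMDiffWithinAt (𝓡 n) (𝓡 R.dim) ∞ (μ ∘ fun y => (σ y, σ' y))
        {y | P.proj (σ y) = Q.proj (σ' y)} y :=
      ContMDiffWithinAt.comp y (hμs _ h3.self_of_nhds)
        (h1.contMDiffAt.prodMk h2.contMDiffAt).contMDiffWithinAt fun z hz => hz
    exact h4.contMDiffAt h3
  refine (isPotential_gerbe hh hh).isCircleGerm (A := R.gerbe h hh) ?_ hsec hτ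
  refine ((hq x σ hσ).add (hq' x σ' hσ')).iff.2
    ((contMDiffAt_const (c := (1 : Circle))).congr_of_eventuallyEq ?_)
  filter_upwards [hmem] with y hy
  simp only [Function.comp]
  rw [hμh _ _ hy, inv_mul_cancel]

end PrincipalCircleBundle

/-! ### Connections on principal bundles -/

section Connections

variable {n : ℕ} {M : Type u} [TopologicalSpace M] [ChartedSpace (EuclideanSpace ℝ (Fin n)) M]

/-- Pulling back by a map that is the identity near `x` does not change the value of a form at
`x`. -/
theorem formPullback_of_eventuallyEq_id {τ : M → M} {x : M} (h : τ =ᶠ[nhds x] id)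
    (a : ∀ y : M, TangentSpace (𝓡 n) y →L[ℝ] ℝ) : formPullback n n τ a x = a x := by
  ext v
  have key : ∀ x', x' = x → ∀ v : EuclideanSpace ℝ (Fin n), a x' v = a x v := by
    rintro _ rfl _
    rfl
  have e : mfderiv (𝓡 n) (𝓡 n) τ x v = v := by
    rw [h.mfderiv_eq, mfderiv_id]
    rfl
  exact (key _ h.self_of_nhds _).trans (congrArg (a x) e)

variable [IsManifold (𝓡 n) ∞ M]

/-- Every class is that of a principal bundle with connection, as the connection can be prescribed
on the pieces of a local trivialisation. -/
theorem exists_connectiveZeroGerbe_represents [T2Space M] [ParacompactSpace M]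
    (q : ConnectionClass n M) : ∃ A : ConnectiveZeroGerbe n M, A.Represents q := by
  choose f a hfa using exists_isConnectionGerm q
  choose U hU hUo hmem using fun i => eventually_nhds_iff.1 (hfa i)
  obtain ⟨P, h, hh, hs⟩ := CircleCocycle.exists_principalCircleBundle
    ⟨U, hUo, hmem, f, fun {i j x} hi hj => ((hU i x hi).2.iff.1 (hU j x hj).2).1⟩
  let w : M → P.Total → Circle := fun i p => (f i (P.proj p))⁻¹ * h p
  have hw : ∀ i p, P.proj p ∈ U i → ContMDiffAt (𝓡 P.dim) (𝓡 1) ∞ (w i) p := hs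
  -- Over the neighbourhood `U i`, the connection is `π^* (a i) + d log (w i)`; these forms agree on
  -- intersections by the cocycle condition, so that the index can be taken to be the base point.
  let conn : ∀ p : P.Total, TangentSpace (𝓡 P.dim) p →L[ℝ] ℝ := fun p =>
    formPullback P.dim n P.proj (a (P.proj p)) p + circleDlog P.dim (w (P.proj p)) p
  have hconn : ∀ i p, P.proj p ∈ U i →
      conn p = formPullback P.dim n P.proj (a i) p + circleDlog P.dim (w i) p := fun i p hp => by
    have h1 := (hU _ _ (hmem (P.proj p))).2.iff.1 (hU i _ hp).2
    have h2 := h1.1.comp p (P.contMDiff_proj p)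
    have e : (fun z => ((fun y => (f (P.proj p) y)⁻¹ * f i y) ∘ P.proj) z * w i z) =
        w (P.proj p) := funext fun z => by
      simp only [Function.comp, w]
      rw [mul_assoc, mul_inv_cancel_left]
    have h3 := circleDlog_mul P.dim h2 (hw i p hp)
    rw [e, circleDlog_comp (P.contMDiff_proj p) h1.1] at h3
    have h4 : formPullback P.dim n P.proj
        (circleDlog n fun y => (f (P.proj p) y)⁻¹ * f i y) p =
        formPullback P.dim n P.proj (a i) p -
          formPullback P.dim n P.proj (a (P.proj p)) p := by
      unfold formPullback
      rw [← h1.2]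
      exact ContinuousLinearMap.sub_comp _ _ _
    change formPullback P.dim n P.proj (a (P.proj p)) p + _ = _
    rw [h3, h4, ← add_assoc, add_sub_cancel]
  have hrep : ∀ x (σ : M → P.Total), P.toSubmersionOnto.IsLocalSection σ x →
      IsConnectionGerm q x (h ∘ σ) (formPullback n P.dim σ conn) := fun x σ hσ => by
    refine (hU x x (hmem x)).2.iff.2 ?_
    have h1 : P.proj (σ x) = x := hσ.proj_eq
    have h2 : P.proj (σ x) ∈ U x := h1.symm ▸ hmem x
    have hσs : ContMDiffAt (𝓡 n) (𝓡 P.dim) ∞ σ x := hσ.contMDiffAt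
    have e : (fun y => (f x y)⁻¹ * (h ∘ σ) y) =ᶠ[nhds x] w x ∘ σ := by
      filter_upwards [hσ] with y hy
      have h3 : P.proj (σ y) = y := hy.2
      simp only [Function.comp, w]
      rw [h3]
    refine ⟨((hw x _ h2).comp x hσs).congr_of_eventuallyEq e, ?_⟩
    rw [circleDlog_congr n e, circleDlog_comp hσs (hw x _ h2)]
    have h3 : formPullback n P.dim σ conn x = formPullback n n (P.proj ∘ σ) (a x) x +
        formPullback n P.dim σ (circleDlog P.dim (w x)) x := by
      rw [formPullback_comp _ hσs (P.contMDiff_proj _)]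
      refine (congrArg (fun c => ContinuousLinearMap.comp c (mfderiv (𝓡 n) (𝓡 P.dim) σ x))
        (hconn x (σ x) h2)).trans ?_
      exact ContinuousLinearMap.add_comp _ _ _
    rw [formPullback_of_eventuallyEq_id (by filter_upwards [hσ] with y hy; exact hy.2)] at h3
    rw [h3, add_sub_cancel_left]
  let A : ConnectiveZeroGerbe n M :=
    { toBundleZeroGerbe := P.gerbe h hh
      conn := conn
      contMDiff_conn := fun p => by
        have hp := hmem (P.proj p)
        refine (contMDiffAt_covector_add (contMDiffAt_formPullback (P.contMDiff_proj p)
          (hU _ _ hp).1) (contMDiffAt_circleDlog P.dim (hw _ p hp))).congr_of_eventuallyEq ?_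
        filter_upwards [(P.contMDiff_proj.continuous.tendsto p).eventually
          ((hUo _).mem_nhds hp)] with z hz
        exact congrArg (covector P.dim z) (hconn _ z hz)
      delta_conn := fun y₁ y₂ hy => by
        have hy : P.proj y₁ = P.proj y₂ := hy
        have h1 := hmem (P.proj y₁)
        have h2 : P.proj y₂ ∈ U (P.proj y₁) := hy ▸ h1
        have hg : ∀ z₁ z₂ : P.Total, P.proj z₁ = P.proj z₂ →
            (h z₁)⁻¹ * h z₂ = (w (P.proj y₁) z₁)⁻¹ * w (P.proj y₁) z₂ := fun z₁ z₂ hz => by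
          simp only [w]
          rw [← hz, mul_inv, inv_inv, mul_mul_mul_comm, mul_inv_cancel, one_mul]
        exact (P.gerbe h hh).exists_hasMFDerivWithinAt_of_circleDlog hy (a (P.proj y₁))
          (hw _ y₁ h1) (hw _ y₂ h2)
          (Filter.Eventually.of_forall fun x z₁ z₂ hz₁ hz₂ => hg z₁ z₂ (hz₁.trans hz₂.symm))
          (hconn _ y₁ h1) (hconn _ y₂ h2) }
  exact ⟨A, h, PrincipalCircleBundle.isPotential_gerbe hh hh, hrep⟩

end Connections

/-! ### The classification -/

/-- Every class is that of the bundle 0-gerbe of a principal bundle. -/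
theorem exists_bundleZeroGerbe_represents {n : ℕ} {M : Type u} [TopologicalSpace M]
    [ChartedSpace (EuclideanSpace ℝ (Fin n)) M] [IsManifold (𝓡 n) ∞ M] [T2Space M]
    [ParacompactSpace M] (q : CircleClass n M) : ∃ A : BundleZeroGerbe n M, A.Represents q := by
  obtain ⟨P, hP⟩ := PrincipalCircleBundle.exists_principalCircleBundle_represents q
  obtain ⟨h, hh⟩ := P.exists_isEquivariant
  exact ⟨_, hP.gerbe hh⟩

/-- The isomorphism classes of principal bundles form the group of their cocycle classes. -/
theorem exists_commGroup_isoClass (n : ℕ) (M : Type u) [TopologicalSpace M]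
    [ChartedSpace (EuclideanSpace ℝ (Fin n)) M] [IsManifold (𝓡 n) ∞ M] [T2Space M]
    [ParacompactSpace M] : ∃ _ : CommGroup (PrincipalCircleBundle.IsoClass n M),
      (∀ P Q R : PrincipalCircleBundle n M, P.IsProduct Q R →
        R.isoClass = P.isoClass * Q.isoClass) ∧
      Nonempty (PrincipalCircleBundle.IsoClass n M ≃*
        Multiplicative (CircleClass n M ⧸ trivialCircleClasses n M)) := by
  choose c hc using PrincipalCircleBundle.exists_represents (n := n) (M := M)
  have hΦ : ∀ {P : PrincipalCircleBundle n M} {q}, P.Represents q →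
      ((c P : CircleClass n M) : CircleClass n M ⧸ trivialCircleClasses n M) = q :=
    fun {P q} h => by
      rw [QuotientAddGroup.eq, neg_add_eq_sub]
      exact h.sub_mem (hc P)
  let e : PrincipalCircleBundle.IsoClass n M ≃
      Multiplicative (CircleClass n M ⧸ trivialCircleClasses n M) := Equiv.ofBijective
    (Quotient.lift (fun P => Multiplicative.ofAdd
      ((c P : CircleClass n M) : CircleClass n M ⧸ trivialCircleClasses n M)) fun P Q h =>
        congrArg Multiplicative.ofAdd (hΦ (PrincipalCircleBundle.Iso.represents h (hc Q)))) (by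
    constructor
    · rintro ⟨P⟩ ⟨Q⟩ h
      refine Quotient.sound (PrincipalCircleBundle.iso_of_represents (hc P) (hc Q) ?_)
      have h' := (QuotientAddGroup.eq (s := trivialCircleClasses n M)).1
        (Multiplicative.ofAdd.injective h)
      rw [neg_add_eq_sub, ← neg_sub] at h'
      exact neg_mem_iff.1 h'
    · intro x
      obtain ⟨q, hq⟩ := QuotientAddGroup.mk_surjective x.toAdd
      obtain ⟨P, hP⟩ := PrincipalCircleBundle.exists_principalCircleBundle_represents q
      exact ⟨P.isoClass, congrArg Multiplicative.ofAdd ((hΦ hP).trans hq)⟩)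
  refine ⟨e.commGroup, fun P Q R h => ?_, ⟨e.mulEquiv⟩⟩
  exact e.injective ((congrArg Multiplicative.ofAdd (hΦ (h.represents (hc P) (hc Q)))).trans
    (e.apply_symm_apply _).symm)

theorem mainTheorem3 (n : ℕ) (M : Type u) [TopologicalSpace M]
    [ChartedSpace (EuclideanSpace ℝ (Fin n)) M] [IsManifold (𝓡 n) ∞ M] [T2Space M]
    [ParacompactSpace M] :
    -- bundle 0-gerbes: products exist, and `A`, `B` are in the same stable isomorphism class
    -- if and only if `A ⊗ B⁻¹` is trivial
    (∀ A B : BundleZeroGerbe n M, ∃ C, A.IsProduct B C) ∧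
    (∀ A B : BundleZeroGerbe n M,
      A.stableClass = B.stableClass ↔ ∃ C, A.IsProduct B.dual C ∧ C.IsTrivial) ∧
    -- products of principal `U(1)`-bundles exist
    (∀ P Q : PrincipalCircleBundle n M, ∃ R, P.IsProduct Q R) ∧
    -- the group of stable isomorphism classes, and the three isomorphisms
    (∃ _ : CommGroup (BundleZeroGerbe.StableClass n M),
      (∀ A B C : BundleZeroGerbe n M, A.IsProduct B C →
        C.stableClass = A.stableClass * B.stableClass) ∧
      (∀ A : BundleZeroGerbe n M, A.stableClass = 1 ↔ A.IsTrivial) ∧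
      (∀ A : BundleZeroGerbe n M, A.dual.stableClass = A.stableClass⁻¹) ∧
      Nonempty (BundleZeroGerbe.StableClass n M ≃*
        Multiplicative (Sheaf.H (smoothCircleSheaf n M) 1)) ∧
      Nonempty (BundleZeroGerbe.StableClass n M ≃*
        Multiplicative (Sheaf.H (integerSheaf M) 2)) ∧
      ∃ _ : CommGroup (PrincipalCircleBundle.IsoClass n M),
        (∀ P Q R : PrincipalCircleBundle n M, P.IsProduct Q R →
          R.isoClass = P.isoClass * Q.isoClass) ∧
        Nonempty (BundleZeroGerbe.StableClass n M ≃* PrincipalCircleBundle.IsoClass n M)) ∧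
    -- bundle 0-gerbes with connection
    (∀ A B : ConnectiveZeroGerbe n M, ∃ C, A.IsProduct B C) ∧
    (∀ A B : ConnectiveZeroGerbe n M,
      A.dStableClass = B.dStableClass ↔ ∃ C, A.IsProduct B.dual C ∧ C.IsDTrivial) ∧
    (∃ _ : CommGroup (ConnectiveZeroGerbe.DStableClass n M),
      (∀ A B C : ConnectiveZeroGerbe n M, A.IsProduct B C →
        C.dStableClass = A.dStableClass * B.dStableClass) ∧
      (∀ A : ConnectiveZeroGerbe n M, A.dStableClass = 1 ↔ A.IsDTrivial) ∧
      (∀ A : ConnectiveZeroGerbe n M, A.dual.dStableClass = A.dStableClass⁻¹) ∧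
      Nonempty (ConnectiveZeroGerbe.DStableClass n M ≃*
        Multiplicative (Hypercohomology M (deligneComplex n M) 1))) := by
  obtain ⟨h₁, inst, hprod, hone, hinv, e, -⟩ := exists_commGroup_quot
    (R := BundleZeroGerbe.StableIso (n := n) (M := M)) BundleZeroGerbe.exists_represents
    exists_bundleZeroGerbe_represents BundleZeroGerbe.Represents.sub_mem
    BundleZeroGerbe.IsProduct.represents BundleZeroGerbe.Represents.dual
    BundleZeroGerbe.isTrivial_iff_represents BundleZeroGerbe.exists_isProduct
    (fun {A B} h => by
      obtain ⟨T, C, hT, hC, φ, hφ⟩ := h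
      exact ⟨T, C, hT, hC, fun q => hφ.represents⟩)
    BundleZeroGerbe.stableIso_exchange
  obtain ⟨h₂, inst', hprod', hone', hinv', e', -⟩ := exists_commGroup_quot
    (R := ConnectiveZeroGerbe.DStableIso (n := n) (M := M)) ConnectiveZeroGerbe.exists_represents
    exists_connectiveZeroGerbe_represents ConnectiveZeroGerbe.Represents.sub_mem
    ConnectiveZeroGerbe.IsProduct.represents ConnectiveZeroGerbe.Represents.dual
    ConnectiveZeroGerbe.isDTrivial_iff_represents ConnectiveZeroGerbe.exists_isProduct
    (fun {A B} h => by
      obtain ⟨T, C, hT, hC, φ, hφ⟩ := h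
      exact ⟨T, C, hT, hC, fun q => hφ.represents⟩)
    ConnectiveZeroGerbe.dStableIso_exchange
  obtain ⟨a⟩ := nonempty_H_one_equiv_circleClass n M
  obtain ⟨b⟩ := nonempty_H_one_smoothCircleSheaf_equiv n M
  obtain ⟨d⟩ := nonempty_hypercohomology_equiv_connectionClass n M
  obtain ⟨inst'', hprod'', ⟨e''⟩⟩ := exists_commGroup_isoClass n M
  have a' := e.trans (AddEquiv.toMultiplicative a.symm)
  exact ⟨BundleZeroGerbe.exists_isProduct, h₁, PrincipalCircleBundle.exists_isProduct,
    ⟨inst, hprod, hone, hinv, ⟨a'⟩, ⟨a'.trans (AddEquiv.toMultiplicative b)⟩,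
      inst'', hprod'', ⟨e.trans e''.symm⟩⟩,
    ConnectiveZeroGerbe.exists_isProduct, h₂,
    ⟨inst', hprod', hone', hinv', ⟨e'.trans (AddEquiv.toMultiplicative d.symm)⟩⟩⟩
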